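/- **Setting.** Let $d_1,d_2\ge 1$, $\tilde d=d_1+d_2$, and consider $\min_{x\in\mathcal X}\max_{y\in\mathcal Y} f(x,y)=\mathbb E_{\xi\sim\mathcal D}[f(x,y;\xi)]$ with $\mathcal X\subset\mathbb R^{d_1}$, $\mathcal Y\subset\mathbb R^{d_2}$ nonempty, compact and convex. Let $0<\tau\le L_f$ and $\delta>0$, and put $\kappa_y=L_f/\tau$, $L_g=L_f+L_f^2/\tau$. Assume that * for some $r>\max(\mu_1,\mu_2)$, on the product of the open $r$-neighbourhoods of $\mathcal X$ and $\mathcal Y$, each $f(\cdot,\cdot;\xi)$ is differentiable with $L_f$-Lipschitz gradient and $f(x,y;\cdot)$ is integrable (this holds for instance if the $f(\cdot,\cdot;\xi)$ are $L_f$-smooth on the whole space); * $f(x,\cdot)$ is $\tau$-strongly concave on $\mathcal Y$ for each $x\in\mathcal X$; write $y^*(x)=\arg\max_{y\in\mathcal Y}f(x,y)$ and $g(x)=f(x,y^*(x))$; * for $u$ uniform on the unit sphere, the estimators $\hat\nabla_xf(x,y;\xi)=\frac{f(x+\mu_1u,y;\xi)-f(x,y;\xi)}{\mu_1/d_1}u$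 and $\hat\nabla_yf(x,y;\xi)=\frac{f(x,y+\mu_2u;\xi)-f(x,y;\xi)}{\mu_2/d_2}u$ satisfy $\mathbb E\|\hat\nabla_xf(x,y;\xi)-\nabla_xf_{\mu_1}(x,y)\|^2\le\delta^2$ and $\mathbb E\|\hat\nabla_yf(x,y;\xi)-\nabla_yf_{\mu_2}(x,y)\|^2\le\delta^2$ on $\mathcal X\times\mathcal Y$, where $f_{\mu_1}(x,y)=\mathbb E_{u}f(x+\mu_1u,y)$ and $f_{\mu_2}(x,y)=\mathbb E_uf(x,y+\mu_2u)$ with $u$ uniform in the unit ball. **Algorithm (Acc-ZOMDA).** Given $x_1\in\mathcal X$ and $y_1=y^*(x_1)$, at each time draw independently a mini-batch $\mathcal B_t$ of $b$ independent triples ($\xi_i\sim\mathcal D$ and two independent directions, uniform on the unit spheres of $\mathbb R^{d_1}$ and $\mathbb R^{d_2}$), and let $\hat\nabla_xf(\cdot;\mathcal B_t)$, $\hat\nabla_yf(\cdot;\mathcal B_t)$ be the averages of the $b$ one-sample estimators. Set $v_1=\hat\nabla_xf(x_1,y_1;\mathcal B_1)$, $w_1=\hat\nabla_yf(x_1,y_1;\mathcal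 B_1)$. For $t=1,\dots,T$, with $\eta_t=k/(m+t)^{1/3}$, let $\tilde x_{t+1}=\mathcal P_{\mathcal X}(x_t-\gamma v_t)$, $x_{t+1}=x_t+\eta_t(\tilde x_{t+1}-x_t)$, $\tilde y_{t+1}=\mathcal P_{\mathcal Y}(y_t+\lambda w_t)$, $y_{t+1}=y_t+\eta_t(\tilde y_{t+1}-y_t)$, $$v_{t+1}=\hat\nabla_xf(x_{t+1},y_{t+1};\mathcal B_{t+1})+(1-c_1\eta_t^2)\big[v_t-\hat\nabla_xf(x_t,y_t;\mathcal B_{t+1})\big],$$ $$w_{t+1}=\hat\nabla_yf(x_{t+1},y_{t+1};\mathcal B_{t+1})+(1-c_2\eta_t^2)\big[w_t-\hat\nabla_yf(x_t,y_t;\mathcal B_{t+1})\big].$$ The output index $\zeta$ is uniform on $\{1,\dots,T\}$, independent of the samples. Let $$\mathcal H_t=\tfrac1\gamma\|\tilde x_{t+1}-x_t\|+\|\nabla_xf(x_t,y_t)-v_t\|+L_f\|y_t-y^*(x_t)\|;$$ the output is an $\epsilon$-stationary point if $\mathbb E[\mathcal H_\zeta]\le\epsilon$. The query complexity is the number of evaluations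 of $f(x,y;\xi)$. **Parameters.** Let $k>0$, $c_1\ge\frac2{3k^3}+\frac{9\tau^2}4$, $c_2\ge\frac2{3k^3}+\frac{625\tilde dL_f^2}{3b}$, $m\ge\max(2,k^3,(c_1k)^3,(c_2k)^3)$, $0<\lambda\le\min(\frac1{6L_f},\frac{75\tau}{24})$, $0<\gamma\le\min\Big(\frac{\lambda\tau}{2L_f}\sqrt{\frac{6b/\tilde d}{36\lambda^2+625\kappa_y^2}},\frac{m^{1/3}}{2L_gk}\Big)$, $0<\mu_1\le\frac1{d_1(m+T)^{2/3}}$, $0<\mu_2\le\frac1{\tilde d^{1/2}d_2(m+T)^{2/3}}$, and take the mini-batch size $b=\lceil\tilde d^{3/5}\rceil$. **Claim.** There is a universal $p\in\mathbb N$ such that for every $K\ge1$ there is $C=C(K)>0$ with the following property. Suppose that $k,L_f\in[1/K,K]$, that $c_1,c_2,m$ are at most $K$ times, and $\gamma$ is at least $1/K$ times, the bounds displayed above, and that $0<\epsilon\le K\kappa_y\tilde d^{-3/10}$. Then there is a number of iterations $T\ge1$ such that for every problem as above with $\delta\le K$ and $g(x_1)-\inf_{\mathcal X}g\le K$, Acc-ZOMDA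 run for $T$ iterations satisfies $\mathbb E[\mathcal H_\zeta]\le\epsilon$ (in particular $\mathcal H_\zeta$ is integrable) and makes at most $$C\,\lambda^{-3/2}\;\tilde d^{9/10}\,\kappa_y^3\,\epsilon^{-3}\,\Big(\log\big(2+\tfrac{\tilde d\kappa_y}{\lambda\epsilon}\big)\Big)^p$$ function-value queries. Thus, with the factor $\lambda^{-3/2}$ counted among the constants ($\lambda$ of constant order), the query complexity is $\tilde O\big((d_1+d_2)^{9/10}\kappa_y^3\epsilon^{-3}\big)$. -/

import Mathlib

open MeasureTheory ProbabilityTheory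

noncomputable section

namespace AccZOMDA

/-- Euclidean space of dimension `d`, with the `ℓ²` norm. -/
abbrev E (d : ℕ) : Type := EuclideanSpace ℝ (Fin d)

/-! ### Sampling distributions and argmin / argmax -/

/-- Uniform probability distribution on the unit sphere of `E d` (for `0 < d`). -/
def sphereUniform (d : ℕ) : Measure (E d) :=
  ((volume : Measure (E d)).toSphere[|Set.univ]).map Subtype.val

/-- Uniform probability distribution on the closed unit ball of `E d`. -/
def ballUniform (d : ℕ) : Measure (E d) :=
  (volume : Measure (E d))[|Metric.closedBall 0 1]

/-- Projection `argmin_{x ∈ S} ½ ‖x - x₀‖²` (the minimizer exists and is unique when `S` is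
nonempty, closed and convex). -/
def proj {d : ℕ} (S : Set (E d)) (x₀ : E d) : E d :=
  Classical.epsilon fun x => x ∈ S ∧ IsMinOn (fun z => (1 / 2 : ℝ) * ‖z - x₀‖ ^ 2) S x

/-! ### The stochastic minimax problem -/

/-- Data of `min_{x ∈ X} max_{y ∈ Y} E_{ξ ∼ law} [loss x y ξ]`. -/
structure Problem (d₁ d₂ : ℕ) (Ξ : Type*) [MeasurableSpace Ξ] where
  loss : E d₁ → E d₂ → Ξ → ℝ
  law : Measure Ξ
  X : Set (E d₁)
  Y : Set (E d₂)

namespace Problem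

variable {d₁ d₂ : ℕ} {Ξ : Type*} [MeasurableSpace Ξ] (P : Problem d₁ d₂ Ξ)

/-- The objective `f(x, y) = E_ξ f(x, y; ξ)`. -/
def F (x : E d₁) (y : E d₂) : ℝ := ∫ ξ, P.loss x y ξ ∂P.law

/-- `y*(x) = argmax_{y ∈ Y} f(x, y)`. -/
def ystar (x : E d₁) : E d₂ :=
  Classical.epsilon fun y => y ∈ P.Y ∧ IsMaxOn (fun z => P.F x z) P.Y y

/-- `g(x) = max_{y ∈ Y} f(x, y) = f(x, y*(x))`. -/
def g (x : E d₁) : ℝ := P.F x (P.ystar x)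

/-- The smoothing `f_{μ₁}(x, y) = E_u f(x + μ₁ u, y)`, `u` uniform in the unit ball. -/
def smoothX (μ₁ : ℝ) (x : E d₁) (y : E d₂) : ℝ :=
  ∫ u, P.F (x + μ₁ • u) y ∂ballUniform d₁

/-- The smoothing `f_{μ₂}(x, y) = E_u f(x, y + μ₂ u)`, `u` uniform in the unit ball. -/
def smoothY (μ₂ : ℝ) (x : E d₁) (y : E d₂) : ℝ :=
  ∫ u, P.F x (y + μ₂ • u) ∂ballUniform d₂

end Problem

/-! ### Computations that count their function-value queries -/

/-- A value together with the number of function-value queries spent on it. -/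
structure Counted (α : Type) where
  val : α
  queries : ℕ

instance : Monad Counted where
  pure a := ⟨a, 0⟩
  bind m k := ⟨(k m.val).val, m.queries + (k m.val).queries⟩

/-- Average of `b` counted vectors. -/
def batchMean {d b : ℕ} (G : Fin b → Counted (E d)) : Counted (E d) :=
  ⟨(b : ℝ)⁻¹ • ∑ i, (G i).val, ∑ i, (G i).queries⟩

/-- A mini-batch: `b` triples `(ξᵢ, ûᵢ, ũᵢ)`. -/
abbrev Batch (d₁ d₂ : ℕ) (Ξ : Type*) (b : ℕ) : Type _ := Fin b → Ξ × E d₁ × E d₂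

/-- The distribution of a mini-batch: all components are independent, `ξᵢ ∼ law`, and `ûᵢ`, `ũᵢ`
are uniform on the unit spheres of `E d₁`, `E d₂`. -/
def batchLaw {d₁ d₂ : ℕ} {Ξ : Type*} [MeasurableSpace Ξ] (P : Problem d₁ d₂ Ξ) (b : ℕ) :
    Measure (Batch d₁ d₂ Ξ b) :=
  Measure.pi fun _ => P.law.prod ((sphereUniform d₁).prod (sphereUniform d₂))

namespace Problem

variable {d₁ d₂ : ℕ} {Ξ : Type*} [MeasurableSpace Ξ] (P : Problem d₁ d₂ Ξ)

/-- One call to the black box: the value `f(x, y; ξ)`. -/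
def query (x : E d₁) (y : E d₂) (ξ : Ξ) : Counted ℝ := ⟨P.loss x y ξ, 1⟩

/-- One-sample estimator of the partial gradient in `x`:
`(f(x + μ₁ u, y; ξ) - f(x, y; ξ)) / (μ₁ / d₁) • u`. -/
def estX (μ₁ : ℝ) (x : E d₁) (y : E d₂) (ξ : Ξ) (u : E d₁) : Counted (E d₁) := do
  let a ← P.query (x + μ₁ • u) y ξ
  let c ← P.query x y ξ
  pure (((a - c) / (μ₁ / (d₁ : ℝ))) • u)

/-- One-sample estimator of the partial gradient in `y`:
`(f(x, y + μ₂ u; ξ) - f(x, y; ξ)) / (μ₂ / d₂) • u`. -/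
def estY (μ₂ : ℝ) (x : E d₁) (y : E d₂) (ξ : Ξ) (u : E d₂) : Counted (E d₂) := do
  let a ← P.query x (y + μ₂ • u) ξ
  let c ← P.query x y ξ
  pure (((a - c) / (μ₂ / (d₂ : ℝ))) • u)

/-- Mini-batch estimator of the partial gradient in `x`. -/
def gradX {b : ℕ} (μ₁ : ℝ) (x : E d₁) (y : E d₂) (B : Batch d₁ d₂ Ξ b) : Counted (E d₁) :=
  batchMean fun i => P.estX μ₁ x y (B i).1 (B i).2.1

/-- Mini-batch estimator of the partial gradient in `y`. -/
def gradY {b : ℕ} (μ₂ : ℝ) (x : E d₁) (y : E d₂) (B : Batch d₁ d₂ Ξ b) : Counted (E d₂) :=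
  batchMean fun i => P.estY μ₂ x y (B i).1 (B i).2.2

end Problem

/-! ### The algorithm -/

/-- Parameters of Acc-ZOMDA (`lam` is the step size `λ` of the ascent variable). -/
structure Params where
  k : ℝ
  m : ℝ
  c₁ : ℝ
  c₂ : ℝ
  γ : ℝ
  lam : ℝ

/-- `η_t = k / (m + t)^{1/3}`. -/
def Params.η (q : Params) (t : ℕ) : ℝ := q.k / (q.m + t) ^ (1 / 3 : ℝ)

/-- The variables `(x_t, y_t, v_t, w_t)` at the start of iteration `t`. -/
structure State (d₁ d₂ : ℕ) where
  x : E d₁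
  y : E d₂
  v : E d₁
  w : E d₂

namespace Problem

variable {d₁ d₂ : ℕ} {Ξ : Type*} [MeasurableSpace Ξ] (P : Problem d₁ d₂ Ξ)

/-- `x̃_{t+1} = 𝒫_X (x_t - γ v_t)`. -/
def xtilde (γ : ℝ) (s : State d₁ d₂) : E d₁ := proj P.X (s.x - γ • s.v)

/-- `ỹ_{t+1} = 𝒫_Y (y_t + λ w_t)`. -/
def ytilde (lam : ℝ) (s : State d₁ d₂) : E d₂ := proj P.Y (s.y + lam • s.w)

/-- Initialization from the first mini-batch. -/
def initState {b : ℕ} (μ₁ μ₂ : ℝ) (x₁ : E d₁) (y₁ : E d₂) (B : Batch d₁ d₂ Ξ b) :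
    Counted (State d₁ d₂) := do
  let v ← P.gradX μ₁ x₁ y₁ B
  let w ← P.gradY μ₂ x₁ y₁ B
  pure ⟨x₁, y₁, v, w⟩

/-- Iteration `t`: from `(x_t, y_t, v_t, w_t)` and the mini-batch `B_{t+1}` to
`(x_{t+1}, y_{t+1}, v_{t+1}, w_{t+1})`, with `α_{t+1} = c₁ η_t²` and `β_{t+1} = c₂ η_t²`. -/
def step {b : ℕ} (q : Params) (μ₁ μ₂ : ℝ) (t : ℕ) (B : Batch d₁ d₂ Ξ b) (s : State d₁ d₂) :
    Counted (State d₁ d₂) := do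
  let x' := s.x + q.η t • (P.xtilde q.γ s - s.x)
  let y' := s.y + q.η t • (P.ytilde q.lam s - s.y)
  let α := q.c₁ * q.η t ^ 2
  let β := q.c₂ * q.η t ^ 2
  let a ← P.gradX μ₁ x' y' B
  let a' ← P.gradX μ₁ s.x s.y B
  let c ← P.gradY μ₂ x' y' B
  let c' ← P.gradY μ₂ s.x s.y B
  pure ⟨x', y', a + (1 - α) • (s.v - a'), c + (1 - β) • (s.w - c')⟩

/-- The state after `n` iterations, that is `(x_{n+1}, y_{n+1}, v_{n+1}, w_{n+1})`, with all queries
made so far; the mini-batch `B_{t+1}` is `S t`. -/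
def run {b : ℕ} (q : Params) (μ₁ μ₂ : ℝ) (x₁ : E d₁) (y₁ : E d₂) (S : ℕ → Batch d₁ d₂ Ξ b) :
    ℕ → Counted (State d₁ d₂)
  | 0 => P.initState μ₁ μ₂ x₁ y₁ (S 0)
  | n + 1 => do
    let s ← run q μ₁ μ₂ x₁ y₁ S n
    P.step q μ₁ μ₂ (n + 1) (S (n + 1)) s

/-- The stationarity measure
`H_t = ‖x̃_{t+1} - x_t‖ / γ + ‖∇ₓ f(x_t, y_t) - v_t‖ + L ‖y_t - y*(x_t)‖`. -/
def stationarity (L γ : ℝ) (s : State d₁ d₂) : ℝ :=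
  1 / γ * ‖P.xtilde γ s - s.x‖ + ‖gradient (fun x => P.F x s.y) s.x - s.v‖
    + L * ‖s.y - P.ystar s.x‖

/-! ### Assumptions on the problem -/

/-- The standing assumptions. The component functions are differentiable with `L`-Lipschitz gradient
on a product of open neighbourhoods of `X` and `Y` that contains the points at which the algorithm
evaluates them (in particular this holds if they are `L`-smooth on the whole space); `f(x, ·)` is
`τ`-strongly concave on `Y` for `x ∈ X`; the one-sample zeroth-order gradients have variance at most
`δ²` on `X × Y`. -/
structure Assumptions (L τ δ μ₁ μ₂ : ℝ) : Prop where
  prob : IsProbabilityMeasure P.law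
  compactX : IsCompact P.X
  convexX : Convex ℝ P.X
  compactY : IsCompact P.Y
  convexY : Convex ℝ P.Y
  nonemptyY : P.Y.Nonempty
  measurable_loss : Measurable fun p : (E d₁ × E d₂) × Ξ => P.loss p.1.1 p.1.2 p.2
  smooth : ∃ r : ℝ, μ₁ < r ∧ μ₂ < r ∧
    (∀ x ∈ Metric.thickening r P.X, ∀ y ∈ Metric.thickening r P.Y,
      Integrable (P.loss x y) P.law) ∧
    (∀ ξ, ∀ x ∈ Metric.thickening r P.X, ∀ y ∈ Metric.thickening r P.Y,
      DifferentiableAt ℝ (fun z : E d₁ × E d₂ => P.loss z.1 z.2 ξ) (x, y)) ∧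
    (∀ ξ, ∀ x ∈ Metric.thickening r P.X, ∀ x' ∈ Metric.thickening r P.X,
      ∀ y ∈ Metric.thickening r P.Y, ∀ y' ∈ Metric.thickening r P.Y,
      ‖gradient (fun z => P.loss z y ξ) x - gradient (fun z => P.loss z y' ξ) x'‖ ^ 2
        + ‖gradient (fun z => P.loss x z ξ) y - gradient (fun z => P.loss x' z ξ) y'‖ ^ 2
        ≤ L ^ 2 * (‖x - x'‖ ^ 2 + ‖y - y'‖ ^ 2))
  concave : ∀ x ∈ P.X, StrongConcaveOn P.Y τ (P.F x)
  varianceX : ∀ x ∈ P.X, ∀ y ∈ P.Y,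
    ∫⁻ s, ENNReal.ofReal
        (‖(P.estX μ₁ x y s.1 s.2).val - gradient (fun z => P.smoothX μ₁ z y) x‖ ^ 2)
      ∂(P.law.prod (sphereUniform d₁)) ≤ ENNReal.ofReal (δ ^ 2)
  varianceY : ∀ x ∈ P.X, ∀ y ∈ P.Y,
    ∫⁻ s, ENNReal.ofReal
        (‖(P.estY μ₂ x y s.1 s.2).val - gradient (fun z => P.smoothY μ₂ x z) y‖ ^ 2)
      ∂(P.law.prod (sphereUniform d₂)) ≤ ENNReal.ofReal (δ ^ 2)

end Problem

/-! ### Conditions on the parameters -/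

/-- Lower bound for `c₁`. -/
def c₁Min (k τ : ℝ) : ℝ := 2 / (3 * k ^ 3) + 9 * τ ^ 2 / 4

/-- Lower bound for `c₂`; `D` is the total dimension `d₁ + d₂`. -/
def c₂Min (k L D b : ℝ) : ℝ := 2 / (3 * k ^ 3) + 625 * D * L ^ 2 / (3 * b)

/-- Lower bound for `m`. -/
def mMin (k c₁ c₂ : ℝ) : ℝ := max (max 2 (k ^ 3)) (max ((c₁ * k) ^ 3) ((c₂ * k) ^ 3))

/-- Upper bound for `γ`, with `κ = L / τ` and `L_g = L + L² / τ`. -/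
def γMax (k m lam L τ D b : ℝ) : ℝ :=
  min (lam * τ / (2 * L) * Real.sqrt ((6 * b / D) / (36 * lam ^ 2 + 625 * (L / τ) ^ 2)))
    (m ^ (1 / 3 : ℝ) / (2 * (L + L ^ 2 / τ) * k))

/-- The admissible range of the parameters. -/
structure Params.Admissible (q : Params) (L τ D b : ℝ) : Prop where
  k_pos : 0 < q.k
  le_c₁ : c₁Min q.k τ ≤ q.c₁
  le_c₂ : c₂Min q.k L D b ≤ q.c₂
  le_m : mMin q.k q.c₁ q.c₂ ≤ q.m
  lam_pos : 0 < q.lam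
  lam_le : q.lam ≤ min (1 / (6 * L)) (75 * τ / 24)
  γ_pos : 0 < q.γ
  γ_le : q.γ ≤ γMax q.k q.m q.lam L τ D b

/-- The parameters are of the order of their admissible bounds: `k` is of constant order, and
`c₁`, `c₂`, `m` and `γ` are within the factor `K` of their bounds. -/
structure Params.OfOrder (q : Params) (K L τ D b : ℝ) : Prop where
  le_k : 1 / K ≤ q.k
  k_le : q.k ≤ K
  c₁_le : q.c₁ ≤ K * c₁Min q.k τ
  c₂_le : q.c₂ ≤ K * c₂Min q.k L D b
  m_le : q.m ≤ K * mMin q.k q.c₁ q.c₂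
  le_γ : γMax q.k q.m q.lam L τ D b / K ≤ q.γ

end AccZOMDA

end

/-! The proof is a Lyapunov argument for the iterates, followed by a choice of `T`.

Three recursions drive one iteration. First, `g_step_le`: the primal function `g` has a quadratic
upper bound with constant `L + L²/τ`, so a projected step lowers `g` by a multiple of `‖x̃ - x‖²`,
up to the squared distance of `y` to `y*(x)` and the squared error of `v`. Second,
`norm_sub_ystar_step_le`: strong concavity makes the projected ascent step contract the squared
distance to `y*(x)` by the factor `1 - ητλ/4`, up to the squared error of `w` and the displacement
of the maximizer, which is `L/τ`-Lipschitz in `x`. Third, `integral_recursive_momentum_sq_le`: the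
squared errors of `v` and `w` contract by `1 - cη²`. Since old and new points are evaluated on the
same mini-batch, the fresh noise is only the mean-square change of the estimator plus `c²η⁴` times
its variance, divided by `b`.

Two facts about finite differences enter. On the sphere the mean of `⟪a, u⟫²` is `‖a‖²/d`, so the
mean-square Lipschitz constant of the estimator grows linearly, not quadratically, in `d`
(`integral_norm_fdEst_sub_sq_le`). The errors are measured from the mean of the estimator, whose
distance to the true gradient is at most `dLμ/2` (`norm_integral_fdEst_sub_le`); this bias is a
deterministic perturbation.

The potential adds to `g` the tracking error with weight `weightY` and the estimation errors with
weight `weightV / η`. The factor `1 / η` turns a contraction of order `η²` into a decrease of order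
`η`; the growth of this weight is absorbed by the term `2/(3k³)` in the bounds for `c₁` and `c₂`.
With these weights all unwanted terms cancel (`potential_arith`), leaving a decrease `η` times
`progress`. Up to bias, `progress` dominates `γ` times the squared stationarity measure
(`stationarity_le_progress`), so summation gives a bound on the average expected stationarity
(`integral_stationarity_le`).

For the count put `D = d₁ + d₂`, `s = D^(1/10)`, `κ = L/τ`. Then `b ~ s⁶`, `c₂` and `m^(1/3)` are of
order at most `s⁴`, and `1/γ` of order at most `κ²s²/λ`. The accumulated error divided by `γ` is at
most of order `κ²s²/λ` times a logarithm (`errorBound_le`). With `u = κs/(√λ ε)`, taking `T` to be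
about the cube of a large multiple of `u` times a logarithm makes the error small enough
(`exists_iterations`), and `bT` is then about `s⁹κ³λ^(-3/2)ε⁻³`, the claimed rate. -/

namespace AccZOMDA

open scoped RealInnerProductSpace Pointwise

/-! ### Moments of the uniform distribution on the sphere -/

section Sphere

variable {d : ℕ}

lemma isProbabilityMeasure_sphereUniform (hd : 0 < d) :
    IsProbabilityMeasure (sphereUniform d) := by
  have : Nonempty (Fin d) := ⟨⟨0, hd⟩⟩
  have : Nontrivial (E d) := inferInstance
  have h0 : ((volume : Measure (E d)).toSphere) Set.univ ≠ 0 := by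
    rw [Ne, Measure.measure_univ_eq_zero]
    exact Measure.toSphere_ne_zero _
  have := cond_isProbabilityMeasure h0
  exact Measure.isProbabilityMeasure_map measurable_subtype_coe.aemeasurable

lemma ae_norm_eq_one : ∀ᵐ u ∂sphereUniform d, ‖u‖ = 1 := by
  rw [sphereUniform, ae_map_iff measurable_subtype_coe.aemeasurable
    (measurableSet_eq_fun measurable_norm measurable_const)]
  exact Filter.Eventually.of_forall fun u => by simp

/-- The spherical measure of a set is proportional to the volume of the cone over it, and a linear
isometry maps cones to cones and preserves volume. -/
lemma map_sphereUniform (T : E d ≃ₗᵢ[ℝ] E d) :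
    (sphereUniform d).map T = sphereUniform d := by
  ext s hs
  have hT : Measurable T := T.continuous.measurable
  have key : ∀ s : Set (E d), MeasurableSet s → sphereUniform d s =
      ((volume : Measure (E d)).toSphere Set.univ)⁻¹ * ((Module.finrank ℝ (E d) : ENNReal) *
        volume (Set.Ioo (0 : ℝ) 1 • (s ∩ Metric.sphere 0 1))) := by
    intro s hs
    rw [sphereUniform, Measure.map_apply measurable_subtype_coe hs, cond_apply MeasurableSet.univ,
      Set.univ_inter, Measure.toSphere_apply' _ (measurable_subtype_coe hs),
      Subtype.image_preimage_coe, Set.inter_comm]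
  rw [Measure.map_apply hT hs, key _ (hT hs), key _ hs]
  congr 2
  rw [← T.measurePreserving.measure_preimage_emb T.toHomeomorph.measurableEmbedding
    (Set.Ioo (0 : ℝ) 1 • (s ∩ Metric.sphere 0 1))]
  congr 1
  ext z
  simp only [Set.mem_smul, Set.mem_inter_iff, Set.mem_preimage, mem_sphere_zero_iff_norm]
  constructor
  · rintro ⟨r, hr, x, ⟨hx, hn⟩, rfl⟩
    exact ⟨r, hr, T x, ⟨hx, by simpa using hn⟩, by simp⟩
  · rintro ⟨r, hr, x, ⟨hx, hn⟩, h⟩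
    refine ⟨r, hr, T.symm x, ⟨by simpa using hx, by simpa using hn⟩, ?_⟩
    apply T.injective
    rw [T.map_smul, T.apply_symm_apply, h]

lemma integrable_of_norm_le_on_sphere {F : Type*} [NormedAddCommGroup F] (hd : 0 < d)
    {f : E d → F} (hf : AEStronglyMeasurable f (sphereUniform d)) {C : ℝ}
    (h : ∀ u, ‖u‖ = 1 → ‖f u‖ ≤ C) : Integrable f (sphereUniform d) := by
  have := isProbabilityMeasure_sphereUniform hd
  refine Integrable.of_bound hf C ?_
  filter_upwards [ae_norm_eq_one] with u hu using h u hu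

lemma integrable_inner_mul_inner (hd : 0 < d) (a c : E d) :
    Integrable (fun u => ⟪a, u⟫ * ⟪c, u⟫) (sphereUniform d) := by
  refine integrable_of_norm_le_on_sphere hd (C := ‖a‖ * ‖c‖) (by fun_prop) fun u hu => ?_
  rw [norm_mul]
  have h1 := norm_inner_le_norm (𝕜 := ℝ) a u
  have h2 := norm_inner_le_norm (𝕜 := ℝ) c u
  rw [hu, mul_one] at h1 h2
  gcongr

/-- A reflection exchanges any two vectors of equal norm, so the integral depends on `‖a‖` only;
over an orthonormal basis the `d` equal integrals add up to the integral of `‖u‖² = 1`. -/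
lemma integral_inner_sq (hd : 0 < d) (a : E d) :
    ∫ u, ⟪a, u⟫ ^ 2 ∂sphereUniform d = ‖a‖ ^ 2 / d := by
  have := isProbabilityMeasure_sphereUniform hd
  have hint : ∀ a : E d, Integrable (fun u => ⟪a, u⟫ ^ 2) (sphereUniform d) := fun a => by
    simpa only [sq] using integrable_inner_mul_inner hd a a
  have hinv : ∀ a c : E d, ‖a‖ = ‖c‖ →
      ∫ u, ⟪a, u⟫ ^ 2 ∂sphereUniform d = ∫ u, ⟪c, u⟫ ^ 2 ∂sphereUniform d := by
    intro a c hac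
    set T := (ℝ ∙ (a - c))ᗮ.reflection with hT
    have h1 : T a = c := Submodule.reflection_sub hac
    conv_lhs => rw [← map_sphereUniform T]
    rw [integral_map T.continuous.measurable.aemeasurable (by fun_prop)]
    refine integral_congr_ae (Filter.Eventually.of_forall fun u => ?_)
    have h2 : ⟪a, T u⟫ = ⟪c, u⟫ := by
      rw [← h1, ← T.inner_map_map a (T u), hT, Submodule.reflection_reflection]
    simp only [h2]
  let e := EuclideanSpace.basisFun (Fin d) ℝ
  have hscale : ∀ i, ∫ u, ⟪a, u⟫ ^ 2 ∂sphereUniform d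
      = ‖a‖ ^ 2 * ∫ u, ⟪e i, u⟫ ^ 2 ∂sphereUniform d := by
    intro i
    rw [hinv a (‖a‖ • e i) (by simp [norm_smul]), ← integral_const_mul]
    refine integral_congr_ae (Filter.Eventually.of_forall fun u => ?_)
    simp only [inner_smul_left, mul_pow]
    simp
  have hsum : ∑ i, ∫ u, ⟪e i, u⟫ ^ 2 ∂sphereUniform d = 1 := by
    rw [← integral_finsetSum _ fun i _ => hint _]
    have : ∫ u, ∑ i, ⟪e i, u⟫ ^ 2 ∂sphereUniform d = ∫ u, (1 : ℝ) ∂sphereUniform d := by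
      refine integral_congr_ae ?_
      filter_upwards [ae_norm_eq_one] with u hu
      have := e.sum_sq_norm_inner_right u
      simp only [Real.norm_eq_abs, sq_abs] at this
      rw [this, hu, one_pow]
    rw [this]; simp
  have h3 : (d : ℝ) * ∫ u, ⟪a, u⟫ ^ 2 ∂sphereUniform d = ‖a‖ ^ 2 := by
    calc (d : ℝ) * ∫ u, ⟪a, u⟫ ^ 2 ∂sphereUniform d
        = ∑ _i : Fin d, ∫ u, ⟪a, u⟫ ^ 2 ∂sphereUniform d := by simp
      _ = ∑ i, ‖a‖ ^ 2 * ∫ u, ⟪e i, u⟫ ^ 2 ∂sphereUniform d :=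
          Finset.sum_congr rfl fun i _ => hscale i
      _ = ‖a‖ ^ 2 := by rw [← Finset.mul_sum, hsum, mul_one]
  rw [← h3]
  have : (d : ℝ) ≠ 0 := by positivity
  field_simp

lemma integral_inner_mul_inner (hd : 0 < d) (a c : E d) :
    ∫ u, ⟪a, u⟫ * ⟪c, u⟫ ∂sphereUniform d = ⟪a, c⟫ / d := by
  have hint : ∀ a : E d, Integrable (fun u => ⟪a, u⟫ ^ 2) (sphereUniform d) := fun a => by
    simpa only [sq] using integrable_inner_mul_inner hd a a
  have h : ∀ u : E d, ⟪a, u⟫ * ⟪c, u⟫ = (⟪a + c, u⟫ ^ 2 - ⟪a - c, u⟫ ^ 2) / 4 := by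
    intro u; rw [inner_add_left, inner_sub_left]; ring
  simp_rw [h]
  rw [integral_div, integral_sub (hint _) (hint _), integral_inner_sq hd, integral_inner_sq hd,
    norm_add_sq_real, norm_sub_sq_real]
  ring

/-- This makes `d ⟪G, u⟫ u` an unbiased estimator of `G`, hence the factor `d` in the finite
differences. -/
lemma integral_inner_smul (hd : 0 < d) (a : E d) :
    ∫ u, ⟪a, u⟫ • u ∂sphereUniform d = (d : ℝ)⁻¹ • a := by
  have hi : Integrable (fun u : E d => ⟪a, u⟫ • u) (sphereUniform d) := by
    refine integrable_of_norm_le_on_sphere hd (C := ‖a‖) (by fun_prop) fun u hu => ?_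
    rw [norm_smul, hu, mul_one]
    simpa [hu] using norm_inner_le_norm (𝕜 := ℝ) a u
  refine ext_inner_left ℝ fun c => ?_
  rw [← integral_inner hi]
  simp_rw [inner_smul_right]
  rw [integral_inner_mul_inner hd, real_inner_comm]
  ring

end Sphere

end AccZOMDA

namespace AccZOMDA

open scoped RealInnerProductSpace

/-! ### Projection onto a compact convex set -/

section Projection

variable {d : ℕ} {S : Set (E d)}

lemma proj_spec (hne : S.Nonempty) (hS : IsCompact S) (x₀ : E d) :
    proj S x₀ ∈ S ∧ IsMinOn (fun z => (1 / 2 : ℝ) * ‖z - x₀‖ ^ 2) S (proj S x₀) := by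
  have h : ∃ x, x ∈ S ∧ IsMinOn (fun z => (1 / 2 : ℝ) * ‖z - x₀‖ ^ 2) S x :=
    hS.exists_isMinOn hne (by fun_prop)
  exact Classical.epsilon_spec h

lemma proj_mem (hne : S.Nonempty) (hS : IsCompact S) (x₀ : E d) : proj S x₀ ∈ S :=
  (proj_spec hne hS x₀).1

lemma inner_sub_proj_nonpos (hne : S.Nonempty) (hS : IsCompact S) (hc : Convex ℝ S) (x₀ : E d)
    {z : E d} (hz : z ∈ S) : ⟪x₀ - proj S x₀, z - proj S x₀⟫ ≤ 0 := by
  obtain ⟨hm, hmin⟩ := proj_spec hne hS x₀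
  refine (norm_eq_iInf_iff_real_inner_le_zero hc hm).1 ?_ z hz
  have : Nonempty S := ⟨⟨_, hm⟩⟩
  refine le_antisymm (le_ciInf fun w => ?_)
    (ciInf_le ⟨0, fun _ ⟨_, h⟩ => h ▸ norm_nonneg _⟩ (⟨_, hm⟩ : S))
  have h := hmin w.2
  simp only [Set.mem_ofPred_eq] at h
  rw [norm_sub_rev, norm_sub_rev x₀]
  exact (sq_le_sq₀ (norm_nonneg _) (norm_nonneg _)).1 (by linarith)

/-- Adding the variational inequalities at the two projections shows that the projection is
nonexpansive. Continuity serves for the measurability of the iterates. -/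
lemma continuous_proj (hne : S.Nonempty) (hS : IsCompact S) (hc : Convex ℝ S) :
    Continuous (proj S) := by
  refine LipschitzWith.continuous (K := 1) (LipschitzWith.of_dist_le_mul fun a c => ?_)
  have h1 := inner_sub_proj_nonpos hne hS hc a (proj_mem hne hS c)
  have h2 := inner_sub_proj_nonpos hne hS hc c (proj_mem hne hS a)
  set p := proj S a
  set q := proj S c
  have h3 : ‖p - q‖ ^ 2 ≤ ⟪a - c, p - q⟫ := by
    have e1 : ⟪a - p, q - p⟫ = -⟪a - p, p - q⟫ := by rw [← inner_neg_right, neg_sub]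
    have e2 : ‖p - q‖ ^ 2 = ⟪a - c, p - q⟫ - ⟪a - p, p - q⟫ + ⟪c - q, p - q⟫ := by
      rw [← real_inner_self_eq_norm_sq, ← inner_sub_left, ← inner_add_left]
      congr 1; abel
    linarith
  have h4 := real_inner_le_norm (a - c) (p - q)
  rw [dist_eq_norm, dist_eq_norm, NNReal.coe_one, one_mul]
  by_contra! hlt
  nlinarith [norm_nonneg (p - q), norm_nonneg (a - c)]

end Projection

/-! ### Quadratic bounds for functions with Lipschitz gradient -/

section Smooth

variable {d : ℕ} {U : Set (E d)} {φ : E d → ℝ} {G : E d → E d} {L : ℝ}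

lemma hasDerivAt_along_line {x z : E d} {t : ℝ} {g : E d} (h : HasGradientAt φ g (x + t • z)) :
    HasDerivAt (fun s : ℝ => φ (x + s • z)) ⟪g, z⟫ t := by
  have h1 : HasDerivAt (fun s : ℝ => x + s • z) z t := by
    simpa using ((hasDerivAt_id t).smul_const z).const_add x
  have h2 := (hasGradientAt_iff_hasFDerivAt.1 h).comp_hasDerivAt t h1
  rw [InnerProductSpace.toDual_apply_apply] at h2
  exact h2

lemma abs_sub_le_of_hasGradientAt (hU : Convex ℝ U) (hG : ∀ x ∈ U, HasGradientAt φ (G x) x)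
    {C : ℝ} (hC : ∀ x ∈ U, ‖G x‖ ≤ C) {x x' : E d} (hx : x ∈ U) (hx' : x' ∈ U) :
    |φ x' - φ x| ≤ C * ‖x' - x‖ := by
  refine hU.norm_image_sub_le_of_norm_hasFDerivWithin_le
    (fun z hz => (hasGradientAt_iff_hasFDerivAt.1 (hG z hz)).hasFDerivWithinAt)
    (fun z hz => ?_) hx hx'
  simpa using hC z hz

/-- Along the segment, the function minus its linear part minus `L/2 t²‖z‖²` has nonpositive
derivative. -/
lemma sub_sub_inner_le (hU : Convex ℝ U) (hG : ∀ x ∈ U, HasGradientAt φ (G x) x)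
    (hL : ∀ x ∈ U, ∀ x' ∈ U, ‖G x - G x'‖ ≤ L * ‖x - x'‖) {x x' : E d} (hx : x ∈ U)
    (hx' : x' ∈ U) : φ x' - φ x - ⟪G x, x' - x⟫ ≤ L / 2 * ‖x' - x‖ ^ 2 := by
  set z := x' - x with hz
  have hmem : ∀ t ∈ Set.Icc (0 : ℝ) 1, x + t • z ∈ U := fun t ht =>
    hU.add_smul_sub_mem hx hx' ht
  let ψ : ℝ → ℝ := fun t => φ (x + t • z) - t * ⟪G x, z⟫ - L / 2 * t ^ 2 * ‖z‖ ^ 2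
  have hder : ∀ t ∈ Set.Icc (0 : ℝ) 1,
      HasDerivAt ψ (⟪G (x + t • z), z⟫ - ⟪G x, z⟫ - L * t * ‖z‖ ^ 2) t := by
    intro t ht
    have h1 := hasDerivAt_along_line (hG _ (hmem t ht))
    have h2 := (hasDerivAt_id t).mul_const ⟪G x, z⟫
    have h3 := (((hasDerivAt_id t).pow 2).const_mul (L / 2)).mul_const (‖z‖ ^ 2)
    refine HasDerivAt.congr_deriv ((h1.sub h2).sub h3) ?_
    simp only [id, Nat.cast_ofNat, show 2 - 1 = 1 from rfl, pow_one]
    ring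
  have hanti : AntitoneOn ψ (Set.Icc 0 1) := by
    refine antitoneOn_of_deriv_nonpos (convex_Icc 0 1)
      (fun t ht => (hder t ht).continuousAt.continuousWithinAt)
      (fun t ht => (hder t (interior_subset ht)).differentiableAt.differentiableWithinAt)
      (fun t ht => ?_)
    have ht' := interior_subset ht
    rw [(hder t ht').deriv, ← inner_sub_left]
    have h4 := real_inner_le_norm (G (x + t • z) - G x) z
    have h5 := hL _ (hmem t ht') x hx
    rw [add_sub_cancel_left, norm_smul, Real.norm_of_nonneg ht'.1] at h5
    nlinarith [mul_le_mul_of_nonneg_right h5 (norm_nonneg z)]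
  have h01 := hanti (Set.left_mem_Icc.2 zero_le_one) (Set.right_mem_Icc.2 zero_le_one) zero_le_one
  simp only [ψ, one_smul, zero_smul, add_zero] at h01
  have : x + z = x' := by rw [hz]; abel
  rw [this] at h01
  linarith

lemma abs_sub_sub_inner_le (hU : Convex ℝ U) (hG : ∀ x ∈ U, HasGradientAt φ (G x) x)
    (hL : ∀ x ∈ U, ∀ x' ∈ U, ‖G x - G x'‖ ≤ L * ‖x - x'‖) {x x' : E d} (hx : x ∈ U)
    (hx' : x' ∈ U) : |φ x' - φ x - ⟪G x, x' - x⟫| ≤ L / 2 * ‖x' - x‖ ^ 2 := by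
  have h1 := sub_sub_inner_le hU hG hL hx hx'
  have h2 := sub_sub_inner_le (φ := fun z => -φ z) (G := fun z => -G z) hU
    (fun z hz => by
      have := (hasGradientAt_iff_hasFDerivAt.1 (hG z hz)).neg
      rw [hasGradientAt_iff_hasFDerivAt, map_neg]
      exact this)
    (fun z hz z' hz' => by
      have := hL z' hz' z hz
      rw [neg_sub_neg, norm_sub_rev z z']; exact this) hx hx'
  rw [inner_neg_left] at h2
  rw [abs_le]; constructor <;> linarith

/-- A quadratic remainder survives integration over `ξ`; this is how expectations are differentiated
below. -/
lemma hasGradientAt_of_quadratic {x g : E d} {C : ℝ}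
    (h : ∀ᶠ x' in nhds x, |φ x' - φ x - ⟪g, x' - x⟫| ≤ C * ‖x' - x‖ ^ 2) :
    HasGradientAt φ g x := by
  rw [hasGradientAt_iff_isLittleO]
  have h1 : (fun x' => φ x' - φ x - ⟪g, x' - x⟫) =O[nhds x] fun x' => ‖x' - x‖ ^ 2 :=
    Asymptotics.IsBigO.of_bound C (by simpa using h)
  refine h1.trans_isLittleO ?_
  have h2 : (fun x' : E d => ‖x' - x‖) =o[nhds x] fun _ => (1 : ℝ) := by
    rw [Asymptotics.isLittleO_one_iff]
    exact tendsto_norm_sub_self x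
  have h3 := h2.mul_isBigO (Asymptotics.isBigO_refl (fun x' : E d => ‖x' - x‖) (nhds x))
  have h4 : (fun x' : E d => ‖x' - x‖ ^ 2) =o[nhds x] fun x' => ‖x' - x‖ := by
    simpa [sq] using h3
  exact h4.of_norm_right

end Smooth

/-! ### Consequences of strong concavity -/

section StrongConcave

variable {d : ℕ} {S : Set (E d)} {φ : E d → ℝ} {τ : ℝ}

/-- Compare `y₀` with the point `a y + (1 - a) y₀`, divide by `a`, and let `a` tend to `0`; the
limit is needed to get the full constant `τ/2`. -/
lemma le_sub_of_isMaxOn (h : StrongConcaveOn S τ φ) {y₀ y : E d} (h₀ : y₀ ∈ S)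
    (hm : IsMaxOn φ S y₀) (hy : y ∈ S) : φ y ≤ φ y₀ - τ / 2 * ‖y - y₀‖ ^ 2 := by
  have key : ∀ a ∈ Set.Ioo (0 : ℝ) 1, φ y + (1 - a) * (τ / 2 * ‖y - y₀‖ ^ 2) ≤ φ y₀ := by
    intro a ha
    have h1 := h.2 hy h₀ ha.1.le (sub_nonneg.2 ha.2.le) (by ring)
    have h2 := hm (h.1 hy h₀ ha.1.le (sub_nonneg.2 ha.2.le) (by ring))
    simp only [Set.mem_ofPred_eq] at h2
    have h3 := h1.trans h2
    simp only [smul_eq_mul] at h3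
    have : a * (φ y + (1 - a) * (τ / 2 * ‖y - y₀‖ ^ 2)) ≤ a * φ y₀ := by nlinarith
    exact le_of_mul_le_mul_left this ha.1
  have hlim : Filter.Tendsto (fun a : ℝ => φ y + (1 - a) * (τ / 2 * ‖y - y₀‖ ^ 2))
      (nhdsWithin 0 (Set.Ioi 0)) (nhds (φ y + (1 - 0) * (τ / 2 * ‖y - y₀‖ ^ 2))) := by
    apply Filter.Tendsto.mono_left _ nhdsWithin_le_nhds
    exact Continuous.tendsto (by fun_prop) 0
  have := le_of_tendsto hlim (by
    filter_upwards [Ioo_mem_nhdsGT (zero_lt_one' ℝ)] with a ha using key a ha)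
  linarith

/-- The same division by `a`, with the difference quotient now converging to the directional
derivative. -/
lemma le_add_inner_of_strongConcaveOn (h : StrongConcaveOn S τ φ) {y z g : E d} (hy : y ∈ S)
    (hz : z ∈ S) (hg : HasGradientAt φ g y) :
    φ z ≤ φ y + ⟪g, z - y⟫ - τ / 2 * ‖z - y‖ ^ 2 := by
  have key : ∀ a ∈ Set.Ioo (0 : ℝ) 1,
      φ z - φ y + (1 - a) * (τ / 2 * ‖z - y‖ ^ 2) ≤ a⁻¹ * (φ (y + a • (z - y)) - φ y) := by
    intro a ha
    have h1 := h.2 hz hy ha.1.le (sub_nonneg.2 ha.2.le) (by ring)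
    have e : a • z + (1 - a) • y = y + a • (z - y) := by module
    rw [e] at h1
    simp only [smul_eq_mul] at h1
    rw [le_inv_mul_iff₀ ha.1]
    nlinarith
  have hd := hasDerivAt_along_line (x := y) (z := z - y) (t := 0) (by simpa using hg)
  have hs := hd.tendsto_slope_zero_right
  simp only [zero_add, zero_smul, add_zero, smul_eq_mul] at hs
  have hlim : Filter.Tendsto (fun a : ℝ => φ z - φ y + (1 - a) * (τ / 2 * ‖z - y‖ ^ 2))
      (nhdsWithin 0 (Set.Ioi 0)) (nhds (φ z - φ y + (1 - 0) * (τ / 2 * ‖z - y‖ ^ 2))) := by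
    apply Filter.Tendsto.mono_left _ nhdsWithin_le_nhds
    exact Continuous.tendsto (by fun_prop) 0
  have := le_of_tendsto_of_tendsto hlim hs (by
    filter_upwards [Ioo_mem_nhdsGT (zero_lt_one' ℝ)] with a ha using key a ha)
  linarith

end StrongConcave

end AccZOMDA

namespace AccZOMDA

open scoped RealInnerProductSpace

/-! ### Random smooth functions and their forward-difference estimators -/

section SmoothFamily

variable {d : ℕ} {Ξ : Type*} [MeasurableSpace Ξ]

/-- A jointly measurable family of functions that are integrable in `ξ` and have `L`-Lipschitz
gradients `G · ξ` on the open convex set `U`. -/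
structure SmoothFamily (ν : Measure Ξ) (U : Set (E d)) (L : ℝ) (φ : E d → Ξ → ℝ)
    (G : E d → Ξ → E d) : Prop where
  isOpen : IsOpen U
  convex : Convex ℝ U
  measurable : Measurable fun p : E d × Ξ => φ p.1 p.2
  integrable : ∀ x ∈ U, Integrable (φ x) ν
  hasGradientAt : ∀ ξ, ∀ x ∈ U, HasGradientAt (fun z => φ z ξ) (G x ξ) x
  lipschitz : ∀ ξ, ∀ x ∈ U, ∀ x' ∈ U, ‖G x ξ - G x' ξ‖ ≤ L * ‖x - x'‖

/-- Forward-difference gradient estimator in the direction `u`. -/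
noncomputable def fdEst (φ : E d → Ξ → ℝ) (μ : ℝ) (x : E d) (s : Ξ × E d) : E d :=
  ((φ (x + μ • s.2) s.1 - φ x s.1) / (μ / (d : ℝ))) • s.2

variable {ν : Measure Ξ} [IsProbabilityMeasure ν] {U : Set (E d)} {L : ℝ} {φ φ' : E d → Ξ → ℝ}
  {G G' : E d → Ξ → E d}

namespace SmoothFamily

variable (h : SmoothFamily ν U L φ G) (h' : SmoothFamily ν U L φ' G')
include h

omit [IsProbabilityMeasure ν] in
lemma measurable_apply (x : E d) : Measurable (φ x) :=
  h.measurable.comp measurable_prodMk_left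

omit [IsProbabilityMeasure ν] in
lemma quadratic {x x' : E d} (hx : x ∈ U) (hx' : x' ∈ U) (ξ : Ξ) :
    |φ x' ξ - φ x ξ - ⟪G x ξ, x' - x⟫| ≤ L / 2 * ‖x' - x‖ ^ 2 :=
  abs_sub_sub_inner_le (φ := fun z => φ z ξ) (G := fun z => G z ξ) h.convex (h.hasGradientAt ξ)
    (h.lipschitz ξ) hx hx'

omit [IsProbabilityMeasure ν] in
-- The gradients are not assumed measurable in `ξ`; they are limits of difference quotients, which
-- are.
lemma measurable_inner {x : E d} (hx : x ∈ U) (e : E d) : Measurable fun ξ => ⟪G x ξ, e⟫ := by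
  have hlim : ∀ ξ, Filter.Tendsto
      (fun n : ℕ => ((n : ℝ) + 1) * (φ (x + (((n : ℝ) + 1)⁻¹) • e) ξ - φ x ξ)) Filter.atTop
      (nhds ⟪G x ξ, e⟫) := by
    intro ξ
    have hd := hasDerivAt_along_line (x := x) (z := e) (t := 0)
      (by simpa using h.hasGradientAt ξ x hx)
    have hs := hd.tendsto_slope_zero_right
    have hn : Filter.Tendsto (fun n : ℕ => ((n : ℝ) + 1)⁻¹) Filter.atTop
        (nhdsWithin 0 (Set.Ioi 0)) := by
      refine tendsto_nhdsWithin_iff.2 ⟨?_, Filter.Eventually.of_forall fun n => ?_⟩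
      · simpa using tendsto_one_div_add_atTop_nhds_zero_nat (𝕜 := ℝ)
      · simp only [Set.mem_Ioi]; positivity
    have := hs.comp hn
    simpa [Function.comp_def] using this
  refine measurable_of_tendsto_metrizable (fun n => ?_) (tendsto_pi_nhds.2 hlim)
  exact ((h.measurable_apply _).sub (h.measurable_apply _)).const_mul _

/-- One difference quotient with a fixed step inside `U` approximates the directional derivative up
to a constant uniform in `ξ`, and it is integrable. -/
lemma integrable_inner {x : E d} (hx : x ∈ U) (e : E d) :
    Integrable (fun ξ => ⟪G x ξ, e⟫) ν := by
  obtain ⟨t, ht, htU⟩ : ∃ t : ℝ, 0 < t ∧ x + t • e ∈ U := by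
    have hc : Filter.Tendsto (fun t : ℝ => x + t • e) (nhdsWithin 0 (Set.Ioi 0)) (nhds x) := by
      apply Filter.Tendsto.mono_left _ nhdsWithin_le_nhds
      exact Continuous.tendsto' (by fun_prop) _ _ (by simp)
    obtain ⟨t, h1, h2⟩ := ((hc.eventually (h.isOpen.mem_nhds hx)).and self_mem_nhdsWithin).exists
    exact ⟨t, h2, h1⟩
  have hb : Integrable (fun ξ => t⁻¹ * (|φ (x + t • e) ξ| + |φ x ξ| + L / 2 * ‖t • e‖ ^ 2)) ν :=
    (((h.integrable _ htU).abs.add (h.integrable _ hx).abs).add (integrable_const _)).const_mul _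
  refine hb.mono' (h.measurable_inner hx e).aestronglyMeasurable
    (Filter.Eventually.of_forall fun ξ => ?_)
  have h1 := h.quadratic hx htU ξ
  rw [add_sub_cancel_left, inner_smul_right] at h1
  rw [Real.norm_eq_abs, le_inv_mul_iff₀ ht, ← abs_of_pos ht, ← abs_mul, abs_of_pos ht]
  have h2 := abs_sub (φ (x + t • e) ξ) (φ x ξ)
  have h3 := abs_sub_abs_le_abs_sub (t * ⟪G x ξ, e⟫) (φ (x + t • e) ξ - φ x ξ)
  rw [abs_sub_comm (t * ⟪G x ξ, e⟫)] at h3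
  linarith

lemma integrable_gradient {x : E d} (hx : x ∈ U) : Integrable (G x) ν := by
  have e := EuclideanSpace.basisFun (Fin d) ℝ
  have : G x = fun ξ => ∑ i, ⟪G x ξ, e i⟫ • e i := by
    ext1 ξ
    conv_lhs => rw [← e.sum_repr' (G x ξ)]
    simp_rw [real_inner_comm]
  rw [this]
  exact integrable_finsetSum _ fun i _ => (h.integrable_inner hx _).smul_const _

/-- The quadratic remainder bound is uniform in `ξ`, so integrating it yields the same bound for the
expectation. -/
lemma hasGradientAt_integral {x : E d} (hx : x ∈ U) :
    HasGradientAt (fun z => ∫ ξ, φ z ξ ∂ν) (∫ ξ, G x ξ ∂ν) x := by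
  refine hasGradientAt_of_quadratic (C := L / 2) ?_
  filter_upwards [h.isOpen.mem_nhds hx] with x' hx'
  have hi := h.integrable_gradient hx
  have e1 : ⟪∫ ξ, G x ξ ∂ν, x' - x⟫ = ∫ ξ, ⟪G x ξ, x' - x⟫ ∂ν := by
    rw [real_inner_comm, ← integral_inner hi]
    simp_rw [real_inner_comm]
  rw [e1, ← integral_sub (h.integrable _ hx') (h.integrable _ hx),
    ← integral_sub (by exact (h.integrable _ hx').sub (h.integrable _ hx)) (hi.inner_const _)]
  have := norm_integral_le_of_norm_le_const (μ := ν)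
    (f := fun ξ => φ x' ξ - φ x ξ - ⟪G x ξ, x' - x⟫)
    (Filter.Eventually.of_forall fun ξ => h.quadratic hx hx' ξ)
  simpa using this

omit [IsProbabilityMeasure ν] in
lemma measurable_fdEst (μ : ℝ) : Measurable fun p : E d × (Ξ × E d) => fdEst φ μ p.1 p.2 := by
  unfold fdEst
  have h1 : Measurable fun p : E d × (Ξ × E d) => φ (p.1 + μ • p.2.2) p.2.1 :=
    h.measurable.comp (Measurable.prodMk (by fun_prop) (by fun_prop))
  have h2 : Measurable fun p : E d × (Ξ × E d) => φ p.1 p.2.1 :=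
    h.measurable.comp (Measurable.prodMk (by fun_prop) (by fun_prop))
  exact ((h1.sub h2).div_const _).smul (by fun_prop)

omit [IsProbabilityMeasure ν] in
-- The Taylor remainder `Lμ²/2` is multiplied by `d/μ`. Both the bias and the mean-square estimates
-- follow from this pointwise linearization.
lemma norm_fdEst_sub_le {μ : ℝ} (hμ : 0 < μ) {x u : E d} (hu : ‖u‖ = 1) (hx : x ∈ U)
    (hxu : x + μ • u ∈ U) (ξ : Ξ) :
    ‖fdEst φ μ x (ξ, u) - ((d : ℝ) * ⟪G x ξ, u⟫) • u‖ ≤ d * L * μ / 2 := by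
  have hq := h.quadratic hx hxu ξ
  rw [add_sub_cancel_left, inner_smul_right, norm_smul, hu, mul_one, Real.norm_of_nonneg hμ.le]
    at hq
  rw [fdEst, ← sub_smul, norm_smul, hu, mul_one, Real.norm_eq_abs]
  have e : (φ (x + μ • u) ξ - φ x ξ) / (μ / (d : ℝ)) - d * ⟪G x ξ, u⟫
      = d / μ * (φ (x + μ • u) ξ - φ x ξ - μ * ⟪G x ξ, u⟫) := by
    rw [div_div_eq_mul_div]; field_simp
  rw [e, abs_mul, abs_of_nonneg (by positivity : (0 : ℝ) ≤ d / μ)]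
  calc (d : ℝ) / μ * |_| ≤ d / μ * (L / 2 * μ ^ 2) := by gcongr
    _ = _ := by field_simp

omit [IsProbabilityMeasure ν] in
lemma ae_norm_fdEst_sub_le {μ : ℝ} (hd : 0 < d) (hμ : 0 < μ) {x : E d} (hx : x ∈ U)
    (hxu : ∀ u : E d, ‖u‖ = 1 → x + μ • u ∈ U) :
    ∀ᵐ s ∂ν.prod (sphereUniform d),
      ‖fdEst φ μ x s - ((d : ℝ) * ⟪G x s.1, s.2⟫) • s.2‖ ≤ d * L * μ / 2 := by
  have := isProbabilityMeasure_sphereUniform hd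
  have h1 : ∀ᵐ s ∂ν.prod (sphereUniform d), ‖s.2‖ = 1 :=
    Measure.quasiMeasurePreserving_snd.ae ae_norm_eq_one
  filter_upwards [h1] with s hs
  exact h.norm_fdEst_sub_le hμ hs hx (hxu _ hs) s.1

lemma integrable_main {x : E d} (hd : 0 < d) (hx : x ∈ U) :
    Integrable (fun s : Ξ × E d => ((d : ℝ) * ⟪G x s.1, s.2⟫) • s.2) (ν.prod (sphereUniform d)) := by
  have := isProbabilityMeasure_sphereUniform hd
  have hi := (h.integrable_gradient hx).comp_fst (sphereUniform d)
  refine (hi.norm.const_mul (d : ℝ)).mono' ?_ ?_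
  · have h2 : AEStronglyMeasurable (fun s : Ξ × E d => s.2) (ν.prod (sphereUniform d)) :=
      measurable_snd.aestronglyMeasurable
    exact ((AEStronglyMeasurable.inner (𝕜 := ℝ) hi.1 h2).const_mul _).smul h2
  · have h1 : ∀ᵐ s ∂ν.prod (sphereUniform d), ‖s.2‖ = 1 :=
      Measure.quasiMeasurePreserving_snd.ae ae_norm_eq_one
    filter_upwards [h1] with s hs
    rw [norm_smul, norm_mul, hs, mul_one, Real.norm_natCast]
    have := norm_inner_le_norm (𝕜 := ℝ) (G x s.1) s.2
    rw [hs, mul_one] at this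
    gcongr

lemma integrable_fdEst {μ : ℝ} (hd : 0 < d) (hμ : 0 < μ) {x : E d} (hx : x ∈ U)
    (hxu : ∀ u : E d, ‖u‖ = 1 → x + μ • u ∈ U) :
    Integrable (fdEst φ μ x) (ν.prod (sphereUniform d)) := by
  have := isProbabilityMeasure_sphereUniform hd
  have hm := h.integrable_main hd hx
  have h1 : Integrable (fun s => fdEst φ μ x s - ((d : ℝ) * ⟪G x s.1, s.2⟫) • s.2)
      (ν.prod (sphereUniform d)) :=
    Integrable.of_bound
      (((h.measurable_fdEst μ).comp measurable_prodMk_left).aestronglyMeasurable.sub hm.1) _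
      (h.ae_norm_fdEst_sub_le hd hμ hx hxu)
  refine (h1.add hm).congr (Filter.Eventually.of_forall fun s => ?_)
  simp

/-- The bias of the forward-difference estimator. -/
lemma norm_integral_fdEst_sub_le {μ : ℝ} (hd : 0 < d) (hμ : 0 < μ) {x : E d} (hx : x ∈ U)
    (hxu : ∀ u : E d, ‖u‖ = 1 → x + μ • u ∈ U) :
    ‖∫ s, fdEst φ μ x s ∂ν.prod (sphereUniform d) - ∫ ξ, G x ξ ∂ν‖ ≤ d * L * μ / 2 := by
  have := isProbabilityMeasure_sphereUniform hd
  have hm := h.integrable_main hd hx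
  have e : ∫ ξ, G x ξ ∂ν
      = ∫ s, ((d : ℝ) * ⟪G x s.1, s.2⟫) • s.2 ∂ν.prod (sphereUniform d) := by
    rw [integral_prod _ hm]
    refine integral_congr_ae (Filter.Eventually.of_forall fun ξ => ?_)
    simp_rw [mul_smul]
    rw [integral_smul, integral_inner_smul hd, smul_smul, mul_inv_cancel₀ (by positivity),
      one_smul]
  rw [e, ← integral_sub (h.integrable_fdEst hd hμ hx hxu) hm]
  simpa using norm_integral_le_of_norm_le_const (h.ae_norm_fdEst_sub_le hd hμ hx hxu)

include h' in
/-- Mean-square Lipschitz continuity of the forward-difference estimator. -/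
lemma integral_norm_fdEst_sub_sq_le {μ : ℝ} (hd : 0 < d) (hμ : 0 < μ) {x x' : E d} (hx : x ∈ U)
    (hxu : ∀ u : E d, ‖u‖ = 1 → x + μ • u ∈ U) (hx' : x' ∈ U)
    (hxu' : ∀ u : E d, ‖u‖ = 1 → x' + μ • u ∈ U) {C : ℝ}
    (hC : ∀ ξ, ‖G x ξ - G' x' ξ‖ ^ 2 ≤ C) :
    ∫ s, ‖fdEst φ μ x s - fdEst φ' μ x' s‖ ^ 2 ∂ν.prod (sphereUniform d)
      ≤ 2 * d * C + 2 * (d * L * μ) ^ 2 := by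
  have := isProbabilityMeasure_sphereUniform hd
  have h1 : ∀ᵐ s ∂ν.prod (sphereUniform d), ‖s.2‖ = 1 :=
    Measure.quasiMeasurePreserving_snd.ae ae_norm_eq_one
  have hG : AEStronglyMeasurable (fun s : Ξ × E d => G x s.1 - G' x' s.1)
      (ν.prod (sphereUniform d)) :=
    (((h.integrable_gradient hx).sub (h'.integrable_gradient hx')).comp_fst (sphereUniform d)).1
  have hS : AEStronglyMeasurable (fun s : Ξ × E d => s.2) (ν.prod (sphereUniform d)) :=
    measurable_snd.aestronglyMeasurable
  have hint : Integrable (fun s : Ξ × E d => ⟪G x s.1 - G' x' s.1, s.2⟫ ^ 2)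
      (ν.prod (sphereUniform d)) := by
    refine Integrable.of_bound ((hG.inner hS).pow 2) C ?_
    filter_upwards [h1] with s hs
    have := abs_real_inner_le_norm (G x s.1 - G' x' s.1) s.2
    rw [hs, mul_one] at this
    rw [norm_pow, Real.norm_eq_abs]
    exact (pow_le_pow_left₀ (abs_nonneg _) this 2).trans (hC _)
  -- Integrating over the direction first gains the factor `1/d`, which reduces the `d²` of the
  -- estimator to `d`. Two families occur because the other variable may change as well.
  have hbound : ∫ s, ⟪G x s.1 - G' x' s.1, s.2⟫ ^ 2 ∂ν.prod (sphereUniform d) ≤ C / d := by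
    rw [integral_prod _ hint]
    simp_rw [integral_inner_sq hd]
    have hnn : ∀ ξ, ‖‖G x ξ - G' x' ξ‖ ^ 2 / (d : ℝ)‖ ≤ C / d := fun ξ => by
      rw [Real.norm_of_nonneg (by positivity)]
      exact div_le_div_of_nonneg_right (hC ξ) (by positivity)
    have := norm_integral_le_of_norm_le_const (μ := ν) (Filter.Eventually.of_forall hnn)
    rw [probReal_univ, mul_one] at this
    exact (le_abs_self _).trans this
  calc ∫ s, ‖fdEst φ μ x s - fdEst φ' μ x' s‖ ^ 2 ∂ν.prod (sphereUniform d)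
      ≤ ∫ s, (2 * (d : ℝ) ^ 2 * ⟪G x s.1 - G' x' s.1, s.2⟫ ^ 2 + 2 * (d * L * μ) ^ 2)
          ∂ν.prod (sphereUniform d) := by
        refine integral_mono_of_nonneg (Filter.Eventually.of_forall fun s => by positivity)
          ((hint.const_mul _).add (integrable_const _)) ?_
        filter_upwards [h1, h.ae_norm_fdEst_sub_le hd hμ hx hxu,
          h'.ae_norm_fdEst_sub_le hd hμ hx' hxu'] with s hs ha hb
        set A := fdEst φ μ x s
        set B := fdEst φ' μ x' s
        have e : A - B = ((d : ℝ) * ⟪G x s.1 - G' x' s.1, s.2⟫) • s.2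
            + ((A - ((d : ℝ) * ⟪G x s.1, s.2⟫) • s.2)
              - (B - ((d : ℝ) * ⟪G' x' s.1, s.2⟫) • s.2)) := by
          rw [inner_sub_left]; module
        have n1 : ‖((d : ℝ) * ⟪G x s.1 - G' x' s.1, s.2⟫) • s.2‖
            = |(d : ℝ) * ⟪G x s.1 - G' x' s.1, s.2⟫| := by
          rw [norm_smul, hs, mul_one, Real.norm_eq_abs]
        have n2 := (norm_sub_le (A - ((d : ℝ) * ⟪G x s.1, s.2⟫) • s.2)
              (B - ((d : ℝ) * ⟪G' x' s.1, s.2⟫) • s.2))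
        have n3 : ‖A - B‖ ≤ |(d : ℝ) * ⟪G x s.1 - G' x' s.1, s.2⟫| + d * L * μ := by
          conv_lhs => rw [e]
          refine (norm_add_le _ _).trans ?_
          rw [n1]; linarith
        have n4 := pow_le_pow_left₀ (norm_nonneg _) n3 2
        have n5 := sq_nonneg (|(d : ℝ) * ⟪G x s.1 - G' x' s.1, s.2⟫| - d * L * μ)
        have n6 := sq_abs ((d : ℝ) * ⟪G x s.1 - G' x' s.1, s.2⟫)
        nlinarith
    _ = 2 * (d : ℝ) ^ 2 * ∫ s, ⟪G x s.1 - G' x' s.1, s.2⟫ ^ 2 ∂ν.prod (sphereUniform d)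
          + 2 * (d * L * μ) ^ 2 := by
        rw [integral_add (hint.const_mul _) (integrable_const _), integral_const_mul]
        simp
    _ ≤ 2 * (d : ℝ) ^ 2 * (C / d) + 2 * (d * L * μ) ^ 2 := by gcongr
    _ = _ := by field_simp

end SmoothFamily

end SmoothFamily

end AccZOMDA

namespace AccZOMDA

open scoped RealInnerProductSpace

/-! ### Mean-square distance to the mean -/

section MeanSquare

variable {α : Type*} [MeasurableSpace α] {ν : Measure α} [IsProbabilityMeasure ν] {d : ℕ}

lemma memLp_two_of_lintegral_sub_le {f : α → E d} (hf : AEStronglyMeasurable f ν) (c : E d)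
    {M : ℝ} (h : ∫⁻ s, ENNReal.ofReal (‖f s - c‖ ^ 2) ∂ν ≤ ENNReal.ofReal M) : MemLp f 2 ν := by
  have h1 : MemLp (fun s => f s - c) 2 ν := by
    refine (memLp_two_iff_integrable_sq_norm (hf.sub aestronglyMeasurable_const)).2 ?_
    refine ⟨((hf.sub aestronglyMeasurable_const).norm.pow 2), ?_⟩
    rw [hasFiniteIntegral_iff_ofReal (Filter.Eventually.of_forall fun s => by positivity)]
    exact h.trans_lt ENNReal.ofReal_lt_top
  have h2 := h1.add (memLp_const (p := 2) c)
  refine h2.ae_eq (Filter.Eventually.of_forall fun s => ?_)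
  simp

lemma MemLp.integrable_norm_sub_sq {f : α → E d} (hf : MemLp f 2 ν) (c : E d) :
    Integrable (fun s => ‖f s - c‖ ^ 2) ν :=
  (hf.sub (memLp_const c)).integrable_norm_pow (by norm_num)

/-- The mean minimizes the mean-square distance. -/
lemma integral_norm_sub_integral_sq_le {f : α → E d} (hf : MemLp f 2 ν) (c : E d) :
    ∫ s, ‖f s - ∫ t, f t ∂ν‖ ^ 2 ∂ν ≤ ∫ s, ‖f s - c‖ ^ 2 ∂ν := by
  set m := ∫ t, f t ∂ν with hm
  have hi : Integrable f ν := hf.integrable (by norm_num)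
  have h1 := MemLp.integrable_norm_sub_sq hf m
  have h2 : Integrable (fun s => ⟪m - c, f s - m⟫) ν := (hi.sub (integrable_const m)).const_inner _
  have e : ∀ s, ‖f s - c‖ ^ 2 = ‖f s - m‖ ^ 2 + 2 * ⟪m - c, f s - m⟫ + ‖m - c‖ ^ 2 := by
    intro s
    have : f s - c = (f s - m) + (m - c) := by abel
    rw [this, norm_add_sq_real, real_inner_comm]
  have h3 : ∫ s, ⟪m - c, f s - m⟫ ∂ν = 0 := by
    have h4 := integral_inner (𝕜 := ℝ) (hi.sub (integrable_const m)) (m - c)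
    simp only [Pi.sub_apply] at h4
    rw [h4, integral_sub hi (integrable_const m)]
    simp [hm]
  simp_rw [e]
  rw [integral_add (by exact h1.add (h2.const_mul 2)) (integrable_const _),
    integral_add h1 (h2.const_mul 2), integral_const_mul, h3]
  simp

/-- The centre `c` is arbitrary, so the variance hypotheses, centred at the gradients of the
smoothed functions, can be used without identifying those gradients with the means of the
estimators. -/
lemma integral_norm_sub_integral_sq_le_of_lintegral {f : α → E d}
    (hf : AEStronglyMeasurable f ν) (c : E d) {M : ℝ} (hM : 0 ≤ M)
    (h : ∫⁻ s, ENNReal.ofReal (‖f s - c‖ ^ 2) ∂ν ≤ ENNReal.ofReal M) :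
    ∫ s, ‖f s - ∫ t, f t ∂ν‖ ^ 2 ∂ν ≤ M := by
  have h2 := memLp_two_of_lintegral_sub_le hf c h
  refine (integral_norm_sub_integral_sq_le h2 c).trans ?_
  rw [← ofReal_integral_eq_lintegral_ofReal (MemLp.integrable_norm_sub_sq h2 c)
    (Filter.Eventually.of_forall fun s => by positivity)] at h
  exact (ENNReal.ofReal_le_ofReal_iff hM).1 h

end MeanSquare

/-! ### Gradients and one-sample estimators of the minimax problem -/

namespace Problem

variable {d₁ d₂ : ℕ} {Ξ : Type*} [MeasurableSpace Ξ] (P : Problem d₁ d₂ Ξ)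

/-- The partial gradient of the objective in `x`. -/
noncomputable def gradFX (x : E d₁) (y : E d₂) : E d₁ := gradient (fun z => P.F z y) x

/-- The partial gradient of the objective in `y`. -/
noncomputable def gradFY (x : E d₁) (y : E d₂) : E d₂ := gradient (fun z => P.F x z) y

/-- The mean of the one-sample estimator in `x`. -/
noncomputable def meanX (μ : ℝ) (x : E d₁) (y : E d₂) : E d₁ :=
  ∫ s, (P.estX μ x y s.1 s.2).val ∂P.law.prod (sphereUniform d₁)

/-- The mean of the one-sample estimator in `y`. -/
noncomputable def meanY (μ : ℝ) (x : E d₁) (y : E d₂) : E d₂ :=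
  ∫ s, (P.estY μ x y s.1 s.2).val ∂P.law.prod (sphereUniform d₂)

variable {P}

namespace Assumptions

variable {L τ δ μ₁ μ₂ : ℝ} (hA : P.Assumptions L τ δ μ₁ μ₂)
include hA

lemma measurable_loss_comp {α : Type*} [MeasurableSpace α] {f : α → E d₁} {g : α → E d₂}
    {k : α → Ξ} (hf : Measurable f) (hg : Measurable g) (hk : Measurable k) :
    Measurable fun a => P.loss (f a) (g a) (k a) :=
  hA.measurable_loss.comp ((hf.prodMk hg).prodMk hk)

/-- Freezing one variable gives a `SmoothFamily` in the other on a thickening that contains all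
query points. The two joint Lipschitz bounds are kept for steps that move both variables. -/
lemma exists_smoothFamily (hL : 0 ≤ L) (hμ₁ : 0 < μ₁) (hμ₂ : 0 < μ₂) :
    ∃ U V, (P.X ⊆ U ∧ ∀ x ∈ P.X, ∀ u : E d₁, ‖u‖ = 1 → x + μ₁ • u ∈ U) ∧
      (P.Y ⊆ V ∧ ∀ y ∈ P.Y, ∀ u : E d₂, ‖u‖ = 1 → y + μ₂ • u ∈ V) ∧
      (∀ y ∈ V, SmoothFamily P.law U L (fun z ξ => P.loss z y ξ)
        fun x ξ => gradient (fun z => P.loss z y ξ) x) ∧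
      (∀ x ∈ U, SmoothFamily P.law V L (P.loss x) fun y ξ => gradient (fun z => P.loss x z ξ) y) ∧
      (∀ ξ, ∀ x ∈ U, ∀ x' ∈ U, ∀ y ∈ V, ∀ y' ∈ V,
        ‖gradient (fun z => P.loss z y ξ) x - gradient (fun z => P.loss z y' ξ) x'‖ ^ 2
          ≤ L ^ 2 * (‖x - x'‖ ^ 2 + ‖y - y'‖ ^ 2)) ∧
      (∀ ξ, ∀ x ∈ U, ∀ x' ∈ U, ∀ y ∈ V, ∀ y' ∈ V,
        ‖gradient (fun z => P.loss x z ξ) y - gradient (fun z => P.loss x' z ξ) y'‖ ^ 2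
          ≤ L ^ 2 * (‖x - x'‖ ^ 2 + ‖y - y'‖ ^ 2)) := by
  obtain ⟨r, h1, h2, hint, hdiff, hlip⟩ := hA.smooth
  have hthick : ∀ {n : ℕ} {S : Set (E n)} {μ : ℝ}, 0 < μ → μ < r →
      S ⊆ Metric.thickening r S ∧ ∀ x ∈ S, ∀ u : E n, ‖u‖ = 1 → x + μ • u ∈ Metric.thickening r S := by
    intro n S μ hμ hr
    refine ⟨Metric.self_subset_thickening (hμ.trans hr) S, fun x hx u hu => ?_⟩
    refine Metric.mem_thickening_iff.2 ⟨x, hx, ?_⟩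
    rw [dist_eq_norm, add_sub_cancel_left, norm_smul, hu, mul_one, Real.norm_of_nonneg hμ.le]
    exact hr
  have hlx : ∀ ξ, ∀ x ∈ Metric.thickening r P.X, ∀ x' ∈ Metric.thickening r P.X,
      ∀ y ∈ Metric.thickening r P.Y, ∀ y' ∈ Metric.thickening r P.Y,
        ‖gradient (fun z => P.loss z y ξ) x - gradient (fun z => P.loss z y' ξ) x'‖ ^ 2
          ≤ L ^ 2 * (‖x - x'‖ ^ 2 + ‖y - y'‖ ^ 2) := fun ξ x hx x' hx' y hy y' hy' =>
    (le_add_of_nonneg_right (by positivity)).trans (hlip ξ x hx x' hx' y hy y' hy')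
  have hly : ∀ ξ, ∀ x ∈ Metric.thickening r P.X, ∀ x' ∈ Metric.thickening r P.X,
      ∀ y ∈ Metric.thickening r P.Y, ∀ y' ∈ Metric.thickening r P.Y,
        ‖gradient (fun z => P.loss x z ξ) y - gradient (fun z => P.loss x' z ξ) y'‖ ^ 2
          ≤ L ^ 2 * (‖x - x'‖ ^ 2 + ‖y - y'‖ ^ 2) := fun ξ x hx x' hx' y hy y' hy' =>
    (le_add_of_nonneg_left (by positivity)).trans (hlip ξ x hx x' hx' y hy y' hy')
  refine ⟨_, _, hthick hμ₁ h1, hthick hμ₂ h2, fun y hy => ?_, fun x hx => ?_, hlx, hly⟩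
  · refine ⟨Metric.isOpen_thickening, hA.convexX.thickening r, ?_, fun x hx => hint x hx y hy,
      fun ξ x hx => ?_, fun ξ x hx x' hx' => ?_⟩
    · exact hA.measurable_loss_comp (by fun_prop) (by fun_prop) (by fun_prop)
    · have h3 : DifferentiableAt ℝ (fun z : E d₁ => (z, y)) x := by fun_prop
      exact ((hdiff ξ x hx y hy).comp x h3).hasGradientAt
    · refine (sq_le_sq₀ (norm_nonneg _) (by positivity)).1 ?_
      have := hlx ξ x hx x' hx' y hy y hy
      rw [sub_self, norm_zero] at this
      nlinarith
  · refine ⟨Metric.isOpen_thickening, hA.convexY.thickening r, ?_, fun y hy => hint x hx y hy,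
      fun ξ y hy => ?_, fun ξ y hy y' hy' => ?_⟩
    · exact hA.measurable_loss_comp (by fun_prop) (by fun_prop) (by fun_prop)
    · have h3 : DifferentiableAt ℝ (fun z : E d₂ => (x, z)) y := by fun_prop
      exact ((hdiff ξ x hx y hy).comp y h3).hasGradientAt
    · refine (sq_le_sq₀ (norm_nonneg _) (by positivity)).1 ?_
      have := hly ξ x hx x hx y hy y' hy'
      rw [sub_self, norm_zero] at this
      nlinarith

lemma measurable_estX_comp {α : Type*} [MeasurableSpace α] {f : α → E d₁} {g : α → E d₂}
    {k : α → Ξ} {u : α → E d₁} (hf : Measurable f) (hg : Measurable g) (hk : Measurable k)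
    (hu : Measurable u) : Measurable fun a => (P.estX μ₁ (f a) (g a) (k a) (u a)).val := by
  have h1 : Measurable fun a => P.loss (f a + μ₁ • u a) (g a) (k a) :=
    hA.measurable_loss_comp (by fun_prop) (by fun_prop) hk
  have h2 : Measurable fun a => P.loss (f a) (g a) (k a) := hA.measurable_loss_comp hf hg hk
  have h3 : Measurable fun a => ((P.loss (f a + μ₁ • u a) (g a) (k a) - P.loss (f a) (g a) (k a))
      / (μ₁ / (d₁ : ℝ))) • u a := ((h1.sub h2).div_const _).smul hu
  exact h3

lemma measurable_estX_apply (x : E d₁) (y : E d₂) :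
    Measurable fun s : Ξ × E d₁ => (P.estX μ₁ x y s.1 s.2).val :=
  hA.measurable_estX_comp measurable_const measurable_const measurable_fst measurable_snd

lemma measurable_estX : Measurable fun p : (E d₁ × E d₂) × (Ξ × E d₁) =>
    (P.estX μ₁ p.1.1 p.1.2 p.2.1 p.2.2).val :=
  hA.measurable_estX_comp (by fun_prop) (by fun_prop) (by fun_prop) (by fun_prop)

lemma measurable_estY_comp {α : Type*} [MeasurableSpace α] {f : α → E d₁} {g : α → E d₂}
    {k : α → Ξ} {u : α → E d₂} (hf : Measurable f) (hg : Measurable g) (hk : Measurable k)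
    (hu : Measurable u) : Measurable fun a => (P.estY μ₂ (f a) (g a) (k a) (u a)).val := by
  have h1 : Measurable fun a => P.loss (f a) (g a + μ₂ • u a) (k a) :=
    hA.measurable_loss_comp (by fun_prop) (by fun_prop) hk
  have h2 : Measurable fun a => P.loss (f a) (g a) (k a) := hA.measurable_loss_comp hf hg hk
  have h3 : Measurable fun a => ((P.loss (f a) (g a + μ₂ • u a) (k a) - P.loss (f a) (g a) (k a))
      / (μ₂ / (d₂ : ℝ))) • u a := ((h1.sub h2).div_const _).smul hu
  exact h3

lemma measurable_estY_apply (x : E d₁) (y : E d₂) :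
    Measurable fun s : Ξ × E d₂ => (P.estY μ₂ x y s.1 s.2).val :=
  hA.measurable_estY_comp measurable_const measurable_const measurable_fst measurable_snd

lemma measurable_estY : Measurable fun p : (E d₁ × E d₂) × (Ξ × E d₂) =>
    (P.estY μ₂ p.1.1 p.1.2 p.2.1 p.2.2).val :=
  hA.measurable_estY_comp (by fun_prop) (by fun_prop) (by fun_prop) (by fun_prop)

lemma measurable_F : Measurable fun p : E d₁ × E d₂ => P.F p.1 p.2 := by
  have := hA.prob
  exact (hA.measurable_loss.stronglyMeasurable.integral_prod_right
    (f := fun (p : E d₁ × E d₂) ξ => P.loss p.1 p.2 ξ)).measurable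

lemma measurable_meanX (hd : 0 < d₁) : Measurable fun p : E d₁ × E d₂ => P.meanX μ₁ p.1 p.2 := by
  have := hA.prob
  have := isProbabilityMeasure_sphereUniform hd
  exact (hA.measurable_estX.stronglyMeasurable.integral_prod_right
    (f := fun (p : E d₁ × E d₂) (s : Ξ × E d₁) => (P.estX μ₁ p.1 p.2 s.1 s.2).val)).measurable

lemma measurable_meanY (hd : 0 < d₂) : Measurable fun p : E d₁ × E d₂ => P.meanY μ₂ p.1 p.2 := by
  have := hA.prob
  have := isProbabilityMeasure_sphereUniform hd
  exact (hA.measurable_estY.stronglyMeasurable.integral_prod_right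
    (f := fun (p : E d₁ × E d₂) (s : Ξ × E d₂) => (P.estY μ₂ p.1 p.2 s.1 s.2).val)).measurable

lemma memLp_estX (hd : 0 < d₁) {x : E d₁} {y : E d₂} (hx : x ∈ P.X) (hy : y ∈ P.Y) :
    MemLp (fun s : Ξ × E d₁ => (P.estX μ₁ x y s.1 s.2).val) 2
      (P.law.prod (sphereUniform d₁)) := by
  have := hA.prob
  have := isProbabilityMeasure_sphereUniform hd
  exact memLp_two_of_lintegral_sub_le
    (hA.measurable_estX_apply x y).aestronglyMeasurable _ (hA.varianceX x hx y hy)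

lemma memLp_estY (hd : 0 < d₂) {x : E d₁} {y : E d₂} (hx : x ∈ P.X) (hy : y ∈ P.Y) :
    MemLp (fun s : Ξ × E d₂ => (P.estY μ₂ x y s.1 s.2).val) 2
      (P.law.prod (sphereUniform d₂)) := by
  have := hA.prob
  have := isProbabilityMeasure_sphereUniform hd
  exact memLp_two_of_lintegral_sub_le
    (hA.measurable_estY_apply x y).aestronglyMeasurable _ (hA.varianceY x hx y hy)

lemma variance_estX_le (hd : 0 < d₁) {x : E d₁} {y : E d₂} (hx : x ∈ P.X) (hy : y ∈ P.Y) :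
    ∫ s, ‖(P.estX μ₁ x y s.1 s.2).val - P.meanX μ₁ x y‖ ^ 2 ∂P.law.prod (sphereUniform d₁)
      ≤ δ ^ 2 := by
  have := hA.prob
  have := isProbabilityMeasure_sphereUniform hd
  exact integral_norm_sub_integral_sq_le_of_lintegral
    (hA.measurable_estX_apply x y).aestronglyMeasurable _ (sq_nonneg δ)
    (hA.varianceX x hx y hy)

lemma variance_estY_le (hd : 0 < d₂) {x : E d₁} {y : E d₂} (hx : x ∈ P.X) (hy : y ∈ P.Y) :
    ∫ s, ‖(P.estY μ₂ x y s.1 s.2).val - P.meanY μ₂ x y‖ ^ 2 ∂P.law.prod (sphereUniform d₂)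
      ≤ δ ^ 2 := by
  have := hA.prob
  have := isProbabilityMeasure_sphereUniform hd
  exact integral_norm_sub_integral_sq_le_of_lintegral
    (hA.measurable_estY_apply x y).aestronglyMeasurable _ (sq_nonneg δ)
    (hA.varianceY x hx y hy)

variable (hL : 0 ≤ L) (hμ₁ : 0 < μ₁) (hμ₂ : 0 < μ₂)
include hL hμ₁ hμ₂

lemma integral_estX_sub_sq_le (hd : 0 < d₁) {x x' : E d₁} {y y' : E d₂} (hx : x ∈ P.X)
    (hx' : x' ∈ P.X) (hy : y ∈ P.Y) (hy' : y' ∈ P.Y) :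
    ∫ s, ‖(P.estX μ₁ x y s.1 s.2).val - (P.estX μ₁ x' y' s.1 s.2).val‖ ^ 2
        ∂P.law.prod (sphereUniform d₁)
      ≤ 2 * d₁ * (L ^ 2 * (‖x - x'‖ ^ 2 + ‖y - y'‖ ^ 2)) + 2 * (d₁ * L * μ₁) ^ 2 := by
  have := hA.prob
  obtain ⟨U, V, ⟨hXU, hXu⟩, ⟨hYV, -⟩, hsx, -, hl, -⟩ := hA.exists_smoothFamily hL hμ₁ hμ₂
  exact (hsx y (hYV hy)).integral_norm_fdEst_sub_sq_le (hsx y' (hYV hy')) hd hμ₁ (hXU hx)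
    (hXu x hx) (hXU hx') (hXu x' hx')
    fun ξ => hl ξ x (hXU hx) x' (hXU hx') y (hYV hy) y' (hYV hy')

lemma integral_estY_sub_sq_le (hd : 0 < d₂) {x x' : E d₁} {y y' : E d₂} (hx : x ∈ P.X)
    (hx' : x' ∈ P.X) (hy : y ∈ P.Y) (hy' : y' ∈ P.Y) :
    ∫ s, ‖(P.estY μ₂ x y s.1 s.2).val - (P.estY μ₂ x' y' s.1 s.2).val‖ ^ 2
        ∂P.law.prod (sphereUniform d₂)
      ≤ 2 * d₂ * (L ^ 2 * (‖x - x'‖ ^ 2 + ‖y - y'‖ ^ 2)) + 2 * (d₂ * L * μ₂) ^ 2 := by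
  have := hA.prob
  obtain ⟨U, V, ⟨hXU, -⟩, ⟨hYV, hYv⟩, -, hsy, -, hl⟩ := hA.exists_smoothFamily hL hμ₁ hμ₂
  exact (hsy x (hXU hx)).integral_norm_fdEst_sub_sq_le (hsy x' (hXU hx')) hd hμ₂ (hYV hy)
    (hYv y hy) (hYV hy') (hYv y' hy')
    fun ξ => hl ξ x (hXU hx) x' (hXU hx') y (hYV hy) y' (hYV hy')

lemma hasGradientAt_X {x : E d₁} {y : E d₂} (hx : x ∈ P.X) (hy : y ∈ P.Y) :
    HasGradientAt (fun z => P.F z y) (P.gradFX x y) x := by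
  have := hA.prob
  obtain ⟨U, V, ⟨hXU, hXu⟩, ⟨hYV, -⟩, hsx, -⟩ := hA.exists_smoothFamily hL hμ₁ hμ₂
  exact ((hsx y (hYV hy)).hasGradientAt_integral (hXU hx)).differentiableAt.hasGradientAt

lemma hasGradientAt_Y {x : E d₁} {y : E d₂} (hx : x ∈ P.X) (hy : y ∈ P.Y) :
    HasGradientAt (fun z => P.F x z) (P.gradFY x y) y := by
  have := hA.prob
  obtain ⟨U, V, ⟨hXU, -⟩, ⟨hYV, hYv⟩, -, hsy, -⟩ := hA.exists_smoothFamily hL hμ₁ hμ₂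
  exact ((hsy x (hXU hx)).hasGradientAt_integral (hYV hy)).differentiableAt.hasGradientAt

lemma norm_meanX_sub_le (hd : 0 < d₁) {x : E d₁} {y : E d₂} (hx : x ∈ P.X) (hy : y ∈ P.Y) :
    ‖P.meanX μ₁ x y - P.gradFX x y‖ ≤ d₁ * L * μ₁ / 2 := by
  have := hA.prob
  obtain ⟨U, V, ⟨hXU, hXu⟩, ⟨hYV, -⟩, hsx, -⟩ := hA.exists_smoothFamily hL hμ₁ hμ₂
  rw [gradFX]
  have h1 := ((hsx y (hYV hy)).hasGradientAt_integral (hXU hx)).gradient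
  unfold F
  rw [h1]
  exact (hsx y (hYV hy)).norm_integral_fdEst_sub_le hd hμ₁ (hXU hx) (hXu x hx)

lemma norm_meanY_sub_le (hd : 0 < d₂) {x : E d₁} {y : E d₂} (hx : x ∈ P.X) (hy : y ∈ P.Y) :
    ‖P.meanY μ₂ x y - P.gradFY x y‖ ≤ d₂ * L * μ₂ / 2 := by
  have := hA.prob
  obtain ⟨U, V, ⟨hXU, -⟩, ⟨hYV, hYv⟩, -, hsy, -⟩ := hA.exists_smoothFamily hL hμ₁ hμ₂
  rw [gradFY]
  have h1 := ((hsy x (hXU hx)).hasGradientAt_integral (hYV hy)).gradient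
  unfold F
  rw [h1]
  exact (hsy x (hXU hx)).norm_integral_fdEst_sub_le hd hμ₂ (hYV hy) (hYv y hy)

lemma norm_gradFX_sub_le {x x' : E d₁} {y y' : E d₂} (hx : x ∈ P.X)
    (hx' : x' ∈ P.X) (hy : y ∈ P.Y) (hy' : y' ∈ P.Y) :
    ‖P.gradFX x y - P.gradFX x' y'‖ ≤ L * √(‖x - x'‖ ^ 2 + ‖y - y'‖ ^ 2) := by
  have := hA.prob
  obtain ⟨U, V, ⟨hXU, hXu⟩, ⟨hYV, -⟩, hsx, -, hl, -⟩ := hA.exists_smoothFamily hL hμ₁ hμ₂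
  rw [gradFX, gradFX]
  have h1 := ((hsx y (hYV hy)).hasGradientAt_integral (hXU hx)).gradient
  have h2 := ((hsx y' (hYV hy')).hasGradientAt_integral (hXU hx')).gradient
  unfold F
  rw [h1, h2, ← integral_sub ((hsx y (hYV hy)).integrable_gradient (hXU hx))
    ((hsx y' (hYV hy')).integrable_gradient (hXU hx'))]
  refine (norm_integral_le_of_norm_le_const (C := L * √(‖x - x'‖ ^ 2 + ‖y - y'‖ ^ 2))
    (Filter.Eventually.of_forall fun ξ => ?_)).trans (by simp)
  refine (sq_le_sq₀ (norm_nonneg _) (by positivity)).1 ?_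
  rw [mul_pow, Real.sq_sqrt (by positivity)]
  exact hl ξ x (hXU hx) x' (hXU hx') y (hYV hy) y' (hYV hy')

lemma norm_gradFY_sub_le {x x' : E d₁} {y y' : E d₂} (hx : x ∈ P.X)
    (hx' : x' ∈ P.X) (hy : y ∈ P.Y) (hy' : y' ∈ P.Y) :
    ‖P.gradFY x y - P.gradFY x' y'‖ ≤ L * √(‖x - x'‖ ^ 2 + ‖y - y'‖ ^ 2) := by
  have := hA.prob
  obtain ⟨U, V, ⟨hXU, -⟩, ⟨hYV, hYv⟩, -, hsy, -, hl⟩ := hA.exists_smoothFamily hL hμ₁ hμ₂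
  rw [gradFY, gradFY]
  have h1 := ((hsy x (hXU hx)).hasGradientAt_integral (hYV hy)).gradient
  have h2 := ((hsy x' (hXU hx')).hasGradientAt_integral (hYV hy')).gradient
  unfold F
  rw [h1, h2, ← integral_sub ((hsy x (hXU hx)).integrable_gradient (hYV hy))
    ((hsy x' (hXU hx')).integrable_gradient (hYV hy'))]
  refine (norm_integral_le_of_norm_le_const (C := L * √(‖x - x'‖ ^ 2 + ‖y - y'‖ ^ 2))
    (Filter.Eventually.of_forall fun ξ => ?_)).trans (by simp)
  refine (sq_le_sq₀ (norm_nonneg _) (by positivity)).1 ?_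
  rw [mul_pow, Real.sq_sqrt (by positivity)]
  exact hl ξ x (hXU hx) x' (hXU hx') y (hYV hy) y' (hYV hy')

end Assumptions

end Problem

end AccZOMDA

/-! ### Descent of the primal function and tracking of the maximizer -/

namespace AccZOMDA

open scoped RealInnerProductSpace

/-- With `ρ = ητλ/4` one has `(1 + ρ)(1 - 2ρ) ≤ 1 - ρ`. From `ητλ ≤ 1/6` follow `1 + ρ ≤ 25/24`,
which turns `4` into `25/6`, and `η² ≤ η/(6τλ)`, so that `(1 + 1/ρ)η²` is at most `(1/6 + 4)η/(τλ)`.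
-/
lemma tracking_arith {τ lam η X κ A Y Z W S : ℝ} (hτ : 0 < τ) (hlam : 0 < lam) (hη : 0 < η)
    (h : η * τ * lam ≤ 1 / 6) (hX : 0 ≤ X) (hY : 0 ≤ Y) (hZ : 0 ≤ Z) (hW : 0 ≤ W)
    (h1 : (1 + η * τ * lam / 4) * A ≤ (1 + η * τ * lam / 4)
      * ((1 - η * τ * lam / 2) * Y - 3 * η / 4 * Z + 4 * η * lam / τ * W))
    (h2 : (1 + 1 / (η * τ * lam / 4)) * S
      ≤ (1 + 1 / (η * τ * lam / 4)) * (κ ^ 2 * (η ^ 2 * X))) :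
    (1 + η * τ * lam / 4) * A + (1 + 1 / (η * τ * lam / 4)) * S
      ≤ (1 - η * τ * lam / 4) * Y - 3 * η / 4 * Z + 25 * η * lam / (6 * τ) * W
        + 25 * κ ^ 2 * η / (6 * τ * lam) * X := by
  have hρ : 0 < η * τ * lam := by positivity
  have b1 : (1 + η * τ * lam / 4) * ((1 - η * τ * lam / 2) * Y) ≤ (1 - η * τ * lam / 4) * Y := by
    rw [← mul_assoc]
    gcongr
    nlinarith
  have b2 : 3 * η / 4 * Z ≤ (1 + η * τ * lam / 4) * (3 * η / 4 * Z) :=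
    le_mul_of_one_le_left (by positivity) (by linarith)
  have b3 : (1 + η * τ * lam / 4) * (4 * η * lam / τ * W) ≤ 25 * η * lam / (6 * τ) * W := by
    calc _ ≤ 25 / 24 * (4 * η * lam / τ * W) := by
          gcongr
          linarith
      _ = _ := by field_simp; ring
  have b4 : (1 + 1 / (η * τ * lam / 4)) * (κ ^ 2 * (η ^ 2 * X))
      ≤ 25 * κ ^ 2 * η / (6 * τ * lam) * X := by
    have c1 : (1 + 1 / (η * τ * lam / 4)) * η ^ 2 ≤ 25 * η / (6 * τ * lam) := by
      have : 1 / (η * τ * lam / 4) * η ^ 2 = 4 * η / (τ * lam) := by field_simp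
      rw [add_mul, one_mul, this]
      have c2 : η ^ 2 ≤ η / (6 * τ * lam) := by
        rw [le_div_iff₀ (by positivity)]
        nlinarith
      calc η ^ 2 + 4 * η / (τ * lam) ≤ η / (6 * τ * lam) + 4 * η / (τ * lam) := by gcongr
        _ = _ := by field_simp; ring
    calc _ = (1 + 1 / (η * τ * lam / 4)) * η ^ 2 * (κ ^ 2 * X) := by ring
      _ ≤ 25 * η / (6 * τ * lam) * (κ ^ 2 * X) := by gcongr
      _ = _ := by ring
  linarith

namespace Problem

variable {d₁ d₂ : ℕ} {Ξ : Type*} [MeasurableSpace Ξ] {P : Problem d₁ d₂ Ξ}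

namespace Assumptions

variable {L τ δ μ₁ μ₂ : ℝ} (hA : P.Assumptions L τ δ μ₁ μ₂) (hL : 0 ≤ L) (hμ₁ : 0 < μ₁)
  (hμ₂ : 0 < μ₂)
include hA hL hμ₁ hμ₂

lemma ystar_spec {x : E d₁} (hx : x ∈ P.X) :
    P.ystar x ∈ P.Y ∧ IsMaxOn (fun z => P.F x z) P.Y (P.ystar x) := by
  have h : ∃ y, y ∈ P.Y ∧ IsMaxOn (fun z => P.F x z) P.Y y :=
    hA.compactY.exists_isMaxOn hA.nonemptyY fun y hy =>
      (hA.hasGradientAt_Y hL hμ₁ hμ₂ hx hy).differentiableAt.continuousAt.continuousWithinAt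
  exact Classical.epsilon_spec h

lemma ystar_mem {x : E d₁} (hx : x ∈ P.X) : P.ystar x ∈ P.Y := (hA.ystar_spec hL hμ₁ hμ₂ hx).1

lemma F_le_g_sub {x : E d₁} {y : E d₂} (hx : x ∈ P.X) (hy : y ∈ P.Y) :
    P.F x y ≤ P.g x - τ / 2 * ‖y - P.ystar x‖ ^ 2 :=
  le_sub_of_isMaxOn (hA.concave x hx) (hA.ystar_mem hL hμ₁ hμ₂ hx)
    (hA.ystar_spec hL hμ₁ hμ₂ hx).2 hy

lemma norm_gradFX_sub_le_Y {x : E d₁} {y y' : E d₂} (hx : x ∈ P.X) (hy : y ∈ P.Y)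
    (hy' : y' ∈ P.Y) : ‖P.gradFX x y - P.gradFX x y'‖ ≤ L * ‖y - y'‖ := by
  have := hA.norm_gradFX_sub_le hL hμ₁ hμ₂ hx hx hy hy'
  rwa [sub_self, norm_zero, zero_pow two_ne_zero, zero_add, Real.sqrt_sq (norm_nonneg _)] at this

lemma norm_gradFX_sub_le_X {x x' : E d₁} {y : E d₂} (hx : x ∈ P.X) (hx' : x' ∈ P.X)
    (hy : y ∈ P.Y) : ‖P.gradFX x y - P.gradFX x' y‖ ≤ L * ‖x - x'‖ := by
  have := hA.norm_gradFX_sub_le hL hμ₁ hμ₂ hx hx' hy hy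
  rwa [sub_self y, norm_zero, zero_pow two_ne_zero, add_zero, Real.sqrt_sq (norm_nonneg _)] at this

lemma norm_gradFY_sub_le_Y {x : E d₁} {y y' : E d₂} (hx : x ∈ P.X) (hy : y ∈ P.Y)
    (hy' : y' ∈ P.Y) : ‖P.gradFY x y - P.gradFY x y'‖ ≤ L * ‖y - y'‖ := by
  have := hA.norm_gradFY_sub_le hL hμ₁ hμ₂ hx hx hy hy'
  rwa [sub_self, norm_zero, zero_pow two_ne_zero, zero_add, Real.sqrt_sq (norm_nonneg _)] at this

/-- The two strong-concavity gaps, at `x` and at `x'`, add up to `τ‖y*(x') - y*(x)‖²`. Their sum is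
bounded by the increment of `z ↦ F(z, y*(x)) - F(z, y*(x'))`, which is Lipschitz with constant
`L‖y*(x') - y*(x)‖`. -/
lemma norm_ystar_sub_le (hτ : 0 < τ) {x x' : E d₁} (hx : x ∈ P.X) (hx' : x' ∈ P.X) :
    ‖P.ystar x' - P.ystar x‖ ≤ L / τ * ‖x' - x‖ := by
  have hy := hA.ystar_mem hL hμ₁ hμ₂ hx
  have hy' := hA.ystar_mem hL hμ₁ hμ₂ hx'
  have h1 := hA.F_le_g_sub hL hμ₁ hμ₂ hx hy'
  have h2 := hA.F_le_g_sub hL hμ₁ hμ₂ hx' hy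
  have h3 := abs_sub_le_of_hasGradientAt (φ := fun z => P.F z (P.ystar x) - P.F z (P.ystar x'))
    (G := fun z => P.gradFX z (P.ystar x) - P.gradFX z (P.ystar x')) hA.convexX
    (fun z hz => by
      have e1 := hasGradientAt_iff_hasFDerivAt.1 (hA.hasGradientAt_X hL hμ₁ hμ₂ hz hy)
      have e2 := hasGradientAt_iff_hasFDerivAt.1 (hA.hasGradientAt_X hL hμ₁ hμ₂ hz hy')
      rw [hasGradientAt_iff_hasFDerivAt, map_sub]
      exact e1.sub e2)
    (fun z hz => hA.norm_gradFX_sub_le_Y hL hμ₁ hμ₂ hz hy hy') hx' hx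
  have h4 := (le_abs_self _).trans h3
  unfold g at h1 h2
  rw [norm_sub_rev (P.ystar x) (P.ystar x'), norm_sub_rev x x'] at h4
  rw [norm_sub_rev (P.ystar x) (P.ystar x')] at h2
  rw [div_mul_eq_mul_div, le_div_iff₀ hτ]
  have h5 : ‖P.ystar x' - P.ystar x‖ * (‖P.ystar x' - P.ystar x‖ * τ)
      ≤ ‖P.ystar x' - P.ystar x‖ * (L * ‖x' - x‖) := by nlinarith
  rcases (norm_nonneg (P.ystar x' - P.ystar x)).eq_or_lt with h0 | h0
  · rw [← h0, zero_mul]; positivity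
  · exact le_of_mul_le_mul_left h5 h0

/-- The primal function has a quadratic upper bound on `X`. -/
lemma g_le (hτ : 0 < τ) {x x' : E d₁} (hx : x ∈ P.X) (hx' : x' ∈ P.X) :
    P.g x' ≤ P.g x + ⟪P.gradFX x (P.ystar x), x' - x⟫ + (L + L ^ 2 / τ) / 2 * ‖x' - x‖ ^ 2 := by
  have hy := hA.ystar_mem hL hμ₁ hμ₂ hx
  have hy' := hA.ystar_mem hL hμ₁ hμ₂ hx'
  have h1 := hA.F_le_g_sub hL hμ₁ hμ₂ hx hy'
  have h2 := sub_sub_inner_le (φ := fun z => P.F z (P.ystar x'))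
    (G := fun z => P.gradFX z (P.ystar x')) hA.convexX
    (fun z hz => hA.hasGradientAt_X hL hμ₁ hμ₂ hz hy')
    (fun z hz z' hz' => hA.norm_gradFX_sub_le_X hL hμ₁ hμ₂ hz hz' hy') hx hx'
  have h3 := hA.norm_gradFX_sub_le_Y hL hμ₁ hμ₂ hx hy' hy
  have h4 := real_inner_le_norm (P.gradFX x (P.ystar x') - P.gradFX x (P.ystar x)) (x' - x)
  have h5 := mul_le_mul_of_nonneg_right h3 (norm_nonneg (x' - x))
  rw [inner_sub_left] at h4
  -- The gap `τ/2 ‖y*(x') - y*(x)‖²` in `h1` pays for replacing the gradient at `y*(x')` by the one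
  -- at `y*(x)`, so `g` itself need not be differentiated.
  have h6 : L * ‖P.ystar x' - P.ystar x‖ * ‖x' - x‖
      ≤ τ / 2 * ‖P.ystar x' - P.ystar x‖ ^ 2 + L ^ 2 / τ / 2 * ‖x' - x‖ ^ 2 := by
    have e : τ / 2 * ‖P.ystar x' - P.ystar x‖ ^ 2 + L ^ 2 / τ / 2 * ‖x' - x‖ ^ 2
        - L * ‖P.ystar x' - P.ystar x‖ * ‖x' - x‖
        = 1 / (2 * τ) * (τ * ‖P.ystar x' - P.ystar x‖ - L * ‖x' - x‖) ^ 2 := by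
      field_simp; ring
    have : 0 ≤ 1 / (2 * τ) * (τ * ‖P.ystar x' - P.ystar x‖ - L * ‖x' - x‖) ^ 2 := by positivity
    linarith
  change P.F x' (P.ystar x') ≤ _
  nlinarith

/-- Descent of the primal function along a step of the algorithm. -/
lemma g_step_le (hτ : 0 < τ) {x v : E d₁} {y : E d₂} {γ η : ℝ} (hx : x ∈ P.X) (hy : y ∈ P.Y)
    (hγ : 0 < γ) (hη : 0 < η) (hη1 : η ≤ 1) (hγη : (L + L ^ 2 / τ) * (γ * η) ≤ 1 / 2) :
    P.g (x + η • (proj P.X (x - γ • v) - x)) ≤ P.g x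
      + η * γ * (2 * L ^ 2 * ‖y - P.ystar x‖ ^ 2 + 2 * ‖P.gradFX x y - v‖ ^ 2)
      - η / (2 * γ) * ‖proj P.X (x - γ • v) - x‖ ^ 2 := by
  have hy₀ := hA.ystar_mem hL hμ₁ hμ₂ hx
  have hne : P.X.Nonempty := ⟨x, hx⟩
  have hp := inner_sub_proj_nonpos hne hA.compactX hA.convexX (x - γ • v) hx
  have hpm := proj_mem hne hA.compactX (x - γ • v)
  set p := proj P.X (x - γ • v)
  have hx' : x + η • (p - x) ∈ P.X := hA.convexX.add_smul_sub_mem hx hpm ⟨hη.le, hη1⟩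
  have h1 := hA.g_le hL hμ₁ hμ₂ hτ hx hx'
  rw [add_sub_cancel_left, inner_smul_right, norm_smul, Real.norm_of_nonneg hη.le] at h1
  have h2 : γ * ⟪v, p - x⟫ ≤ -‖p - x‖ ^ 2 := by
    have e : ⟪x - γ • v - p, x - p⟫ = ‖p - x‖ ^ 2 + γ * ⟪v, p - x⟫ := by
      have : x - γ • v - p = -((p - x) + γ • v) := by abel
      rw [this, ← neg_sub p x, inner_neg_neg, inner_add_left, real_inner_self_eq_norm_sq,
        real_inner_smul_left]
    linarith
  set g₀ := P.gradFX x (P.ystar x)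
  have h3 : ‖g₀ - v‖ ^ 2 ≤ 2 * L ^ 2 * ‖y - P.ystar x‖ ^ 2 + 2 * ‖P.gradFX x y - v‖ ^ 2 := by
    have e1 := hA.norm_gradFX_sub_le_Y hL hμ₁ hμ₂ hx hy₀ hy
    rw [norm_sub_rev (P.ystar x)] at e1
    have e2 := norm_sub_le_norm_sub_add_norm_sub g₀ (P.gradFX x y) v
    have e3 : ‖g₀ - v‖ ≤ L * ‖y - P.ystar x‖ + ‖P.gradFX x y - v‖ := by linarith
    have e4 := pow_le_pow_left₀ (norm_nonneg _) e3 2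
    nlinarith [sq_nonneg (L * ‖y - P.ystar x‖ - ‖P.gradFX x y - v‖)]
  -- Of the gain `‖p - x‖²/γ` from the projection, Young's inequality spends `1/(4γ)` here and the
  -- curvature of `g` another `1/(4γ)` in `h5`; `1/(2γ)` remains.
  have h4 : ⟪g₀, p - x⟫ ≤ γ * ‖g₀ - v‖ ^ 2 - 3 / (4 * γ) * ‖p - x‖ ^ 2 := by
    have e1 := real_inner_le_norm (g₀ - v) (p - x)
    rw [inner_sub_left] at e1
    have e2 : ⟪v, p - x⟫ ≤ -(‖p - x‖ ^ 2 / γ) := by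
      rw [le_neg, ← neg_le_neg_iff, neg_neg] at *
      rw [← neg_div, le_div_iff₀ hγ]; linarith
    have e3 : ‖g₀ - v‖ * ‖p - x‖ ≤ γ * ‖g₀ - v‖ ^ 2 + 1 / (4 * γ) * ‖p - x‖ ^ 2 := by
      have : γ * ‖g₀ - v‖ ^ 2 + 1 / (4 * γ) * ‖p - x‖ ^ 2 - ‖g₀ - v‖ * ‖p - x‖
          = 1 / γ * (γ * ‖g₀ - v‖ - ‖p - x‖ / 2) ^ 2 := by field_simp; ring
      have : 0 ≤ 1 / γ * (γ * ‖g₀ - v‖ - ‖p - x‖ / 2) ^ 2 := by positivity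
      linarith
    have e4 : 3 / (4 * γ) * ‖p - x‖ ^ 2 = ‖p - x‖ ^ 2 / γ - 1 / (4 * γ) * ‖p - x‖ ^ 2 := by
      field_simp; ring
    linarith
  have h5 : (L + L ^ 2 / τ) / 2 * (η * ‖p - x‖) ^ 2 ≤ η * (1 / (4 * γ) * ‖p - x‖ ^ 2) := by
    have : (L + L ^ 2 / τ) * η ≤ 1 / (2 * γ) := by
      rw [le_div_iff₀ (by positivity)]; nlinarith
    have h6 := mul_le_mul_of_nonneg_right this (by positivity : 0 ≤ η * ‖p - x‖ ^ 2 / 2)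
    calc _ = (L + L ^ 2 / τ) * η * (η * ‖p - x‖ ^ 2 / 2) := by ring
      _ ≤ _ := h6
      _ = _ := by field_simp; ring
  have h7 : η * ⟪g₀, p - x⟫ ≤ η * (γ * (2 * L ^ 2 * ‖y - P.ystar x‖ ^ 2
      + 2 * ‖P.gradFX x y - v‖ ^ 2) - 3 / (4 * γ) * ‖p - x‖ ^ 2) := by
    gcongr
    refine h4.trans ?_
    gcongr
  have h8 : η / (2 * γ) * ‖p - x‖ ^ 2
      = η * (3 / (4 * γ) * ‖p - x‖ ^ 2) - η * (1 / (4 * γ) * ‖p - x‖ ^ 2) := by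
    field_simp; ring
  linarith

/-- Tracking of the inner maximizer along a step of the algorithm. -/
lemma norm_sub_ystar_step_le (hτ : 0 < τ) (hτL : τ ≤ L) {x x' : E d₁} {y w : E d₂} {lam η X : ℝ}
    (hx : x ∈ P.X) (hx' : x' ∈ P.X) (hy : y ∈ P.Y) (hlam : 0 < lam) (hlamL : lam * L ≤ 1 / 6)
    (hη : 0 < η) (hη1 : η ≤ 1) (hX : ‖x' - x‖ ^ 2 ≤ η ^ 2 * X) :
    ‖y + η • (proj P.Y (y + lam • w) - y) - P.ystar x'‖ ^ 2
      ≤ (1 - η * τ * lam / 4) * ‖y - P.ystar x‖ ^ 2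
        - 3 * η / 4 * ‖proj P.Y (y + lam • w) - y‖ ^ 2
        + 25 * η * lam / (6 * τ) * ‖P.gradFY x y - w‖ ^ 2
        + 25 * (L / τ) ^ 2 * η / (6 * τ * lam) * X := by
  have hy₀ := hA.ystar_mem hL hμ₁ hμ₂ hx
  have hp := inner_sub_proj_nonpos hA.nonemptyY hA.compactY hA.convexY (y + lam • w) hy₀
  have hpm := proj_mem hA.nonemptyY hA.compactY (y + lam • w)
  set p := proj P.Y (y + lam • w)
  set s := P.ystar x
  set G := P.gradFY x y
  -- Bound `F` from above at the maximizer `s` and from below at the projected point `p`; since `F x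
  -- p ≤ F x s`, the function values cancel and `h7` remains.
  have h1 := le_add_inner_of_strongConcaveOn (hA.concave x hx) hy hy₀
    (hA.hasGradientAt_Y hL hμ₁ hμ₂ hx hy)
  have h2 := (abs_le.1 (abs_sub_sub_inner_le (φ := fun z => P.F x z)
    (G := fun z => P.gradFY x z) hA.convexY
    (fun z hz => hA.hasGradientAt_Y hL hμ₁ hμ₂ hx hz)
    (fun z hz z' hz' => hA.norm_gradFY_sub_le_Y hL hμ₁ hμ₂ hx hz hz') hy hpm)).1
  have h3 : P.F x p ≤ P.F x s := (hA.ystar_spec hL hμ₁ hμ₂ hx).2 hpm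
  -- the projection inequality
  have h4 : lam * ⟪w, s - p⟫ ≤ ⟪p - y, s - y⟫ - ‖p - y‖ ^ 2 := by
    have e1 : ⟪y + lam • w - p, s - p⟫ = lam * ⟪w, s - p⟫ - ⟪p - y, s - p⟫ := by
      have : y + lam • w - p = lam • w - (p - y) := by abel
      rw [this, inner_sub_left, real_inner_smul_left]
    have e2 : ⟪p - y, s - p⟫ = ⟪p - y, s - y⟫ - ‖p - y‖ ^ 2 := by
      have : s - p = (s - y) - (p - y) := by abel
      rw [this, inner_sub_right, real_inner_self_eq_norm_sq]
    linarith
  have young : ∀ a c : E d₂, ⟪a, c⟫ ≤ 1 / τ * ‖a‖ ^ 2 + τ / 4 * ‖c‖ ^ 2 := by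
    intro a c
    have e1 := real_inner_le_norm a c
    have e2 : 1 / τ * ‖a‖ ^ 2 + τ / 4 * ‖c‖ ^ 2 - ‖a‖ * ‖c‖ = 1 / τ * (‖a‖ - τ / 2 * ‖c‖) ^ 2 := by
      field_simp; ring
    have : 0 ≤ 1 / τ * (‖a‖ - τ / 2 * ‖c‖) ^ 2 := by positivity
    linarith
  have h5 := young (G - w) (s - y)
  have h6 := young (G - w) (y - p)
  rw [norm_sub_rev s y] at h1 h5
  rw [norm_sub_rev y p] at h6
  have e7 : ⟪G, s - y⟫ - ⟪G, p - y⟫ = ⟪w, s - p⟫ + ⟪G - w, s - y⟫ + ⟪G - w, y - p⟫ := by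
    simp only [inner_sub_left, inner_sub_right]; ring
  have h7 : 0 ≤ L / 2 * ‖p - y‖ ^ 2 + ⟪w, s - p⟫ + 2 / τ * ‖G - w‖ ^ 2
      + τ / 4 * ‖p - y‖ ^ 2 - τ / 4 * ‖y - s‖ ^ 2 := by
    have : 2 / τ * ‖G - w‖ ^ 2 = 1 / τ * ‖G - w‖ ^ 2 + 1 / τ * ‖G - w‖ ^ 2 := by ring
    linarith
  have h8 : -⟪p - y, s - y⟫ ≤ lam * (L / 2 * ‖p - y‖ ^ 2 + 2 / τ * ‖G - w‖ ^ 2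
      + τ / 4 * ‖p - y‖ ^ 2 - τ / 4 * ‖y - s‖ ^ 2) - ‖p - y‖ ^ 2 := by
    have := mul_nonneg hlam.le h7
    linarith
  -- `λL ≤ 1/6` and `τ ≤ L` give `λ(L/2 + τ/4) ≤ 1/8`. In `h10` this leaves `2η · 7/8 - η² ≥ 3η/4`.
  have h9 : -⟪p - y, s - y⟫ ≤ -(7 / 8) * ‖p - y‖ ^ 2 + 2 * lam / τ * ‖G - w‖ ^ 2
      - lam * τ / 4 * ‖y - s‖ ^ 2 := by
    have a1 : lam * (L / 2 + τ / 4) ≤ 1 / 8 := by nlinarith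
    have a2 := mul_le_mul_of_nonneg_right a1 (sq_nonneg ‖p - y‖)
    have a3 : 2 * lam / τ * ‖G - w‖ ^ 2 = lam * (2 / τ * ‖G - w‖ ^ 2) := by ring
    rw [a3]; linarith
  -- distance to the old maximizer
  have h10 : ‖y + η • (p - y) - s‖ ^ 2 ≤ (1 - η * τ * lam / 2) * ‖y - s‖ ^ 2
      - 3 * η / 4 * ‖p - y‖ ^ 2 + 4 * η * lam / τ * ‖G - w‖ ^ 2 := by
    have a1 : ‖y + η • (p - y) - s‖ ^ 2
        = ‖y - s‖ ^ 2 + 2 * η * (-⟪p - y, s - y⟫) + η ^ 2 * ‖p - y‖ ^ 2 := by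
      have : y + η • (p - y) - s = (y - s) + η • (p - y) := by abel
      rw [this, norm_add_sq_real, norm_smul, mul_pow, Real.norm_eq_abs, sq_abs, inner_smul_right,
        real_inner_comm, ← neg_sub s y, inner_neg_right, neg_sub]
      ring
    have a2 := mul_le_mul_of_nonneg_left h9 (by positivity : 0 ≤ 2 * η)
    have a3 : η ^ 2 * ‖p - y‖ ^ 2 ≤ η * ‖p - y‖ ^ 2 := by
      have : η ^ 2 ≤ η := by nlinarith
      gcongr
    have a4 : 4 * η * lam / τ * ‖G - w‖ ^ 2 = 2 * η * (2 * lam / τ * ‖G - w‖ ^ 2) := by ring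
    rw [a1, a4]; linarith
  -- movement of the maximizer
  have h11 : ‖s - P.ystar x'‖ ^ 2 ≤ (L / τ) ^ 2 * (η ^ 2 * X) := by
    have a1 := hA.norm_ystar_sub_le hL hμ₁ hμ₂ hτ hx hx'
    rw [norm_sub_rev] at a1
    have a2 := pow_le_pow_left₀ (norm_nonneg _) a1 2
    rw [mul_pow] at a2
    exact a2.trans (by gcongr)
  set q := y + η • (p - y)
  set ρ := η * τ * lam / 4 with hρ
  have hρ0 : 0 < ρ := by positivity
  have hητlam : η * τ * lam ≤ 1 / 6 :=
    calc η * τ * lam = η * (lam * τ) := by ring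
      _ ≤ 1 * (lam * L) := by gcongr
      _ ≤ 1 / 6 := by linarith
  -- The Young parameter `ρ` is half of the contraction rate `ητλ/2`, so half of the contraction
  -- survives the displacement of the maximizer.
  have h12 : ‖q - P.ystar x'‖ ^ 2
      ≤ (1 + ρ) * ‖q - s‖ ^ 2 + (1 + 1 / ρ) * ‖s - P.ystar x'‖ ^ 2 := by
    have a1 := norm_sub_le_norm_sub_add_norm_sub q s (P.ystar x')
    have a2 := pow_le_pow_left₀ (norm_nonneg _) a1 2
    have a3 : (1 + ρ) * ‖q - s‖ ^ 2 + (1 + 1 / ρ) * ‖s - P.ystar x'‖ ^ 2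
        - (‖q - s‖ + ‖s - P.ystar x'‖) ^ 2
        = 1 / ρ * (ρ * ‖q - s‖ - ‖s - P.ystar x'‖) ^ 2 := by field_simp; ring
    have : 0 ≤ 1 / ρ * (ρ * ‖q - s‖ - ‖s - P.ystar x'‖) ^ 2 := by positivity
    linarith
  have hX0 : 0 ≤ X := by
    have : 0 ≤ η ^ 2 * X := (sq_nonneg _).trans hX
    exact nonneg_of_mul_nonneg_right this (by positivity)
  have h13 := mul_le_mul_of_nonneg_left h10 (by positivity : 0 ≤ 1 + ρ)
  have h14 := mul_le_mul_of_nonneg_left h11 (by positivity : 0 ≤ 1 + 1 / ρ)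
  exact h12.trans (tracking_arith hτ hlam hη hητlam hX0 (sq_nonneg _) (sq_nonneg _)
    (sq_nonneg _) h13 h14)

end Assumptions

end Problem

end AccZOMDA

/-! ### Second moments of mini-batch averages -/

namespace AccZOMDA

open scoped RealInnerProductSpace

section BatchMoments

variable {α : Type*} [MeasurableSpace α] {ν : Measure α} [IsProbabilityMeasure ν] {d b : ℕ}

lemma memLp_eval_pi {F : Type*} [NormedAddCommGroup F] {f : α → F} (hf : MemLp f 2 ν)
    (i : Fin b) : MemLp (fun B : Fin b → α => f (B i)) 2 (Measure.pi fun _ => ν) :=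
  hf.comp_measurePreserving (measurePreserving_eval (fun _ : Fin b => ν) i)

/-- The cross term has mean zero, and the variance of a sum of independent terms is the sum of the
variances. -/
lemma integral_const_add_batch_mean_sq {f : α → ℝ} (hf : MemLp f 2 ν) (h0 : ∫ s, f s ∂ν = 0)
    (hb : 0 < b) (c : ℝ) :
    Integrable (fun B : Fin b → α => (c + (b : ℝ)⁻¹ * ∑ i, f (B i)) ^ 2) (Measure.pi fun _ => ν) ∧
    ∫ B, (c + (b : ℝ)⁻¹ * ∑ i, f (B i)) ^ 2 ∂(Measure.pi fun _ : Fin b => ν)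
      = c ^ 2 + (b : ℝ)⁻¹ * ∫ s, f s ^ 2 ∂ν := by
  have hS : MemLp (fun B : Fin b → α => ∑ i, f (B i)) 2 (Measure.pi fun _ => ν) :=
    memLp_finsetSum _ fun i _ => memLp_eval_pi hf i
  have hS1 : Integrable (fun B : Fin b → α => ∑ i, f (B i)) (Measure.pi fun _ => ν) :=
    hS.integrable (by norm_num)
  have hS2 : Integrable (fun B : Fin b → α => (∑ i, f (B i)) ^ 2) (Measure.pi fun _ => ν) :=
    hS.integrable_sq
  have hmean : ∫ B, ∑ i, f (B i) ∂(Measure.pi fun _ : Fin b => ν) = 0 := by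
    rw [integral_finsetSum _ fun i _ => (memLp_eval_pi hf i).integrable (by norm_num)]
    refine Finset.sum_eq_zero fun i _ => ?_
    rw [← h0]
    have hm := measurePreserving_eval (fun _ : Fin b => ν) i
    conv_rhs => rw [← hm.map_eq]
    rw [integral_map hm.measurable.aemeasurable]
    rw [hm.map_eq]; exact hf.1
  have hvar : ∫ B, (∑ i, f (B i)) ^ 2 ∂(Measure.pi fun _ : Fin b => ν) = b * ∫ s, f s ^ 2 ∂ν := by
    have h1 := variance_sum_pi (μ := fun _ : Fin b => ν) (X := fun _ => f) fun _ => hf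
    have e : (∑ i : Fin b, fun ω : Fin b → α => f (ω i)) = fun B => ∑ i, f (B i) := by
      ext B; simp
    rw [e, variance_of_integral_eq_zero hS.1.aemeasurable hmean] at h1
    simp only [variance_of_integral_eq_zero hf.1.aemeasurable h0] at h1
    rw [h1]; simp
  have e : ∀ B : Fin b → α, (c + (b : ℝ)⁻¹ * ∑ i, f (B i)) ^ 2
      = c ^ 2 + 2 * c * (b : ℝ)⁻¹ * ∑ i, f (B i) + ((b : ℝ)⁻¹) ^ 2 * (∑ i, f (B i)) ^ 2 := by
    intro B; ring
  simp_rw [e]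
  have i1 : Integrable (fun B : Fin b → α => c ^ 2 + 2 * c * (b : ℝ)⁻¹ * ∑ i, f (B i))
      (Measure.pi fun _ => ν) := (integrable_const _).add (hS1.const_mul _)
  refine ⟨i1.add (hS2.const_mul _), ?_⟩
  rw [integral_add i1 (hS2.const_mul _), integral_add (integrable_const _) (hS1.const_mul _),
    integral_const_mul, integral_const_mul, hmean, hvar]
  have : (b : ℝ) ≠ 0 := by positivity
  simp only [integral_const, probReal_univ, smul_eq_mul]
  field_simp; ring

/-- Second moment of a constant plus a mini-batch average of centred vectors. -/
lemma integral_norm_const_add_batch_mean_sq {f : α → E d} (hf : MemLp f 2 ν)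
    (h0 : ∫ s, f s ∂ν = 0) (hb : 0 < b) (c : E d) :
    Integrable (fun B : Fin b → α => ‖c + (b : ℝ)⁻¹ • ∑ i, f (B i)‖ ^ 2)
      (Measure.pi fun _ => ν) ∧
    ∫ B, ‖c + (b : ℝ)⁻¹ • ∑ i, f (B i)‖ ^ 2 ∂(Measure.pi fun _ : Fin b => ν)
      = ‖c‖ ^ 2 + (b : ℝ)⁻¹ * ∫ s, ‖f s‖ ^ 2 ∂ν := by
  have hi : Integrable f ν := hf.integrable (by norm_num)
  have hl : ∀ l, MemLp (fun s => f s l) 2 ν := fun l =>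
    (EuclideanSpace.proj (𝕜 := ℝ) l : E d →L[ℝ] ℝ).comp_memLp' hf
  have hl0 : ∀ l, ∫ s, f s l ∂ν = 0 := fun l => by
    have := (EuclideanSpace.proj (𝕜 := ℝ) l : E d →L[ℝ] ℝ).integral_comp_comm hi
    rw [h0] at this
    simpa using this
  have hk := fun l => integral_const_add_batch_mean_sq (hl l) (hl0 l) hb (c l)
  have e : ∀ B : Fin b → α, ‖c + (b : ℝ)⁻¹ • ∑ i, f (B i)‖ ^ 2
      = ∑ l, (c l + (b : ℝ)⁻¹ * ∑ i, f (B i) l) ^ 2 := by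
    intro B
    rw [EuclideanSpace.real_norm_sq_eq]
    simp
  simp_rw [e]
  refine ⟨integrable_finsetSum _ fun l _ => (hk l).1, ?_⟩
  rw [integral_finsetSum _ fun l _ => (hk l).1, EuclideanSpace.real_norm_sq_eq]
  simp_rw [EuclideanSpace.real_norm_sq_eq]
  rw [integral_finsetSum _ fun l _ => (hl l).integrable_sq, Finset.mul_sum, ← Finset.sum_add_distrib]
  exact Finset.sum_congr rfl fun l _ => (hk l).2

lemma integral_batch_mean_sub_mean_sq_le {e : α → E d} (he : MemLp e 2 ν) (hb : 0 < b) {M : ℝ}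
    (hM : ∫ s, ‖e s - ∫ t, e t ∂ν‖ ^ 2 ∂ν ≤ M) :
    Integrable (fun B : Fin b → α => ‖(b : ℝ)⁻¹ • ∑ i, e (B i) - ∫ t, e t ∂ν‖ ^ 2)
      (Measure.pi fun _ => ν) ∧
    ∫ B, ‖(b : ℝ)⁻¹ • ∑ i, e (B i) - ∫ t, e t ∂ν‖ ^ 2 ∂(Measure.pi fun _ : Fin b => ν)
      ≤ M / b := by
  set h := ∫ t, e t ∂ν with hh
  have hi : Integrable e ν := he.integrable (by norm_num)
  obtain ⟨k1, k2⟩ := integral_norm_const_add_batch_mean_sq (f := fun s => e s - h) (b := b)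
    (he.sub (memLp_const h)) (by rw [integral_sub hi (integrable_const _)]; simp [hh]) hb 0
  have hb' : (b : ℝ) ≠ 0 := by positivity
  have e1 : ∀ B : Fin b → α, (0 : E d) + (b : ℝ)⁻¹ • ∑ i, (e (B i) - h)
      = (b : ℝ)⁻¹ • ∑ i, e (B i) - h := by
    intro B
    rw [Finset.sum_sub_distrib, Finset.sum_const, Finset.card_univ, Fintype.card_fin, smul_sub,
      ← Nat.cast_smul_eq_nsmul ℝ, smul_smul, inv_mul_cancel₀ hb', one_smul, zero_add]
  simp_rw [e1] at k1 k2
  refine ⟨k1, ?_⟩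
  rw [k2, norm_zero, zero_pow two_ne_zero, zero_add, div_eq_inv_mul]
  gcongr

/-- One step of the recursive-momentum estimator in mean square. -/
lemma integral_recursive_momentum_sq_le {e e' : α → E d} (he : MemLp e 2 ν) (he' : MemLp e' 2 ν)
    (hb : 0 < b) {a M V : ℝ} (ha : 0 ≤ a) (ha1 : a ≤ 1)
    (hV : ∫ s, ‖e' s - ∫ t, e' t ∂ν‖ ^ 2 ∂ν ≤ V) (hM : ∫ s, ‖e' s - e s‖ ^ 2 ∂ν ≤ M) (v : E d) :
    Integrable (fun B : Fin b → α => ‖(b : ℝ)⁻¹ • ∑ i, e' (B i)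
      + (1 - a) • (v - (b : ℝ)⁻¹ • ∑ i, e (B i)) - ∫ t, e' t ∂ν‖ ^ 2) (Measure.pi fun _ => ν) ∧
    ∫ B, ‖(b : ℝ)⁻¹ • ∑ i, e' (B i) + (1 - a) • (v - (b : ℝ)⁻¹ • ∑ i, e (B i))
        - ∫ t, e' t ∂ν‖ ^ 2 ∂(Measure.pi fun _ : Fin b => ν)
      ≤ (1 - a) * ‖v - ∫ t, e t ∂ν‖ ^ 2 + (2 * M + 2 * a ^ 2 * V) / b := by
  set h := ∫ t, e t ∂ν with hh
  set h' := ∫ t, e' t ∂ν with hh'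
  have hi : Integrable e ν := he.integrable (by norm_num)
  have hi' : Integrable e' ν := he'.integrable (by norm_num)
  have hb' : (b : ℝ) ≠ 0 := by positivity
  -- The new error is `(1 - a)(v - h)` plus the batch mean of this centred vector: the centred
  -- difference of the two estimates plus `a` times the centred new estimate.
  let f : α → E d := fun s => (1 - a) • ((e' s - e s) - (h' - h)) + a • (e' s - h')
  have hD : MemLp (fun s => (e' s - e s) - (h' - h)) 2 ν := (he'.sub he).sub (memLp_const _)
  have hR : MemLp (fun s => e' s - h') 2 ν := he'.sub (memLp_const _)
  have hf : MemLp f 2 ν := (hD.const_smul (1 - a)).add (hR.const_smul a)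
  have hd0 : ∫ s, (e' s - e s) ∂ν = h' - h := integral_sub hi' hi
  have hf0 : ∫ s, f s ∂ν = 0 := by
    have j1 : Integrable (fun s => (e' s - e s) - (h' - h)) ν := hD.integrable (by norm_num)
    have j2 : Integrable (fun s => e' s - h') ν := hR.integrable (by norm_num)
    have j3 : ∫ s, ((e' s - e s) - (h' - h)) ∂ν = 0 := by
      rw [integral_sub (by exact hi'.sub hi) (integrable_const _), hd0]; simp
    have j4 : ∫ s, (e' s - h') ∂ν = 0 := by
      rw [integral_sub hi' (integrable_const _)]; simp [hh']
    change ∫ s, ((1 - a) • ((e' s - e s) - (h' - h)) + a • (e' s - h')) ∂ν = 0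
    rw [integral_add (by exact j1.smul (1 - a)) (by exact j2.smul a), integral_smul, integral_smul, j3, j4]
    simp
  obtain ⟨k1, k2⟩ := integral_norm_const_add_batch_mean_sq hf hf0 hb ((1 - a) • (v - h))
  have e1 : ∀ B : Fin b → α, (1 - a) • (v - h) + (b : ℝ)⁻¹ • ∑ i, f (B i)
      = (b : ℝ)⁻¹ • ∑ i, e' (B i) + (1 - a) • (v - (b : ℝ)⁻¹ • ∑ i, e (B i)) - h' := by
    intro B
    have : ∀ s, f s = e' s - (1 - a) • e s - (h' - (1 - a) • h) := by
      intro s; simp only [f]; module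
    simp_rw [this]
    rw [Finset.sum_sub_distrib, Finset.sum_sub_distrib, Finset.sum_const, Finset.card_univ,
      Fintype.card_fin, ← Finset.smul_sum, ← Nat.cast_smul_eq_nsmul ℝ,
      smul_sub (b : ℝ)⁻¹ _ ((b : ℝ) • _), inv_smul_smul₀ hb']
    module
  simp_rw [e1] at k1 k2
  refine ⟨k1, ?_⟩
  have hV0 : 0 ≤ V := (integral_nonneg fun s => by positivity).trans hV
  have hM0 : 0 ≤ M := (integral_nonneg fun s => by positivity).trans hM
  have hDM : ∫ s, ‖(e' s - e s) - (h' - h)‖ ^ 2 ∂ν ≤ M := by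
    have := integral_norm_sub_integral_sq_le (f := fun s => e' s - e s) (he'.sub he) 0
    simp only [sub_zero, hd0] at this
    exact this.trans hM
  have hf2 : ∫ s, ‖f s‖ ^ 2 ∂ν ≤ 2 * M + 2 * a ^ 2 * V := by
    have i1 : Integrable (fun s => ‖(e' s - e s) - (h' - h)‖ ^ 2) ν :=
      hD.integrable_norm_pow (by norm_num)
    have i2 : Integrable (fun s => ‖e' s - h'‖ ^ 2) ν := hR.integrable_norm_pow (by norm_num)
    calc ∫ s, ‖f s‖ ^ 2 ∂ν
        ≤ ∫ s, (2 * ‖(e' s - e s) - (h' - h)‖ ^ 2 + 2 * a ^ 2 * ‖e' s - h'‖ ^ 2) ∂ν := by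
          refine integral_mono (hf.integrable_norm_pow (by norm_num))
            ((i1.const_mul _).add (i2.const_mul _)) fun s => ?_
          have n1 := norm_add_le ((1 - a) • ((e' s - e s) - (h' - h))) (a • (e' s - h'))
          rw [norm_smul, norm_smul, Real.norm_of_nonneg (sub_nonneg.2 ha1),
            Real.norm_of_nonneg ha] at n1
          set p := ‖(e' s - e s) - (h' - h)‖
          set q := ‖e' s - h'‖
          have hp : 0 ≤ p := norm_nonneg _
          have n2 : ‖f s‖ ≤ p + a * q := n1.trans (by nlinarith)
          have n3 := pow_le_pow_left₀ (norm_nonneg _) n2 2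
          change ‖f s‖ ^ 2 ≤ 2 * p ^ 2 + 2 * a ^ 2 * q ^ 2
          nlinarith [sq_nonneg (p - a * q)]
      _ = 2 * ∫ s, ‖(e' s - e s) - (h' - h)‖ ^ 2 ∂ν + 2 * a ^ 2 * ∫ s, ‖e' s - h'‖ ^ 2 ∂ν := by
          rw [integral_add (i1.const_mul _) (i2.const_mul _), integral_const_mul,
            integral_const_mul]
      _ ≤ _ := by gcongr
  rw [k2, norm_smul, mul_pow, Real.norm_of_nonneg (sub_nonneg.2 ha1), div_eq_inv_mul]
  gcongr
  nlinarith

end BatchMoments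

end AccZOMDA

/-! ### Estimation errors along the algorithm -/

namespace AccZOMDA

open scoped RealInnerProductSpace

/-- The distribution of one sample `(ξ, û, ũ)`. -/
noncomputable def sampleLaw {d₁ d₂ : ℕ} {Ξ : Type*} [MeasurableSpace Ξ] (P : Problem d₁ d₂ Ξ) :
    Measure (Ξ × E d₁ × E d₂) :=
  P.law.prod ((sphereUniform d₁).prod (sphereUniform d₂))

namespace Problem

variable {d₁ d₂ : ℕ} {Ξ : Type*} [MeasurableSpace Ξ] (P : Problem d₁ d₂ Ξ)

/-- Squared error of the gradient estimate `v`. -/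
noncomputable def errX (μ : ℝ) (s : State d₁ d₂) : ℝ := ‖s.v - P.meanX μ s.x s.y‖ ^ 2

/-- Squared error of the gradient estimate `w`. -/
noncomputable def errY (μ : ℝ) (s : State d₁ d₂) : ℝ := ‖s.w - P.meanY μ s.x s.y‖ ^ 2

/-- The next iterate in `x`. -/
noncomputable def nextX (q : Params) (t : ℕ) (s : State d₁ d₂) : E d₁ :=
  s.x + q.η t • (P.xtilde q.γ s - s.x)

/-- The next iterate in `y`. -/
noncomputable def nextY (q : Params) (t : ℕ) (s : State d₁ d₂) : E d₂ :=
  s.y + q.η t • (P.ytilde q.lam s - s.y)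

variable {b : ℕ}

lemma gradX_val (μ : ℝ) (x : E d₁) (y : E d₂) (B : Batch d₁ d₂ Ξ b) :
    (P.gradX μ x y B).val = (b : ℝ)⁻¹ • ∑ i, (P.estX μ x y (B i).1 (B i).2.1).val := rfl

lemma gradY_val (μ : ℝ) (x : E d₁) (y : E d₂) (B : Batch d₁ d₂ Ξ b) :
    (P.gradY μ x y B).val = (b : ℝ)⁻¹ • ∑ i, (P.estY μ x y (B i).1 (B i).2.2).val := rfl

lemma initState_val (μ₁ μ₂ : ℝ) (x : E d₁) (y : E d₂) (B : Batch d₁ d₂ Ξ b) :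
    (P.initState μ₁ μ₂ x y B).val = ⟨x, y, (P.gradX μ₁ x y B).val, (P.gradY μ₂ x y B).val⟩ := rfl

lemma step_val (q : Params) (μ₁ μ₂ : ℝ) (t : ℕ) (B : Batch d₁ d₂ Ξ b) (s : State d₁ d₂) :
    (P.step q μ₁ μ₂ t B s).val = ⟨P.nextX q t s, P.nextY q t s,
      (P.gradX μ₁ (P.nextX q t s) (P.nextY q t s) B).val
        + (1 - q.c₁ * q.η t ^ 2) • (s.v - (P.gradX μ₁ s.x s.y B).val),
      (P.gradY μ₂ (P.nextX q t s) (P.nextY q t s) B).val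
        + (1 - q.c₂ * q.η t ^ 2) • (s.w - (P.gradY μ₂ s.x s.y B).val)⟩ := rfl

variable {P}

namespace Assumptions

variable {L τ δ μ₁ μ₂ : ℝ} (hA : P.Assumptions L τ δ μ₁ μ₂) (hd₁ : 0 < d₁) (hd₂ : 0 < d₂)
include hA hd₁ hd₂

lemma isProbabilityMeasure_sampleLaw : IsProbabilityMeasure (sampleLaw P) := by
  have := hA.prob
  have := isProbabilityMeasure_sphereUniform hd₁
  have := isProbabilityMeasure_sphereUniform hd₂
  unfold sampleLaw
  infer_instance

lemma measurePreserving_sampleX : MeasurePreserving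
    (fun s : Ξ × E d₁ × E d₂ => (s.1, s.2.1)) (sampleLaw P) (P.law.prod (sphereUniform d₁)) := by
  have := hA.prob
  have := isProbabilityMeasure_sphereUniform hd₁
  have := isProbabilityMeasure_sphereUniform hd₂
  exact (MeasurePreserving.id P.law).prod
    (measurePreserving_fst (μ := sphereUniform d₁) (ν := sphereUniform d₂))

lemma measurePreserving_sampleY : MeasurePreserving
    (fun s : Ξ × E d₁ × E d₂ => (s.1, s.2.2)) (sampleLaw P) (P.law.prod (sphereUniform d₂)) := by
  have := hA.prob
  have := isProbabilityMeasure_sphereUniform hd₁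
  have := isProbabilityMeasure_sphereUniform hd₂
  exact (MeasurePreserving.id P.law).prod
    (measurePreserving_snd (μ := sphereUniform d₁) (ν := sphereUniform d₂))

lemma integral_sampleX {F : Type*} [NormedAddCommGroup F] [NormedSpace ℝ F] {f : Ξ × E d₁ → F}
    (hf : AEStronglyMeasurable f (P.law.prod (sphereUniform d₁))) :
    ∫ s, f (s.1, s.2.1) ∂sampleLaw P = ∫ s, f s ∂P.law.prod (sphereUniform d₁) := by
  have h := hA.measurePreserving_sampleX hd₁ hd₂
  rw [← h.map_eq] at hf
  rw [← integral_map h.measurable.aemeasurable hf, h.map_eq]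

lemma integral_sampleY {F : Type*} [NormedAddCommGroup F] [NormedSpace ℝ F] {f : Ξ × E d₂ → F}
    (hf : AEStronglyMeasurable f (P.law.prod (sphereUniform d₂))) :
    ∫ s, f (s.1, s.2.2) ∂sampleLaw P = ∫ s, f s ∂P.law.prod (sphereUniform d₂) := by
  have h := hA.measurePreserving_sampleY hd₁ hd₂
  rw [← h.map_eq] at hf
  rw [← integral_map h.measurable.aemeasurable hf, h.map_eq]

lemma memLp_comp_sampleX {F : Type*} [NormedAddCommGroup F] {f : Ξ × E d₁ → F}
    (hf : MemLp f 2 (P.law.prod (sphereUniform d₁))) :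
    MemLp (fun s : Ξ × E d₁ × E d₂ => f (s.1, s.2.1)) 2 (sampleLaw P) :=
  hf.comp_measurePreserving (hA.measurePreserving_sampleX hd₁ hd₂)

lemma memLp_sampleX {x : E d₁} {y : E d₂} (hx : x ∈ P.X) (hy : y ∈ P.Y) :
    MemLp (fun s : Ξ × E d₁ × E d₂ => (P.estX μ₁ x y s.1 s.2.1).val) 2 (sampleLaw P) :=
  hA.memLp_comp_sampleX hd₁ hd₂ (f := fun s => (P.estX μ₁ x y s.1 s.2).val)
    (hA.memLp_estX hd₁ hx hy)

lemma memLp_comp_sampleY {F : Type*} [NormedAddCommGroup F] {f : Ξ × E d₂ → F}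
    (hf : MemLp f 2 (P.law.prod (sphereUniform d₂))) :
    MemLp (fun s : Ξ × E d₁ × E d₂ => f (s.1, s.2.2)) 2 (sampleLaw P) :=
  hf.comp_measurePreserving (hA.measurePreserving_sampleY hd₁ hd₂)

lemma memLp_sampleY {x : E d₁} {y : E d₂} (hx : x ∈ P.X) (hy : y ∈ P.Y) :
    MemLp (fun s : Ξ × E d₁ × E d₂ => (P.estY μ₂ x y s.1 s.2.2).val) 2 (sampleLaw P) :=
  hA.memLp_comp_sampleY hd₁ hd₂ (f := fun s => (P.estY μ₂ x y s.1 s.2).val)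
    (hA.memLp_estY hd₂ hx hy)

lemma mean_sampleX (x : E d₁) (y : E d₂) :
    ∫ s, (P.estX μ₁ x y s.1 s.2.1).val ∂sampleLaw P = P.meanX μ₁ x y :=
  hA.integral_sampleX hd₁ hd₂ (hA.measurable_estX_apply x y).aestronglyMeasurable

lemma mean_sampleY (x : E d₁) (y : E d₂) :
    ∫ s, (P.estY μ₂ x y s.1 s.2.2).val ∂sampleLaw P = P.meanY μ₂ x y :=
  hA.integral_sampleY hd₁ hd₂ (hA.measurable_estY_apply x y).aestronglyMeasurable

lemma variance_sampleX_le {x : E d₁} {y : E d₂} (hx : x ∈ P.X) (hy : y ∈ P.Y) :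
    ∫ s, ‖(P.estX μ₁ x y s.1 s.2.1).val - P.meanX μ₁ x y‖ ^ 2 ∂sampleLaw P ≤ δ ^ 2 :=
  (hA.integral_sampleX hd₁ hd₂ (f := fun s => ‖(P.estX μ₁ x y s.1 s.2).val - P.meanX μ₁ x y‖ ^ 2)
    (((hA.measurable_estX_apply x y).sub_const _).norm.pow_const 2).aestronglyMeasurable).trans_le
    (hA.variance_estX_le hd₁ hx hy)

lemma variance_sampleY_le {x : E d₁} {y : E d₂} (hx : x ∈ P.X) (hy : y ∈ P.Y) :
    ∫ s, ‖(P.estY μ₂ x y s.1 s.2.2).val - P.meanY μ₂ x y‖ ^ 2 ∂sampleLaw P ≤ δ ^ 2 :=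
  (hA.integral_sampleY hd₁ hd₂ (f := fun s => ‖(P.estY μ₂ x y s.1 s.2).val - P.meanY μ₂ x y‖ ^ 2)
    (((hA.measurable_estY_apply x y).sub_const _).norm.pow_const 2).aestronglyMeasurable).trans_le
    (hA.variance_estY_le hd₂ hx hy)

lemma integral_errX_init_le (hb : 0 < b) {x : E d₁} {y : E d₂} (hx : x ∈ P.X) (hy : y ∈ P.Y) :
    Integrable (fun B => P.errX μ₁ (P.initState μ₁ μ₂ x y B).val) (batchLaw P b) ∧
    ∫ B, P.errX μ₁ (P.initState μ₁ μ₂ x y B).val ∂batchLaw P b ≤ δ ^ 2 / b := by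
  have := hA.isProbabilityMeasure_sampleLaw hd₁ hd₂
  have hm := hA.mean_sampleX hd₁ hd₂ x y
  have h := integral_batch_mean_sub_mean_sq_le (hA.memLp_sampleX hd₁ hd₂ hx hy) hb
    (M := δ ^ 2) (by rw [hm]; exact hA.variance_sampleX_le hd₁ hd₂ hx hy)
  rw [hm] at h
  exact h

lemma integral_errY_init_le (hb : 0 < b) {x : E d₁} {y : E d₂} (hx : x ∈ P.X) (hy : y ∈ P.Y) :
    Integrable (fun B => P.errY μ₂ (P.initState μ₁ μ₂ x y B).val) (batchLaw P b) ∧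
    ∫ B, P.errY μ₂ (P.initState μ₁ μ₂ x y B).val ∂batchLaw P b ≤ δ ^ 2 / b := by
  have := hA.isProbabilityMeasure_sampleLaw hd₁ hd₂
  have hm := hA.mean_sampleY hd₁ hd₂ x y
  have h := integral_batch_mean_sub_mean_sq_le (hA.memLp_sampleY hd₁ hd₂ hx hy) hb
    (M := δ ^ 2) (by rw [hm]; exact hA.variance_sampleY_le hd₁ hd₂ hx hy)
  rw [hm] at h
  exact h

variable (hL : 0 ≤ L) (hμ₁ : 0 < μ₁) (hμ₂ : 0 < μ₂)
include hL hμ₁ hμ₂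

/-- The variance `δ²` appears only with the factor `(c₁η²)²`. The rest of the noise is governed by
the squared displacement, of order `η²`, because both estimates share the mini-batch. -/
lemma integral_errX_step_le (hb : 0 < b) (q : Params) (t : ℕ) {s : State d₁ d₂} (hx : s.x ∈ P.X)
    (hy : s.y ∈ P.Y) (hx' : P.nextX q t s ∈ P.X) (hy' : P.nextY q t s ∈ P.Y)
    (ha : 0 ≤ q.c₁ * q.η t ^ 2) (ha1 : q.c₁ * q.η t ^ 2 ≤ 1) :
    Integrable (fun B => P.errX μ₁ (P.step q μ₁ μ₂ t B s).val) (batchLaw P b) ∧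
    ∫ B, P.errX μ₁ (P.step q μ₁ μ₂ t B s).val ∂batchLaw P b
      ≤ (1 - q.c₁ * q.η t ^ 2) * P.errX μ₁ s
        + (2 * (2 * d₁ * (L ^ 2 * (q.η t ^ 2 * (‖P.xtilde q.γ s - s.x‖ ^ 2
          + ‖P.ytilde q.lam s - s.y‖ ^ 2))) + 2 * (d₁ * L * μ₁) ^ 2)
          + 2 * (q.c₁ * q.η t ^ 2) ^ 2 * δ ^ 2) / b := by
  have := hA.isProbabilityMeasure_sampleLaw hd₁ hd₂
  have hm := hA.mean_sampleX hd₁ hd₂ s.x s.y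
  have hm' := hA.mean_sampleX hd₁ hd₂ (P.nextX q t s) (P.nextY q t s)
  have hM : ∫ z, ‖(P.estX μ₁ (P.nextX q t s) (P.nextY q t s) z.1 z.2.1).val
      - (P.estX μ₁ s.x s.y z.1 z.2.1).val‖ ^ 2 ∂sampleLaw P
      ≤ 2 * d₁ * (L ^ 2 * (q.η t ^ 2 * (‖P.xtilde q.γ s - s.x‖ ^ 2
          + ‖P.ytilde q.lam s - s.y‖ ^ 2))) + 2 * (d₁ * L * μ₁) ^ 2 := by
    have h1 := hA.integral_sampleX hd₁ hd₂
      (f := fun z => ‖(P.estX μ₁ (P.nextX q t s) (P.nextY q t s) z.1 z.2).val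
        - (P.estX μ₁ s.x s.y z.1 z.2).val‖ ^ 2)
      (((hA.measurable_estX_apply _ _).sub (hA.measurable_estX_apply _ _)).norm.pow_const
        2).aestronglyMeasurable
    rw [h1]
    refine (hA.integral_estX_sub_sq_le hL hμ₁ hμ₂ hd₁ hx' hx hy' hy).trans_eq ?_
    rw [nextX, nextY, add_sub_cancel_left, add_sub_cancel_left, norm_smul, norm_smul, mul_pow,
      mul_pow, Real.norm_eq_abs, sq_abs]
    ring
  have h := integral_recursive_momentum_sq_le (hA.memLp_sampleX hd₁ hd₂ hx hy)
    (hA.memLp_sampleX hd₁ hd₂ hx' hy') hb (M := _) (V := δ ^ 2) ha ha1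
    (by rw [hm']; exact hA.variance_sampleX_le hd₁ hd₂ hx' hy') hM s.v
  rw [hm, hm'] at h
  exact h

lemma integral_errY_step_le (hb : 0 < b) (q : Params) (t : ℕ) {s : State d₁ d₂} (hx : s.x ∈ P.X)
    (hy : s.y ∈ P.Y) (hx' : P.nextX q t s ∈ P.X) (hy' : P.nextY q t s ∈ P.Y)
    (ha : 0 ≤ q.c₂ * q.η t ^ 2) (ha1 : q.c₂ * q.η t ^ 2 ≤ 1) :
    Integrable (fun B => P.errY μ₂ (P.step q μ₁ μ₂ t B s).val) (batchLaw P b) ∧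
    ∫ B, P.errY μ₂ (P.step q μ₁ μ₂ t B s).val ∂batchLaw P b
      ≤ (1 - q.c₂ * q.η t ^ 2) * P.errY μ₂ s
        + (2 * (2 * d₂ * (L ^ 2 * (q.η t ^ 2 * (‖P.xtilde q.γ s - s.x‖ ^ 2
          + ‖P.ytilde q.lam s - s.y‖ ^ 2))) + 2 * (d₂ * L * μ₂) ^ 2)
          + 2 * (q.c₂ * q.η t ^ 2) ^ 2 * δ ^ 2) / b := by
  have := hA.isProbabilityMeasure_sampleLaw hd₁ hd₂
  have hm := hA.mean_sampleY hd₁ hd₂ s.x s.y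
  have hm' := hA.mean_sampleY hd₁ hd₂ (P.nextX q t s) (P.nextY q t s)
  have hM : ∫ z, ‖(P.estY μ₂ (P.nextX q t s) (P.nextY q t s) z.1 z.2.2).val
      - (P.estY μ₂ s.x s.y z.1 z.2.2).val‖ ^ 2 ∂sampleLaw P
      ≤ 2 * d₂ * (L ^ 2 * (q.η t ^ 2 * (‖P.xtilde q.γ s - s.x‖ ^ 2
          + ‖P.ytilde q.lam s - s.y‖ ^ 2))) + 2 * (d₂ * L * μ₂) ^ 2 := by
    have h1 := hA.integral_sampleY hd₁ hd₂
      (f := fun z => ‖(P.estY μ₂ (P.nextX q t s) (P.nextY q t s) z.1 z.2).val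
        - (P.estY μ₂ s.x s.y z.1 z.2).val‖ ^ 2)
      (((hA.measurable_estY_apply _ _).sub (hA.measurable_estY_apply _ _)).norm.pow_const
        2).aestronglyMeasurable
    rw [h1]
    refine (hA.integral_estY_sub_sq_le hL hμ₁ hμ₂ hd₂ hx' hx hy' hy).trans_eq ?_
    rw [nextX, nextY, add_sub_cancel_left, add_sub_cancel_left, norm_smul, norm_smul, mul_pow,
      mul_pow, Real.norm_eq_abs, sq_abs]
    ring
  have h := integral_recursive_momentum_sq_le (hA.memLp_sampleY hd₁ hd₂ hx hy)
    (hA.memLp_sampleY hd₁ hd₂ hx' hy') hb (M := _) (V := δ ^ 2) ha ha1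
    (by rw [hm']; exact hA.variance_sampleY_le hd₁ hd₂ hx' hy') hM s.w
  rw [hm, hm'] at h
  exact h

end Assumptions

end Problem

end AccZOMDA

/-! ### Parameter inequalities and the weights of the potential -/

namespace AccZOMDA

namespace Params.Admissible

variable {q : Params} {L τ D b : ℝ} (hq : q.Admissible L τ D b)
include hq

lemma two_le_m : 2 ≤ q.m := ((le_max_left _ _).trans (le_max_left _ _)).trans hq.le_m

lemma k_cube_le_m : q.k ^ 3 ≤ q.m := ((le_max_right _ _).trans (le_max_left _ _)).trans hq.le_m

lemma c₁_k_cube_le_m : (q.c₁ * q.k) ^ 3 ≤ q.m :=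
  ((le_max_left _ _).trans (le_max_right _ _)).trans hq.le_m

lemma c₂_k_cube_le_m : (q.c₂ * q.k) ^ 3 ≤ q.m :=
  ((le_max_right _ _).trans (le_max_right _ _)).trans hq.le_m

lemma add_pos (t : ℕ) : 0 < q.m + t := by
  have := hq.two_le_m
  positivity

lemma η_pos (t : ℕ) : 0 < q.η t := div_pos hq.k_pos (Real.rpow_pos_of_pos (hq.add_pos t) _)

lemma le_cbrt {a : ℝ} (ha : a ^ 3 ≤ q.m) (t : ℕ) : a ≤ (q.m + t) ^ (1 / 3 : ℝ) := by
  have h1 : ((q.m + t) ^ (1 / 3 : ℝ)) ^ 3 = q.m + t := by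
    rw [← Real.rpow_natCast, ← Real.rpow_mul (hq.add_pos t).le]; norm_num
  by_contra! h
  have h2 := pow_lt_pow_left₀ h (Real.rpow_nonneg (hq.add_pos t).le _) three_ne_zero
  have : (0 : ℝ) ≤ t := Nat.cast_nonneg t
  linarith

lemma cbrt_cube (t : ℕ) : ((q.m + t) ^ (1 / 3 : ℝ)) ^ 3 = q.m + t := by
  rw [← Real.rpow_natCast, ← Real.rpow_mul (hq.add_pos t).le]; norm_num

lemma η_le_one (t : ℕ) : q.η t ≤ 1 := by
  rw [Params.η, div_le_one (Real.rpow_pos_of_pos (hq.add_pos t) _)]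
  exact hq.le_cbrt hq.k_cube_le_m t

lemma c₁_pos : 0 < q.c₁ := by
  refine lt_of_lt_of_le ?_ hq.le_c₁
  have := hq.k_pos
  unfold c₁Min; positivity

lemma c₂_pos (hD : 0 < D) (hb : 0 < b) : 0 < q.c₂ := by
  refine lt_of_lt_of_le ?_ hq.le_c₂
  have := hq.k_pos
  unfold c₂Min; positivity

/-- Both `ck` and `k` lie below the cube root of `m + t`; their product is `ck²`. -/
lemma mul_η_sq_le_one {c : ℝ} (h : (c * q.k) ^ 3 ≤ q.m) (t : ℕ) :
    c * q.η t ^ 2 ≤ 1 := by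
  have h1 := hq.le_cbrt h t
  have h2 := hq.le_cbrt hq.k_cube_le_m t
  have h3 : 0 < (q.m + t) ^ (1 / 3 : ℝ) := Real.rpow_pos_of_pos (hq.add_pos t) _
  have hk := hq.k_pos
  rw [Params.η, div_pow, ← mul_div_assoc, div_le_one (by positivity)]
  calc c * q.k ^ 2 = (c * q.k) * q.k := by ring
    _ ≤ (q.m + t) ^ (1 / 3 : ℝ) * (q.m + t) ^ (1 / 3 : ℝ) := by gcongr
    _ = _ := by ring

/-- For the cube roots `a`, `c` of `m + n + 1` and `m + n`, `(a - c)(a² + ac + c²) = 1` and `a² + ac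
+ c² ≥ 3ac ≥ 3ka`; a factor `2` is to spare. It controls the growth of the weight `1/η`. -/
lemma inv_η_succ_sub_le (n : ℕ) :
    1 / q.η (n + 1) - 1 / q.η n ≤ 2 / (3 * q.k ^ 3) * q.η (n + 1) := by
  have h1 := hq.cbrt_cube n
  have h2 := hq.cbrt_cube (n + 1)
  have hk := hq.k_pos
  rw [Params.η, Params.η]
  have hc1 : 1 ≤ (q.m + n) ^ (1 / 3 : ℝ) :=
    hq.le_cbrt (by rw [one_pow]; linarith [hq.two_le_m]) n
  have ha1 : 1 ≤ (q.m + ↑(n + 1)) ^ (1 / 3 : ℝ) :=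
    hq.le_cbrt (by rw [one_pow]; linarith [hq.two_le_m]) (n + 1)
  set c := (q.m + n) ^ (1 / 3 : ℝ)
  set a := (q.m + ↑(n + 1)) ^ (1 / 3 : ℝ)
  have h3 : (a - c) * (a ^ 2 + a * c + c ^ 2) = 1 := by
    push_cast at h2
    linear_combination h2 - h1
  have hac : 0 ≤ a - c := by
    by_contra! h
    nlinarith [mul_pos_of_neg_of_neg h (neg_neg_of_pos (by positivity : 0 < a ^ 2 + a * c + c ^ 2))]
  have ha0 : 0 < a := by linarith
  have hc0 : 0 < c := by linarith
  have hkc : q.k ≤ c := hq.le_cbrt hq.k_cube_le_m n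
  have h4 : 3 * q.k * a * (a - c) ≤ 2 := by
    have : 3 * q.k * a ≤ a ^ 2 + a * c + c ^ 2 := by
      nlinarith [sq_nonneg (a - c), mul_le_mul_of_nonneg_right hkc ha0.le]
    nlinarith [mul_le_mul_of_nonneg_right this hac]
  rw [one_div_div, one_div_div, ← sub_div, div_mul_div_comm, div_le_div_iff₀ hk (by positivity)]
  have := mul_le_mul_of_nonneg_left h4 (by positivity : 0 ≤ q.k ^ 2)
  linarith

lemma lam_mul_L_le (hL : 0 < L) : q.lam * L ≤ 1 / 6 := by
  have h := hq.lam_le.trans (min_le_left _ _)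
  rw [le_div_iff₀ (by positivity)] at h
  linarith

lemma lam_le_tau : q.lam ≤ 75 * τ / 24 := hq.lam_le.trans (min_le_right _ _)

lemma γ_mul_η_le (hL : 0 < L) (hτ : 0 < τ) (t : ℕ) :
    (L + L ^ 2 / τ) * (q.γ * q.η t) ≤ 1 / 2 := by
  have h := hq.γ_le.trans (min_le_right _ _)
  have hk := hq.k_pos
  have hm : 0 < q.m := by linarith [hq.two_le_m]
  have hη : q.η t ≤ q.k / q.m ^ (1 / 3 : ℝ) := by
    rw [Params.η]
    gcongr
    simp
  have hm3 : 0 < q.m ^ (1 / 3 : ℝ) := Real.rpow_pos_of_pos hm _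
  calc (L + L ^ 2 / τ) * (q.γ * q.η t)
      ≤ (L + L ^ 2 / τ) * (q.m ^ (1 / 3 : ℝ) / (2 * (L + L ^ 2 / τ) * q.k)
          * (q.k / q.m ^ (1 / 3 : ℝ))) := by
        have := hq.η_pos t
        gcongr
    _ = 1 / 2 := by field_simp

lemma γ_sq_le (hL : 0 < L) (hτ : 0 < τ) (hD : 0 < D) (hb : 0 < b) :
    q.γ ^ 2 * L ^ 2 * D * (36 * q.lam ^ 2 + 625 * (L / τ) ^ 2) ≤ 3 / 2 * (b * q.lam ^ 2 * τ ^ 2) := by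
  have h := hq.γ_le.trans (min_le_left _ _)
  have hl := hq.lam_pos
  have h2 := pow_le_pow_left₀ hq.γ_pos.le h 2
  rw [mul_pow, Real.sq_sqrt (by positivity)] at h2
  calc q.γ ^ 2 * L ^ 2 * D * (36 * q.lam ^ 2 + 625 * (L / τ) ^ 2)
      ≤ ((q.lam * τ / (2 * L)) ^ 2 * (6 * b / D / (36 * q.lam ^ 2 + 625 * (L / τ) ^ 2)))
          * L ^ 2 * D * (36 * q.lam ^ 2 + 625 * (L / τ) ^ 2) := by gcongr
    _ = _ := by
      have : 0 < 36 * q.lam ^ 2 + 625 * (L / τ) ^ 2 := by positivity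
      set N := 36 * q.lam ^ 2 + 625 * (L / τ) ^ 2
      field_simp; ring

end Params.Admissible

/-- Weight of the tracking error `‖y - y*(x)‖²` in the potential. -/
noncomputable def weightY (q : Params) (L τ D b : ℝ) : ℝ := 40 * q.γ * L ^ 2 * D / (τ * q.lam * b)

/-- Weight of the estimation errors in the potential, up to the factor `1 / η`. -/
noncomputable def weightV (q : Params) (τ : ℝ) : ℝ := 2 * q.γ / τ ^ 2

/-- The error made in one step by bias and variance of the estimators; `β₁`, `β₂` are the bounds
`d₁ L μ₁` and `d₂ L μ₂`. -/
noncomputable def stepError (q : Params) (L τ D b δ β₁ β₂ η : ℝ) : ℝ :=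
  η * q.γ * β₁ ^ 2 + weightY q L τ D b * (25 * η * q.lam / (6 * τ)) * (β₂ ^ 2 / 2)
    + weightV q τ / η * ((4 * β₁ ^ 2 + 4 * β₂ ^ 2 + 2 * (q.c₁ * η ^ 2) ^ 2 * δ ^ 2
      + 2 * (q.c₂ * η ^ 2) ^ 2 * δ ^ 2) / b)

section Arithmetic

variable {q : Params} {L τ D b : ℝ} (hq : q.Admissible L τ D b) (hL : 0 < L) (hτ : 0 < τ)
  (hb : 0 < b) (hbD : b ≤ D) {η ηp : ℝ} (hη : 0 < η) (hηp : 1 / η - 1 / ηp ≤ 2 / (3 * q.k ^ 3) * η)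
include hq hL hτ hb hbD hη

/-- The weighted contraction is worth `10γL²η · D/b`, and `D/b ≥ 1`; after paying for the descent of
`g`, `8` of the `10` units remain. -/
lemma coeffY_le : 2 * L ^ 2 * (η * q.γ) - weightY q L τ D b * (η * τ * q.lam / 4)
    ≤ -(8 * q.γ * L ^ 2 * η) := by
  have hl := hq.lam_pos
  have hγ := hq.γ_pos
  have e : weightY q L τ D b * (η * τ * q.lam / 4) = 10 * q.γ * L ^ 2 * η * (D / b) := by
    rw [weightY]; field_simp; ring
  have h1 : 1 ≤ D / b := (one_le_div hb).2 hbD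
  have h2 := mul_le_mul_of_nonneg_left h1 (by positivity : 0 ≤ 10 * q.γ * L ^ 2 * η)
  rw [e]; linarith

/-- The noise caused by moving `y` is paid by the tracking step. This reduces to `8λ ≤ 30τ`, for
which `λ ≤ 75τ/24` suffices. -/
lemma coeffZ_le : weightV q τ / η * (4 * (D * (L ^ 2 * η ^ 2)) / b)
    ≤ weightY q L τ D b * (3 * η / 4) := by
  have hl := hq.lam_pos
  have hγ := hq.γ_pos
  have hD := hb.trans_le hbD
  have h1 := hq.lam_le_tau
  have e1 : weightV q τ / η * (4 * (D * (L ^ 2 * η ^ 2)) / b)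
      = q.γ * D * L ^ 2 * η / (τ ^ 2 * q.lam * b) * (8 * q.lam) := by
    rw [weightV]; field_simp; ring
  have e2 : weightY q L τ D b * (3 * η / 4)
      = q.γ * D * L ^ 2 * η / (τ ^ 2 * q.lam * b) * (30 * τ) := by
    rw [weightY]; field_simp; ring
  rw [e1, e2]
  gcongr ?_ * ?_
  linarith

/-- The square-root bound on `γ` is made for this: both losses due to moving `x` use at most `2/5`
of the available `1/2` in `η/γ`, and `1/10` is left. -/
lemma coeffX_le : weightV q τ / η * (4 * (D * (L ^ 2 * η ^ 2)) / b)
      + weightY q L τ D b * (25 * (L / τ) ^ 2 * η / (6 * τ * q.lam)) - η / (2 * q.γ)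
    ≤ -(η / (10 * q.γ)) := by
  have hl := hq.lam_pos
  have hγ := hq.γ_pos
  have hD := hb.trans_le hbD
  have h := hq.γ_sq_le hL hτ hD hb
  have h0 : q.γ ^ 2 * L ^ 2 * D * (500 / 3 * (L / τ) ^ 2 + 8 * q.lam ^ 2)
      ≤ 2 / 5 * (b * q.lam ^ 2 * τ ^ 2) := by
    have h3 : 500 / 3 * (L / τ) ^ 2 + 8 * q.lam ^ 2
        ≤ 4 / 15 * (36 * q.lam ^ 2 + 625 * (L / τ) ^ 2) := by nlinarith [sq_nonneg q.lam]
    have h4 := mul_le_mul_of_nonneg_left h3 (by positivity : 0 ≤ q.γ ^ 2 * L ^ 2 * D)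
    linarith
  have e1 : weightV q τ / η * (4 * (D * (L ^ 2 * η ^ 2)) / b)
      + weightY q L τ D b * (25 * (L / τ) ^ 2 * η / (6 * τ * q.lam))
      = η / (q.γ * (b * q.lam ^ 2 * τ ^ 2))
        * (q.γ ^ 2 * L ^ 2 * D * (500 / 3 * (L / τ) ^ 2 + 8 * q.lam ^ 2)) := by
    rw [weightV, weightY]; field_simp; ring
  have e2 : η / (2 * q.γ) - η / (10 * q.γ)
      = η / (q.γ * (b * q.lam ^ 2 * τ ^ 2)) * (2 / 5 * (b * q.lam ^ 2 * τ ^ 2)) := by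
    field_simp; ring
  have := mul_le_mul_of_nonneg_left h0
    (by positivity : 0 ≤ η / (q.γ * (b * q.lam ^ 2 * τ ^ 2)))
  rw [e1]; linarith

include hηp

omit hL hb hbD in
-- In `c₁`, the part `2/(3k³)` absorbs the growth of the weight; the part `9τ²/4` yields `9/2` in
-- units of `ηγ`, against the `4` lost in the descent of `g`.
lemma coeffA_le : 4 * (η * q.γ) + weightV q τ * ((1 - q.c₁ * η ^ 2) / η - 1 / ηp)
    ≤ -(η * q.γ / 2) := by
  have hγ := hq.γ_pos
  have h1 := hq.le_c₁
  rw [c₁Min] at h1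
  have e1 : (1 - q.c₁ * η ^ 2) / η - 1 / ηp = (1 / η - 1 / ηp) - q.c₁ * η := by field_simp; ring
  have h2 : (1 - q.c₁ * η ^ 2) / η - 1 / ηp ≤ -(9 * τ ^ 2 / 4 * η) := by
    rw [e1]; nlinarith
  have h3 := mul_le_mul_of_nonneg_left h2 (by rw [weightV]; positivity : 0 ≤ weightV q τ)
  have e2 : weightV q τ * -(9 * τ ^ 2 / 4 * η) = -(9 / 2 * (η * q.γ)) := by
    rw [weightV]; field_simp; ring
  linarith

/-- As for `v`: in units of `γL²Dη/(τ²b)`, the second part of `c₂` yields `1250/3` against the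
`1000/3` needed by the tracking inequality. No decrease need be kept, since the stationarity measure
does not contain `w`. -/
lemma coeffB_le : weightY q L τ D b * (25 * η * q.lam / (6 * τ) * 2)
    + weightV q τ * ((1 - q.c₂ * η ^ 2) / η - 1 / ηp) ≤ 0 := by
  have hγ := hq.γ_pos
  have hl := hq.lam_pos
  have hD := hb.trans_le hbD
  have h1 := hq.le_c₂
  rw [c₂Min] at h1
  have e1 : (1 - q.c₂ * η ^ 2) / η - 1 / ηp = (1 / η - 1 / ηp) - q.c₂ * η := by field_simp; ring
  have h2 : (1 - q.c₂ * η ^ 2) / η - 1 / ηp ≤ -(625 * D * L ^ 2 / (3 * b) * η) := by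
    rw [e1]; nlinarith
  have h3 := mul_le_mul_of_nonneg_left h2 (by rw [weightV]; positivity : 0 ≤ weightV q τ)
  have e2 : weightV q τ * -(625 * D * L ^ 2 / (3 * b) * η)
      = -(1250 / 3 * (q.γ * L ^ 2 * D * η / (τ ^ 2 * b))) := by
    rw [weightV]; field_simp; ring
  have e3 : weightY q L τ D b * (25 * η * q.lam / (6 * τ) * 2)
      = 1000 / 3 * (q.γ * L ^ 2 * D * η / (τ ^ 2 * b)) := by
    rw [weightY]; field_simp; ring
  have : 0 ≤ q.γ * L ^ 2 * D * η / (τ ^ 2 * b) := by positivity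
  linarith

/-- The one-step inequality for the potential. -/
lemma potential_arith {d₁ d₂ δ β₁ β₂ g g' Y Y' A A' B B' X Z G₁ G₂ : ℝ} (hDd : D = d₁ + d₂)
    (hY : 0 ≤ Y) (hA : 0 ≤ A) (hB : 0 ≤ B) (hX : 0 ≤ X) (hZ : 0 ≤ Z)
    (hG₁ : G₁ ≤ 2 * A + β₁ ^ 2 / 2) (hG₂ : G₂ ≤ 2 * B + β₂ ^ 2 / 2)
    (hg : g' ≤ g + η * q.γ * (2 * L ^ 2 * Y + 2 * G₁) - η / (2 * q.γ) * X)
    (hY' : Y' ≤ (1 - η * τ * q.lam / 4) * Y - 3 * η / 4 * Z + 25 * η * q.lam / (6 * τ) * G₂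
      + 25 * (L / τ) ^ 2 * η / (6 * τ * q.lam) * X)
    (hA' : A' ≤ (1 - q.c₁ * η ^ 2) * A + (2 * (2 * d₁ * (L ^ 2 * (η ^ 2 * (X + Z))) + 2 * β₁ ^ 2)
      + 2 * (q.c₁ * η ^ 2) ^ 2 * δ ^ 2) / b)
    (hB' : B' ≤ (1 - q.c₂ * η ^ 2) * B + (2 * (2 * d₂ * (L ^ 2 * (η ^ 2 * (X + Z))) + 2 * β₂ ^ 2)
      + 2 * (q.c₂ * η ^ 2) ^ 2 * δ ^ 2) / b) :
    g' + weightY q L τ D b * Y' + weightV q τ / η * (A' + B')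
        + η * (1 / (10 * q.γ) * X + q.γ / 2 * A + 8 * q.γ * L ^ 2 * Y)
      ≤ g + weightY q L τ D b * Y + weightV q τ / ηp * (A + B)
        + stepError q L τ D b δ β₁ β₂ η := by
  have hγ := hq.γ_pos
  have hl := hq.lam_pos
  have hD := hb.trans_le hbD
  have wY : 0 ≤ weightY q L τ D b := by rw [weightY]; positivity
  have wV : 0 ≤ weightV q τ := by rw [weightV]; positivity
  have kY := mul_le_mul_of_nonneg_right (coeffY_le hq hL hτ hb hbD hη) hY
  have kZ := mul_le_mul_of_nonneg_right (coeffZ_le hq hL hτ hb hbD hη) hZ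
  have kX := mul_le_mul_of_nonneg_right (coeffX_le hq hL hτ hb hbD hη) hX
  have kA := mul_le_mul_of_nonneg_right (coeffA_le hq hτ hη hηp) hA
  have kB := mul_le_mul_of_nonneg_right (coeffB_le hq hL hτ hb hbD hη hηp) hB
  have lY := mul_le_mul_of_nonneg_left hY' wY
  have l₁ := mul_le_mul_of_nonneg_left hG₁ (by positivity : 0 ≤ η * q.γ * 2)
  have l₂ := mul_le_mul_of_nonneg_left hG₂
    (by positivity : 0 ≤ weightY q L τ D b * (25 * η * q.lam / (6 * τ)))
  have lAB := mul_le_mul_of_nonneg_left (add_le_add hA' hB')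
    (by positivity : 0 ≤ weightV q τ / η)
  -- The displacement noise of the two estimators carries `d₁` and `d₂`; with equal weights they add
  -- up to `D`.
  have e : weightV q τ / η * ((1 - q.c₁ * η ^ 2) * A
        + (2 * (2 * d₁ * (L ^ 2 * (η ^ 2 * (X + Z))) + 2 * β₁ ^ 2)
          + 2 * (q.c₁ * η ^ 2) ^ 2 * δ ^ 2) / b + ((1 - q.c₂ * η ^ 2) * B
        + (2 * (2 * d₂ * (L ^ 2 * (η ^ 2 * (X + Z))) + 2 * β₂ ^ 2)
          + 2 * (q.c₂ * η ^ 2) ^ 2 * δ ^ 2) / b))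
      = weightV q τ * ((1 - q.c₁ * η ^ 2) / η) * A + weightV q τ * ((1 - q.c₂ * η ^ 2) / η) * B
        + weightV q τ / η * (4 * (D * (L ^ 2 * η ^ 2)) / b) * X
        + weightV q τ / η * (4 * (D * (L ^ 2 * η ^ 2)) / b) * Z
        + weightV q τ / η * ((4 * β₁ ^ 2 + 4 * β₂ ^ 2 + 2 * (q.c₁ * η ^ 2) ^ 2 * δ ^ 2
          + 2 * (q.c₂ * η ^ 2) ^ 2 * δ ^ 2) / b) := by
    rw [hDd]; ring
  rw [e] at lAB
  rw [stepError]
  have e2 : weightV q τ / ηp * (A + B)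
      = weightV q τ * (1 / ηp) * A + weightV q τ * (1 / ηp) * B := by ring
  have e3 : η * (1 / (10 * q.γ) * X + q.γ / 2 * A + 8 * q.γ * L ^ 2 * Y)
      = η / (10 * q.γ) * X + η * q.γ / 2 * A + 8 * q.γ * L ^ 2 * η * Y := by ring
  rw [e2, e3]
  linarith

end Arithmetic

end AccZOMDA

/-! ### Measurability, independence and query count of the run -/

namespace AccZOMDA

section StateMeasurable

variable {d₁ d₂ : ℕ}

instance State.instMeasurableSpace : MeasurableSpace (State d₁ d₂) :=
  MeasurableSpace.comap (fun s => (s.x, s.y, s.v, s.w)) inferInstance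

lemma State.measurable_tuple : Measurable fun s : State d₁ d₂ => (s.x, s.y, s.v, s.w) :=
  comap_measurable _

@[fun_prop]
lemma State.measurable_x : Measurable (State.x : State d₁ d₂ → E d₁) :=
  State.measurable_tuple.fst

@[fun_prop]
lemma State.measurable_y : Measurable (State.y : State d₁ d₂ → E d₂) :=
  State.measurable_tuple.snd.fst

@[fun_prop]
lemma State.measurable_v : Measurable (State.v : State d₁ d₂ → E d₁) :=
  State.measurable_tuple.snd.snd.fst

@[fun_prop]
lemma State.measurable_w : Measurable (State.w : State d₁ d₂ → E d₂) :=
  State.measurable_tuple.snd.snd.snd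

lemma State.measurable_mk {α : Type*} [MeasurableSpace α] {x v : α → E d₁} {y w : α → E d₂}
    (hx : Measurable x) (hy : Measurable y) (hv : Measurable v) (hw : Measurable w) :
    Measurable fun a => (⟨x a, y a, v a, w a⟩ : State d₁ d₂) :=
  measurable_comap_iff.2 (hx.prodMk (hy.prodMk (hv.prodMk hw)))

end StateMeasurable

namespace Problem

variable {d₁ d₂ : ℕ} {Ξ : Type*} [MeasurableSpace Ξ] {P : Problem d₁ d₂ Ξ} {b : ℕ}

lemma run_succ_val (q : Params) (μ₁ μ₂ : ℝ) (x₁ : E d₁) (y₁ : E d₂)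
    (S : ℕ → Batch d₁ d₂ Ξ b) (n : ℕ) :
    (P.run q μ₁ μ₂ x₁ y₁ S (n + 1)).val
      = (P.step q μ₁ μ₂ (n + 1) (S (n + 1)) (P.run q μ₁ μ₂ x₁ y₁ S n).val).val := rfl

lemma run_congr (q : Params) (μ₁ μ₂ : ℝ) (x₁ : E d₁) (y₁ : E d₂)
    {S S' : ℕ → Batch d₁ d₂ Ξ b} {n : ℕ} (h : ∀ i ≤ n, S i = S' i) :
    P.run q μ₁ μ₂ x₁ y₁ S n = P.run q μ₁ μ₂ x₁ y₁ S' n := by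
  induction n with
  | zero => simp only [run, h 0 le_rfl]
  | succ n ih => simp only [run, h (n + 1) le_rfl, ih fun i hi => h i (hi.trans n.le_succ)]

lemma queries_gradX (μ : ℝ) (x : E d₁) (y : E d₂) (B : Batch d₁ d₂ Ξ b) :
    (P.gradX μ x y B).queries = 2 * b := by
  change ∑ _i : Fin b, (1 + (1 + 0)) = 2 * b
  simp [mul_comm]

lemma queries_gradY (μ : ℝ) (x : E d₁) (y : E d₂) (B : Batch d₁ d₂ Ξ b) :
    (P.gradY μ x y B).queries = 2 * b := by
  change ∑ _i : Fin b, (1 + (1 + 0)) = 2 * b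
  simp [mul_comm]

lemma queries_run (q : Params) (μ₁ μ₂ : ℝ) (x₁ : E d₁) (y₁ : E d₂)
    (S : ℕ → Batch d₁ d₂ Ξ b) (n : ℕ) :
    (P.run q μ₁ μ₂ x₁ y₁ S n).queries = 4 * b + 8 * b * n := by
  induction n with
  | zero =>
    change (P.gradX μ₁ x₁ y₁ (S 0)).queries + ((P.gradY μ₂ x₁ y₁ (S 0)).queries + 0) = _
    rw [queries_gradX, queries_gradY]; ring
  | succ n ih =>
    change (P.run q μ₁ μ₂ x₁ y₁ S n).queries + ((P.gradX μ₁ _ _ (S (n + 1))).queries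
      + ((P.gradX μ₁ _ _ (S (n + 1))).queries + ((P.gradY μ₂ _ _ (S (n + 1))).queries
      + ((P.gradY μ₂ _ _ (S (n + 1))).queries + 0)))) = _
    rw [queries_gradX, queries_gradX, queries_gradY, queries_gradY, ih]; ring

/-- The states whose iterates are feasible. -/
def feasible (P : Problem d₁ d₂ Ξ) : Set (State d₁ d₂) := {s | s.x ∈ P.X ∧ s.y ∈ P.Y}

/-- `y*` on `X`, zero elsewhere. -/
noncomputable def ystarX (P : Problem d₁ d₂ Ξ) (x : E d₁) : E d₂ := P.X.indicator P.ystar x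

lemma ystarX_eq {x : E d₁} (hx : x ∈ P.X) : P.ystarX x = P.ystar x := Set.indicator_of_mem hx _

namespace Assumptions

variable {L τ δ μ₁ μ₂ : ℝ} (hA : P.Assumptions L τ δ μ₁ μ₂)
include hA

lemma step_mem (q : Params) (hη : ∀ t, 0 ≤ q.η t ∧ q.η t ≤ 1) (t : ℕ)
    {s : State d₁ d₂} (hs : s ∈ P.feasible) : P.nextX q t s ∈ P.X ∧ P.nextY q t s ∈ P.Y :=
  ⟨hA.convexX.add_smul_sub_mem hs.1 (proj_mem ⟨_, hs.1⟩ hA.compactX _) (hη t),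
    hA.convexY.add_smul_sub_mem hs.2 (proj_mem hA.nonemptyY hA.compactY _) (hη t)⟩

lemma run_mem (q : Params) (hη : ∀ t, 0 ≤ q.η t ∧ q.η t ≤ 1) {x₁ : E d₁} {y₁ : E d₂}
    (hx : x₁ ∈ P.X) (hy : y₁ ∈ P.Y) (S : ℕ → Batch d₁ d₂ Ξ b) (n : ℕ) :
    (P.run q μ₁ μ₂ x₁ y₁ S n).val ∈ P.feasible := by
  induction n with
  | zero => exact ⟨hx, hy⟩
  | succ n ih => exact hA.step_mem q hη (n + 1) ih

lemma measurable_gradX_comp {α : Type*} [MeasurableSpace α] {f : α → E d₁} {g : α → E d₂}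
    {B : α → Batch d₁ d₂ Ξ b} (hf : Measurable f) (hg : Measurable g) (hB : Measurable B) :
    Measurable fun a => (P.gradX μ₁ (f a) (g a) (B a)).val := by
  simp only [gradX_val]
  have h : Measurable fun a => ∑ i, (P.estX μ₁ (f a) (g a) (B a i).1 (B a i).2.1).val :=
    Finset.measurable_fun_sum _ fun i _ => by
      have hBi : Measurable fun a => B a i := (measurable_pi_apply i).comp hB
      exact hA.measurable_estX_comp hf hg hBi.fst hBi.snd.fst
  exact h.const_smul ((b : ℝ)⁻¹)

lemma measurable_gradY_comp {α : Type*} [MeasurableSpace α] {f : α → E d₁} {g : α → E d₂}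
    {B : α → Batch d₁ d₂ Ξ b} (hf : Measurable f) (hg : Measurable g) (hB : Measurable B) :
    Measurable fun a => (P.gradY μ₂ (f a) (g a) (B a)).val := by
  simp only [gradY_val]
  have h : Measurable fun a => ∑ i, (P.estY μ₂ (f a) (g a) (B a i).1 (B a i).2.2).val :=
    Finset.measurable_fun_sum _ fun i _ => by
      have hBi : Measurable fun a => B a i := (measurable_pi_apply i).comp hB
      exact hA.measurable_estY_comp hf hg hBi.fst hBi.snd.snd
  exact h.const_smul ((b : ℝ)⁻¹)

lemma measurable_xtilde (hne : P.X.Nonempty) (γ : ℝ) :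
    Measurable fun s : State d₁ d₂ => P.xtilde γ s :=
  (continuous_proj hne hA.compactX hA.convexX).measurable.comp
    (State.measurable_x.sub (State.measurable_v.const_smul γ))

lemma measurable_ytilde (lam : ℝ) : Measurable fun s : State d₁ d₂ => P.ytilde lam s :=
  (continuous_proj hA.nonemptyY hA.compactY hA.convexY).measurable.comp
    (State.measurable_y.add (State.measurable_w.const_smul lam))

lemma measurable_nextX (hne : P.X.Nonempty) (q : Params) (t : ℕ) :
    Measurable fun s : State d₁ d₂ => P.nextX q t s :=
  State.measurable_x.add
    (((hA.measurable_xtilde hne q.γ).sub State.measurable_x).const_smul (q.η t))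

lemma measurable_nextY (q : Params) (t : ℕ) : Measurable fun s : State d₁ d₂ => P.nextY q t s :=
  State.measurable_y.add
    (((hA.measurable_ytilde q.lam).sub State.measurable_y).const_smul (q.η t))

lemma measurable_step_comp {α : Type*} [MeasurableSpace α] {f : α → State d₁ d₂}
    {B : α → Batch d₁ d₂ Ξ b} (hne : P.X.Nonempty) (hf : Measurable f) (hB : Measurable B)
    (q : Params) (t : ℕ) : Measurable fun a => (P.step q μ₁ μ₂ t (B a) (f a)).val := by
  simp only [step_val]
  have hx : Measurable fun a => P.nextX q t (f a) := (hA.measurable_nextX hne q t).comp hf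
  have hy : Measurable fun a => P.nextY q t (f a) := (hA.measurable_nextY q t).comp hf
  have sx : Measurable fun a => (f a).x := State.measurable_x.comp hf
  have sy : Measurable fun a => (f a).y := State.measurable_y.comp hf
  have sv : Measurable fun a => (f a).v := State.measurable_v.comp hf
  have sw : Measurable fun a => (f a).w := State.measurable_w.comp hf
  have gx' := hA.measurable_gradX_comp hx hy hB
  have gx := hA.measurable_gradX_comp sx sy hB
  have gy' := hA.measurable_gradY_comp hx hy hB
  have gy := hA.measurable_gradY_comp sx sy hB
  exact State.measurable_mk hx hy (gx'.add ((sv.sub gx).const_smul (1 - q.c₁ * q.η t ^ 2)))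
    (gy'.add ((sw.sub gy).const_smul (1 - q.c₂ * q.η t ^ 2)))

lemma measurable_step (hne : P.X.Nonempty) (q : Params) (t : ℕ) :
    Measurable fun p : State d₁ d₂ × Batch d₁ d₂ Ξ b => (P.step q μ₁ μ₂ t p.2 p.1).val :=
  hA.measurable_step_comp hne measurable_fst measurable_snd q t

lemma measurable_initState (x : E d₁) (y : E d₂) :
    Measurable fun B : Batch d₁ d₂ Ξ b => (P.initState μ₁ μ₂ x y B).val := by
  simp only [initState_val]
  exact State.measurable_mk measurable_const measurable_const
    (hA.measurable_gradX_comp measurable_const measurable_const measurable_id)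
    (hA.measurable_gradY_comp measurable_const measurable_const measurable_id)

lemma measurable_run (hne : P.X.Nonempty) (q : Params) (x₁ : E d₁) (y₁ : E d₂) (n : ℕ) :
    Measurable fun S : ℕ → Batch d₁ d₂ Ξ b => (P.run q μ₁ μ₂ x₁ y₁ S n).val := by
  induction n with
  | zero =>
    have h0 : Measurable fun S : ℕ → Batch d₁ d₂ Ξ b => S 0 := measurable_pi_apply 0
    exact (hA.measurable_initState x₁ y₁).comp h0
  | succ n ih =>
    have h0 : Measurable fun S : ℕ → Batch d₁ d₂ Ξ b => S (n + 1) := measurable_pi_apply (n + 1)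
    simp only [run_succ_val]
    exact hA.measurable_step_comp (f := fun S => (P.run q μ₁ μ₂ x₁ y₁ S n).val) hne ih h0 q (n + 1)

/-- The state at time `n` is independent of the next mini-batch. -/
lemma indepFun_run (hne : P.X.Nonempty) (q : Params) (x₁ : E d₁) (y₁ : E d₂)
    {Ω : Type*} [MeasurableSpace Ω] {Pr : Measure Ω} {S : ℕ → Ω → Batch d₁ d₂ Ξ b}
    (hS : ∀ t, Measurable (S t)) (hind : iIndepFun S Pr) (n : ℕ) :
    IndepFun (fun ω => (P.run q μ₁ μ₂ x₁ y₁ (fun t => S t ω) n).val) (S (n + 1)) Pr := by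
  have h1 := hind.indepFun_finset (Finset.range (n + 1)) {n + 1} (by simp) hS
  -- The state at time `n` reads only the batches up to `n`, so it factors through this extension of
  -- a prefix to a sequence. The batch of index `0` serves as the default value, as the batch type
  -- need not be known to be inhabited.
  let ext : (Finset.range (n + 1) → Batch d₁ d₂ Ξ b) → ℕ → Batch d₁ d₂ Ξ b := fun z i =>
    if h : i ∈ Finset.range (n + 1) then z ⟨i, h⟩ else z ⟨0, by simp⟩
  have hext : Measurable ext := by
    refine measurable_pi_lambda _ fun i => ?_
    by_cases h : i ∈ Finset.range (n + 1)
    · simp only [ext, h, dif_pos]; exact measurable_pi_apply _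
    · simp only [ext, h, dif_neg, not_false_eq_true]; exact measurable_pi_apply _
  have h2 := h1.comp ((hA.measurable_run hne q x₁ y₁ n).comp hext)
    (measurable_pi_apply (⟨n + 1, by simp⟩ : ({n + 1} : Finset ℕ)))
  have e1 : (fun ω => (P.run q μ₁ μ₂ x₁ y₁ (fun t => S t ω) n).val)
      = ((fun S' => (P.run q μ₁ μ₂ x₁ y₁ S' n).val) ∘ ext) ∘
        fun ω (i : Finset.range (n + 1)) => S i ω := by
    ext1 ω
    simp only [Function.comp_apply]
    rw [run_congr]
    intro i hi
    have : i ∈ Finset.range (n + 1) := by simp; omega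
    simp only [ext, this, dif_pos]
  rw [e1]
  exact h2

/-- The expectation of a function of the next state, as an iterated integral. -/
lemma lintegral_run_succ (hne : P.X.Nonempty) (q : Params) (x₁ : E d₁) (y₁ : E d₂)
    {Ω : Type*} [MeasurableSpace Ω] {Pr : Measure Ω} [IsProbabilityMeasure Pr]
    {S : ℕ → Ω → Batch d₁ d₂ Ξ b}
    (hS : ∀ t, Measurable (S t)) (hind : iIndepFun S Pr)
    (hlaw : ∀ t, Pr.map (S t) = batchLaw P b) (n : ℕ) {Ψ : State d₁ d₂ → ENNReal}
    (hΨ : Measurable Ψ) :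
    ∫⁻ ω, Ψ (P.run q μ₁ μ₂ x₁ y₁ (fun t => S t ω) (n + 1)).val ∂Pr
      = ∫⁻ ω, ∫⁻ B, Ψ (P.step q μ₁ μ₂ (n + 1) B
          (P.run q μ₁ μ₂ x₁ y₁ (fun t => S t ω) n).val).val ∂batchLaw P b ∂Pr := by
  have hm : Measurable fun ω => (P.run q μ₁ μ₂ x₁ y₁ (fun t => S t ω) n).val :=
    (hA.measurable_run hne q x₁ y₁ n).comp (measurable_pi_lambda _ hS)
  have h1 := (indepFun_iff_map_prod_eq_prod_map_map hm.aemeasurable (hS (n + 1)).aemeasurable).1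
    (hA.indepFun_run hne q x₁ y₁ hS hind n)
  have hst := hΨ.comp (hA.measurable_step (b := b) hne q (n + 1))
  have : IsProbabilityMeasure (batchLaw P b) := by
    rw [← hlaw 0]; exact Measure.isProbabilityMeasure_map (hS 0).aemeasurable
  rw [hlaw] at h1
  have h2 := lintegral_map (μ := Pr) hst (hm.prodMk (hS (n + 1)))
  rw [h1, lintegral_prod _ hst.aemeasurable, lintegral_map hst.lintegral_prod_right' hm] at h2
  exact h2.symm

/-- On `X` the maximizer is Lipschitz in `x`; outside, `ystar` is an uncontrolled choice, hence the
indicator. The partial gradient is treated likewise below. -/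
lemma measurable_ystarX (hL : 0 ≤ L) (hμ₁ : 0 < μ₁) (hμ₂ : 0 < μ₂) (hτ : 0 < τ) :
    Measurable P.ystarX := by
  classical
  have hc : ContinuousOn P.ystar P.X := by
    refine (LipschitzOnWith.of_dist_le_mul (K := ⟨L / τ, by positivity⟩)
      fun x hx x' hx' => ?_).continuousOn
    rw [dist_eq_norm, dist_eq_norm]
    exact hA.norm_ystar_sub_le hL hμ₁ hμ₂ hτ hx' hx
  have := hc.measurable_piecewise (g := 0) continuousOn_const hA.compactX.measurableSet
  rwa [Set.piecewise_eq_indicator] at this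

lemma measurable_indicator_gradFX (hL : 0 ≤ L) (hμ₁ : 0 < μ₁) (hμ₂ : 0 < μ₂) :
    Measurable ((P.X ×ˢ P.Y).indicator fun p => P.gradFX p.1 p.2) := by
  classical
  have hc : ContinuousOn (fun p : E d₁ × E d₂ => P.gradFX p.1 p.2) (P.X ×ˢ P.Y) := by
    intro p hp
    rw [ContinuousWithinAt, tendsto_iff_norm_sub_tendsto_zero]
    have hlim : Filter.Tendsto
        (fun z : E d₁ × E d₂ => L * √(‖z.1 - p.1‖ ^ 2 + ‖z.2 - p.2‖ ^ 2))
        (nhdsWithin p (P.X ×ˢ P.Y)) (nhds 0) := by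
      apply Filter.Tendsto.mono_left _ nhdsWithin_le_nhds
      exact Continuous.tendsto' (by fun_prop) _ _ (by simp)
    refine squeeze_zero' (Filter.Eventually.of_forall fun z => norm_nonneg _) ?_ hlim
    filter_upwards [self_mem_nhdsWithin] with z hz
    exact hA.norm_gradFX_sub_le hL hμ₁ hμ₂ hz.1 hp.1 hz.2 hp.2
  have hK : MeasurableSet (P.X ×ˢ P.Y) := hA.compactX.measurableSet.prod hA.compactY.measurableSet
  have := hc.measurable_piecewise (g := 0) continuousOn_const hK
  rwa [Set.piecewise_eq_indicator] at this

end Assumptions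

end Problem

end AccZOMDA

/-! ### Expected decrease of the potential -/

namespace AccZOMDA

lemma norm_sub_sq_le_of_bias {d : ℕ} {u m v : E d} {β : ℝ} (h : ‖m - u‖ ≤ β / 2) :
    ‖u - v‖ ^ 2 ≤ 2 * ‖v - m‖ ^ 2 + β ^ 2 / 2 := by
  have h2 := norm_sub_le_norm_sub_add_norm_sub u m v
  rw [norm_sub_rev u m, norm_sub_rev m v] at h2
  have h3 : ‖u - v‖ ≤ β / 2 + ‖v - m‖ := by linarith
  have h4 := pow_le_pow_left₀ (norm_nonneg _) h3 2
  nlinarith [sq_nonneg (β / 2 - ‖v - m‖)]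

lemma lintegral_ofReal_affine {α : Type*} [MeasurableSpace α] {ν : Measure α}
    [IsProbabilityMeasure ν] {f g : α → ℝ} (hf : Integrable f ν) (hg : Integrable g ν)
    (hf0 : ∀ a, 0 ≤ f a) (hg0 : ∀ a, 0 ≤ g a) {c w : ℝ} (hc : 0 ≤ c) (hw : 0 ≤ w) :
    ∫⁻ a, ENNReal.ofReal (c + w * (f a + g a)) ∂ν
      = ENNReal.ofReal (c + w * (∫ a, f a ∂ν + ∫ a, g a ∂ν)) := by
  have hint : Integrable (fun a => w * (f a + g a)) ν := (hf.add hg).const_mul w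
  have hi : Integrable (fun a => c + w * (f a + g a)) ν := (integrable_const c).add hint
  rw [← ofReal_integral_eq_lintegral_ofReal hi
    (Filter.Eventually.of_forall fun a => add_nonneg hc (mul_nonneg hw (add_nonneg (hf0 a) (hg0 a)))),
    integral_add (integrable_const c) hint, integral_const_mul, integral_add hf hg]
  simp

namespace Problem

variable {d₁ d₂ : ℕ} {Ξ : Type*} [MeasurableSpace Ξ] (P : Problem d₁ d₂ Ξ) {b : ℕ}

/-- Squared distance of `y` to the inner maximizer. -/
noncomputable def trackY (s : State d₁ d₂) : ℝ := ‖s.y - P.ystarX s.x‖ ^ 2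

/-- The potential after `n` iterations. -/
noncomputable def potential (q : Params) (L τ D bb gmin μ₁ μ₂ : ℝ) (n : ℕ) (s : State d₁ d₂) : ℝ :=
  P.F s.x (P.ystarX s.x) - gmin + weightY q L τ D bb * P.trackY s
    + weightV q τ / q.η n * (P.errX μ₁ s + P.errY μ₂ s)

/-- The guaranteed decrease of the potential, up to the factor `η`. -/
noncomputable def progress (q : Params) (L μ₁ : ℝ) (s : State d₁ d₂) : ℝ :=
  1 / (10 * q.γ) * ‖P.xtilde q.γ s - s.x‖ ^ 2 + q.γ / 2 * P.errX μ₁ s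
    + 8 * q.γ * L ^ 2 * P.trackY s

variable {P}

lemma trackY_nonneg (s : State d₁ d₂) : 0 ≤ P.trackY s := sq_nonneg _
lemma errX_nonneg (μ : ℝ) (s : State d₁ d₂) : 0 ≤ P.errX μ s := sq_nonneg _
lemma errY_nonneg (μ : ℝ) (s : State d₁ d₂) : 0 ≤ P.errY μ s := sq_nonneg _

lemma progress_nonneg {q : Params} (hγ : 0 < q.γ) (L μ₁ : ℝ) (s : State d₁ d₂) :
    0 ≤ P.progress q L μ₁ s := by
  have := P.trackY_nonneg s
  have := P.errX_nonneg μ₁ s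
  unfold progress; positivity

namespace Assumptions

variable {L τ δ μ₁ μ₂ : ℝ} (hA : P.Assumptions L τ δ μ₁ μ₂) (hd₁ : 0 < d₁) (hd₂ : 0 < d₂)
include hA hd₁ hd₂

omit hd₂ in
lemma measurable_errX : Measurable fun s : State d₁ d₂ => P.errX μ₁ s := by
  have := (hA.measurable_meanX hd₁).comp
    ((State.measurable_x (d₁ := d₁) (d₂ := d₂)).prodMk State.measurable_y)
  exact (State.measurable_v.sub this).norm.pow_const 2

omit hd₁ in
lemma measurable_errY : Measurable fun s : State d₁ d₂ => P.errY μ₂ s := by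
  have := (hA.measurable_meanY hd₂).comp
    ((State.measurable_x (d₁ := d₁) (d₂ := d₂)).prodMk State.measurable_y)
  exact (State.measurable_w.sub this).norm.pow_const 2

variable (hL : 0 < L) (hμ₁ : 0 < μ₁) (hμ₂ : 0 < μ₂) (hτ : 0 < τ)
include hL hμ₁ hμ₂ hτ

omit hd₁ hd₂ in
lemma measurable_trackY : Measurable fun s : State d₁ d₂ => P.trackY s := by
  have h := (hA.measurable_ystarX hL.le hμ₁ hμ₂ hτ).comp (State.measurable_x (d₁ := d₁) (d₂ := d₂))
  exact (State.measurable_y.sub h).norm.pow_const 2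

lemma measurable_potential (q : Params) (D bb gmin : ℝ) (n : ℕ) :
    Measurable (P.potential q L τ D bb gmin μ₁ μ₂ n) := by
  have h := (hA.measurable_ystarX hL.le hμ₁ hμ₂ hτ).comp (State.measurable_x (d₁ := d₁) (d₂ := d₂))
  have hF := hA.measurable_F.comp (State.measurable_x.prodMk h)
  exact ((hF.sub_const gmin).add ((hA.measurable_trackY hL hμ₁ hμ₂ hτ).const_mul _)).add
    (((hA.measurable_errX hd₁).add (hA.measurable_errY hd₂)).const_mul _)

omit hd₂ in
lemma measurable_progress (hne : P.X.Nonempty) (q : Params) :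
    Measurable (P.progress q L μ₁) :=
  (((((hA.measurable_xtilde hne q.γ).sub State.measurable_x).norm.pow_const 2).const_mul _).add
    ((hA.measurable_errX hd₁).const_mul _)).add
    ((hA.measurable_trackY hL hμ₁ hμ₂ hτ).const_mul _)

variable {q : Params} {D : ℝ} (hq : q.Admissible L τ D b) (hτL : τ ≤ L) (hb : 0 < b)
  (hbD : (b : ℝ) ≤ D) (hD : D = d₁ + d₂)
include hq hτL hb hbD hD

/-- Expected decrease of the potential in one iteration from a feasible state. -/
lemma lintegral_potential_step_le {gmin : ℝ} (hg : ∀ x ∈ P.X, gmin ≤ P.g x) (n : ℕ)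
    {s : State d₁ d₂} (hs : s ∈ P.feasible) :
    ∫⁻ B, ENNReal.ofReal (P.potential q L τ D b gmin μ₁ μ₂ (n + 1)
        (P.step q μ₁ μ₂ (n + 1) B s).val) ∂batchLaw P b
      + ENNReal.ofReal (q.η (n + 1) * P.progress q L μ₁ s)
    ≤ ENNReal.ofReal (P.potential q L τ D b gmin μ₁ μ₂ n s)
      + ENNReal.ofReal (stepError q L τ D b δ (d₁ * L * μ₁) (d₂ * L * μ₂) (q.η (n + 1))) := by
  have hb' : (0 : ℝ) < b := by positivity
  have hη := hq.η_pos (n + 1)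
  have hγ := hq.γ_pos
  have hl := hq.lam_pos
  have hDpos := hb'.trans_le hbD
  have hηn := hq.η_pos n
  have wY : 0 ≤ weightY q L τ D b := by rw [weightY]; positivity
  have wV : 0 ≤ weightV q τ := by rw [weightV]; positivity
  have hη1 := hq.η_le_one (n + 1)
  have hc₁ := hq.c₁_pos
  have hc₂ := hq.c₂_pos hDpos hb'
  obtain ⟨hx', hy'⟩ := hA.step_mem q (fun t => ⟨(hq.η_pos t).le, hq.η_le_one t⟩) (n + 1) hs
  obtain ⟨iX, eX⟩ := hA.integral_errX_step_le hd₁ hd₂ hL.le hμ₁ hμ₂ hb q (n + 1) hs.1 hs.2 hx' hy'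
    (by positivity) (hq.mul_η_sq_le_one hq.c₁_k_cube_le_m _)
  obtain ⟨iY, eY⟩ := hA.integral_errY_step_le hd₁ hd₂ hL.le hμ₁ hμ₂ hb q (n + 1) hs.1 hs.2 hx' hy'
    (by positivity) (hq.mul_η_sq_le_one hq.c₂_k_cube_le_m _)
  have hG₁ : ‖P.gradFX s.x s.y - s.v‖ ^ 2 ≤ 2 * P.errX μ₁ s + (d₁ * L * μ₁) ^ 2 / 2 :=
    norm_sub_sq_le_of_bias (hA.norm_meanX_sub_le hL.le hμ₁ hμ₂ hd₁ hs.1 hs.2)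
  have hG₂ : ‖P.gradFY s.x s.y - s.w‖ ^ 2 ≤ 2 * P.errY μ₂ s + (d₂ * L * μ₂) ^ 2 / 2 :=
    norm_sub_sq_le_of_bias (hA.norm_meanY_sub_le hL.le hμ₁ hμ₂ hd₂ hs.1 hs.2)
  have hgs := hA.g_step_le hL.le hμ₁ hμ₂ hτ (v := s.v) hs.1 hs.2 hγ hη hη1
    (hq.γ_mul_η_le hL hτ (n + 1))
  have hys := hA.norm_sub_ystar_step_le hL.le hμ₁ hμ₂ hτ hτL (w := s.w) (lam := q.lam)
    (X := ‖P.xtilde q.γ s - s.x‖ ^ 2) hs.1 hx' hs.2 hl (hq.lam_mul_L_le hL) hη hη1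
    (by rw [nextX, add_sub_cancel_left, norm_smul, mul_pow, Real.norm_of_nonneg hη.le])
  -- The state after `n` iterations is weighted with `1/η n`, while the iteration leaving it uses `η
  -- (n + 1)`; these are `ηp` and `η`.
  have key := potential_arith hq hL hτ hb' hbD hη (hq.inv_η_succ_sub_le n) hD
    (sq_nonneg ‖s.y - P.ystar s.x‖) (P.errX_nonneg μ₁ s) (P.errY_nonneg μ₂ s)
    (sq_nonneg ‖P.xtilde q.γ s - s.x‖) (sq_nonneg ‖P.ytilde q.lam s - s.y‖) hG₁ hG₂
    hgs hys eX eY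
  -- the potential of the new state
  have hpot : ∀ B : Batch d₁ d₂ Ξ b, P.potential q L τ D b gmin μ₁ μ₂ (n + 1) (P.step q μ₁ μ₂ (n + 1) B s).val
      = (P.g (P.nextX q (n + 1) s) - gmin
          + weightY q L τ D b * ‖P.nextY q (n + 1) s - P.ystar (P.nextX q (n + 1) s)‖ ^ 2)
        + weightV q τ / q.η (n + 1) * (P.errX μ₁ (P.step q μ₁ μ₂ (n + 1) B s).val
          + P.errY μ₂ (P.step q μ₁ μ₂ (n + 1) B s).val) := by
    intro B
    have e := P.ystarX_eq hx'
    unfold potential trackY g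
    rw [← e]; rfl
  have : IsProbabilityMeasure (batchLaw P b) := by
    have := hA.isProbabilityMeasure_sampleLaw hd₁ hd₂
    exact inferInstanceAs (IsProbabilityMeasure (Measure.pi fun _ => sampleLaw P))
  have hg' := hg _ hx'
  have hgs0 := hg _ hs.1
  have hprog := P.progress_nonneg hγ L μ₁ s
  have hc0 : 0 ≤ P.g (P.nextX q (n + 1) s) - gmin
      + weightY q L τ D b * ‖P.nextY q (n + 1) s - P.ystar (P.nextX q (n + 1) s)‖ ^ 2 := by
    have : 0 ≤ P.g (P.nextX q (n + 1) s) - gmin := sub_nonneg.2 hg'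
    positivity
  simp_rw [hpot]
  rw [lintegral_ofReal_affine iX iY (fun B => P.errX_nonneg _ _) (fun B => P.errY_nonneg _ _) hc0
    (by positivity)]
  have herr0 : 0 ≤ stepError q L τ D b δ (d₁ * L * μ₁) (d₂ * L * μ₂) (q.η (n + 1)) := by
    unfold stepError; positivity
  have hpot0 : 0 ≤ P.potential q L τ D b gmin μ₁ μ₂ n s := by
    have := P.trackY_nonneg s
    have := P.errX_nonneg μ₁ s
    have := P.errY_nonneg μ₂ s
    have h0 : 0 ≤ P.F s.x (P.ystarX s.x) - gmin := by rw [P.ystarX_eq hs.1]; exact sub_nonneg.2 hgs0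
    unfold potential; positivity
  have hE : 0 ≤ ∫ B, P.errX μ₁ (P.step q μ₁ μ₂ (n + 1) B s).val ∂batchLaw P b
      + ∫ B, P.errY μ₂ (P.step q μ₁ μ₂ (n + 1) B s).val ∂batchLaw P b :=
    add_nonneg (integral_nonneg fun B => P.errX_nonneg _ _)
      (integral_nonneg fun B => P.errY_nonneg _ _)
  rw [← ENNReal.ofReal_add (by positivity) (by positivity), ← ENNReal.ofReal_add hpot0 herr0]
  apply ENNReal.ofReal_le_ofReal
  unfold potential progress trackY
  rw [P.ystarX_eq hs.1]
  change _ ≤ P.g s.x - gmin + _ + _ + _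
  change P.g (P.nextX q (n + 1) s)
    + weightY q L τ D b * ‖P.nextY q (n + 1) s - P.ystar (P.nextX q (n + 1) s)‖ ^ 2 + _ + _ ≤ _ at key
  linarith

variable {Ω : Type*} [MeasurableSpace Ω] {Pr : Measure Ω} [IsProbabilityMeasure Pr]
  {S : ℕ → Ω → Batch d₁ d₂ Ξ b} (hS : ∀ t, Measurable (S t)) (hind : iIndepFun S Pr)
  (hlaw : ∀ t, Pr.map (S t) = batchLaw P b) {x₁ : E d₁} (hx₁ : x₁ ∈ P.X) {K : ℝ} (hK0 : 0 ≤ K)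
  (hK : ∀ x ∈ P.X, P.g x₁ - P.g x ≤ K)
include hS hlaw hx₁ hK hK0

omit hτL hbD hD hK [IsProbabilityMeasure Pr] in
-- Starting at `y₁ = y*(x₁)` removes the tracking term, and the reference value `g x₁ - K` makes the
-- first term exactly `K`; only the variance of the first batch remains.
lemma lintegral_potential_init_le :
    ∫⁻ ω, ENNReal.ofReal (P.potential q L τ D b (P.g x₁ - K) μ₁ μ₂ 0
        (P.run q μ₁ μ₂ x₁ (P.ystar x₁) (fun t => S t ω) 0).val) ∂Pr
      ≤ ENNReal.ofReal (K + weightV q τ / q.η 0 * (2 * δ ^ 2 / b)) := by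
  have hγ := hq.γ_pos
  have hηn := hq.η_pos 0
  have wV : 0 ≤ weightV q τ := by rw [weightV]; positivity
  have hy₁ := hA.ystar_mem hL.le hμ₁ hμ₂ hx₁
  have hmeas := hA.measurable_potential hd₁ hd₂ hL hμ₁ hμ₂ hτ q D b (P.g x₁ - K) 0
  have hinit := hA.measurable_initState (b := b) x₁ (P.ystar x₁)
  have e := lintegral_map (μ := Pr) ((hmeas.comp hinit).ennreal_ofReal) (hS 0)
  rw [hlaw] at e
  refine (e.symm.trans_le ?_)
  obtain ⟨iX, eX⟩ := hA.integral_errX_init_le hd₁ hd₂ hb hx₁ hy₁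
  obtain ⟨iY, eY⟩ := hA.integral_errY_init_le hd₁ hd₂ hb hx₁ hy₁
  have hpot : ∀ B : Batch d₁ d₂ Ξ b, P.potential q L τ D b (P.g x₁ - K) μ₁ μ₂ 0
      (P.initState μ₁ μ₂ x₁ (P.ystar x₁) B).val
      = K + weightV q τ / q.η 0 * (P.errX μ₁ (P.initState μ₁ μ₂ x₁ (P.ystar x₁) B).val
        + P.errY μ₂ (P.initState μ₁ μ₂ x₁ (P.ystar x₁) B).val) := by
    intro B
    have e := P.ystarX_eq hx₁
    unfold potential trackY
    change P.F x₁ (P.ystarX x₁) - (P.g x₁ - K) + weightY q L τ D b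
      * ‖P.ystar x₁ - P.ystarX x₁‖ ^ 2 + _ = _
    rw [e, sub_self, norm_zero, g]; ring
  have : IsProbabilityMeasure (batchLaw P b) := by
    have := hA.isProbabilityMeasure_sampleLaw hd₁ hd₂
    exact inferInstanceAs (IsProbabilityMeasure (Measure.pi fun _ => sampleLaw P))
  simp only [Function.comp_apply, hpot]
  rw [lintegral_ofReal_affine iX iY (fun B => P.errX_nonneg _ _) (fun B => P.errY_nonneg _ _) hK0
    (by positivity)]
  apply ENNReal.ofReal_le_ofReal
  have : 2 * δ ^ 2 / (b : ℝ) = δ ^ 2 / b + δ ^ 2 / b := by ring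
  rw [this]
  gcongr

include hind

/-- Summed decrease of the potential. -/
lemma sum_lintegral_progress_le (T : ℕ) :
    ∫⁻ ω, ENNReal.ofReal (P.potential q L τ D b (P.g x₁ - K) μ₁ μ₂ T
        (P.run q μ₁ μ₂ x₁ (P.ystar x₁) (fun t => S t ω) T).val) ∂Pr
      + ∑ n ∈ Finset.range T, ∫⁻ ω, ENNReal.ofReal (q.η (n + 1) * P.progress q L μ₁
        (P.run q μ₁ μ₂ x₁ (P.ystar x₁) (fun t => S t ω) n).val) ∂Pr
    ≤ ENNReal.ofReal (K + weightV q τ / q.η 0 * (2 * δ ^ 2 / b))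
      + ∑ n ∈ Finset.range T, ENNReal.ofReal
        (stepError q L τ D b δ (d₁ * L * μ₁) (d₂ * L * μ₂) (q.η (n + 1))) := by
  induction T with
  | zero =>
    simpa using hA.lintegral_potential_init_le hd₁ hd₂ hL hμ₁ hμ₂ hτ hq hb hS hlaw hx₁ hK0
  | succ T ih =>
    have hne : P.X.Nonempty := ⟨x₁, hx₁⟩
    have hy₁ := hA.ystar_mem hL.le hμ₁ hμ₂ hx₁
    have hrun : Measurable fun ω => (P.run q μ₁ μ₂ x₁ (P.ystar x₁) (fun t => S t ω) T).val :=
      (hA.measurable_run hne q x₁ (P.ystar x₁) T).comp (measurable_pi_lambda _ hS)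
    have hprog : Measurable fun ω => ENNReal.ofReal (q.η (T + 1) * P.progress q L μ₁
        (P.run q μ₁ μ₂ x₁ (P.ystar x₁) (fun t => S t ω) T).val) :=
      (((hA.measurable_progress hd₁ hL hμ₁ hμ₂ hτ hne q).comp hrun).const_mul _).ennreal_ofReal
    -- By independence, the next state is averaged over its batch with the current state fixed.
    -- Lower integrals let the induction proceed before any integrability is known.
    have h1 : ∫⁻ ω, ENNReal.ofReal (P.potential q L τ D b (P.g x₁ - K) μ₁ μ₂ (T + 1)
          (P.run q μ₁ μ₂ x₁ (P.ystar x₁) (fun t => S t ω) (T + 1)).val) ∂Pr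
        + ∫⁻ ω, ENNReal.ofReal (q.η (T + 1) * P.progress q L μ₁
          (P.run q μ₁ μ₂ x₁ (P.ystar x₁) (fun t => S t ω) T).val) ∂Pr
        ≤ ∫⁻ ω, ENNReal.ofReal (P.potential q L τ D b (P.g x₁ - K) μ₁ μ₂ T
          (P.run q μ₁ μ₂ x₁ (P.ystar x₁) (fun t => S t ω) T).val) ∂Pr
        + ENNReal.ofReal
          (stepError q L τ D b δ (d₁ * L * μ₁) (d₂ * L * μ₂) (q.η (T + 1))) := by
      rw [hA.lintegral_run_succ hne q x₁ (P.ystar x₁) hS hind hlaw T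
        (Ψ := fun s => ENNReal.ofReal (P.potential q L τ D b (P.g x₁ - K) μ₁ μ₂ (T + 1) s))
        (hA.measurable_potential hd₁ hd₂ hL hμ₁ hμ₂ hτ q D b (P.g x₁ - K) (T + 1)).ennreal_ofReal,
        ← lintegral_add_right _ hprog]
      have hc : ∀ c : ENNReal, c = ∫⁻ _ω, c ∂Pr := fun c => by simp
      conv_rhs => rw [hc (ENNReal.ofReal (stepError q L τ D b δ (d₁ * L * μ₁) (d₂ * L * μ₂)
        (q.η (T + 1)))), ← lintegral_add_right _ measurable_const]
      refine lintegral_mono fun ω => ?_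
      exact hA.lintegral_potential_step_le hd₁ hd₂ hL hμ₁ hμ₂ hτ hq hτL hb hbD hD
        (fun x hx => by linarith [hK x hx]) T
        (hA.run_mem q (fun t => ⟨(hq.η_pos t).le, hq.η_le_one t⟩) hx₁ hy₁ (fun t => S t ω) T)
    rw [Finset.sum_range_succ, Finset.sum_range_succ]
    calc _ = (∫⁻ ω, ENNReal.ofReal (P.potential q L τ D b (P.g x₁ - K) μ₁ μ₂ (T + 1)
          (P.run q μ₁ μ₂ x₁ (P.ystar x₁) (fun t => S t ω) (T + 1)).val) ∂Pr
        + ∫⁻ ω, ENNReal.ofReal (q.η (T + 1) * P.progress q L μ₁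
          (P.run q μ₁ μ₂ x₁ (P.ystar x₁) (fun t => S t ω) T).val) ∂Pr)
        + ∑ n ∈ Finset.range T, ∫⁻ ω, ENNReal.ofReal (q.η (n + 1) * P.progress q L μ₁
          (P.run q μ₁ μ₂ x₁ (P.ystar x₁) (fun t => S t ω) n).val) ∂Pr := by ring
      _ ≤ _ := add_le_add_left h1 _
      _ = (∫⁻ ω, ENNReal.ofReal (P.potential q L τ D b (P.g x₁ - K) μ₁ μ₂ T
          (P.run q μ₁ μ₂ x₁ (P.ystar x₁) (fun t => S t ω) T).val) ∂Pr
        + ∑ n ∈ Finset.range T, ∫⁻ ω, ENNReal.ofReal (q.η (n + 1) * P.progress q L μ₁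
          (P.run q μ₁ μ₂ x₁ (P.ystar x₁) (fun t => S t ω) n).val) ∂Pr)
        + ENNReal.ofReal
          (stepError q L τ D b δ (d₁ * L * μ₁) (d₂ * L * μ₂) (q.η (T + 1))) := by ring
      _ ≤ _ := add_le_add_left ih _
      _ = _ := by ring

end Assumptions

end Problem

end AccZOMDA

/-! ### From the potential to the stationarity measure -/

namespace AccZOMDA

lemma integral_uniformOn_univ_fin {T : ℕ} (hT : 0 < T) (f : Fin T → ℝ) :
    ∫ i, f i ∂uniformOn Set.univ = (T : ℝ)⁻¹ * ∑ i, f i := by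
  have : Nonempty (Fin T) := ⟨⟨0, hT⟩⟩
  rw [uniformOn, ProbabilityTheory.cond, integral_smul_measure, Measure.restrict_univ, integral_count]
  simp [Measure.count_apply_finite]

lemma isProbabilityMeasure_uniformOn_univ_fin {T : ℕ} (hT : 0 < T) :
    IsProbabilityMeasure (uniformOn (Set.univ : Set (Fin T))) :=
  isProbabilityMeasure_uniformOn Set.finite_univ ⟨⟨0, hT⟩, trivial⟩

/-- A sequence of integrable functions evaluated at an independent uniform index. -/
lemma integrable_uniform_index {Ω : Type*} [MeasurableSpace Ω] {Pr : Measure Ω}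
    [IsProbabilityMeasure Pr] {T : ℕ} (hT : 0 < T) {H : ℕ → Ω → ℝ}
    (hH : ∀ n, n < T → Integrable (H n) Pr) (hm : ∀ n, Measurable (H n)) :
    Integrable (fun z : Ω × Fin T => H z.2 z.1) (Pr.prod (uniformOn Set.univ)) ∧
    ∫ z : Ω × Fin T, H z.2 z.1 ∂(Pr.prod (uniformOn Set.univ))
      = (T : ℝ)⁻¹ * ∑ n ∈ Finset.range T, ∫ ω, H n ω ∂Pr := by
  have := isProbabilityMeasure_uniformOn_univ_fin hT
  have hmeas : Measurable fun z : Ω × Fin T => H z.2 z.1 :=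
    measurable_from_prod_countable_left fun i => hm i
  have hint : Integrable (fun z : Ω × Fin T => H z.2 z.1) (Pr.prod (uniformOn Set.univ)) := by
    rw [integrable_prod_iff' hmeas.aestronglyMeasurable]
    exact ⟨Filter.Eventually.of_forall fun i => hH i i.2, Integrable.of_finite⟩
  refine ⟨hint, ?_⟩
  rw [integral_prod_symm _ hint, integral_uniformOn_univ_fin hT,
    Finset.sum_range fun n => ∫ ω, H n ω ∂Pr]

lemma Params.Admissible.η_antitone {q : Params} {L τ D b : ℝ} (hq : q.Admissible L τ D b)
    {n T : ℕ} (h : n ≤ T) : q.η T ≤ q.η n := by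
  have h1 := hq.add_pos n
  have hk := hq.k_pos
  have h2 : (n : ℝ) ≤ T := by exact_mod_cast h
  unfold Params.η
  gcongr

namespace Problem

variable {d₁ d₂ : ℕ} {Ξ : Type*} [MeasurableSpace Ξ] {P : Problem d₁ d₂ Ξ} {b : ℕ}

namespace Assumptions

variable {L τ δ μ₁ μ₂ : ℝ} (hA : P.Assumptions L τ δ μ₁ μ₂) (hd₁ : 0 < d₁) (hd₂ : 0 < d₂)
  (hL : 0 < L) (hμ₁ : 0 < μ₁) (hμ₂ : 0 < μ₂) (hτ : 0 < τ)
include hA hd₁ hL hμ₁ hμ₂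

/-- Stationarity is controlled by the decrease of the potential. -/
lemma stationarity_le_progress {q : Params} (hγ : 0 < q.γ) {ε : ℝ} (hε : 0 < ε)
    {s : State d₁ d₂} (hs : s ∈ P.feasible) :
    P.stationarity L q.γ s
      ≤ 13 / (2 * q.γ * ε) * P.progress q L μ₁ s + ε / 2 + d₁ * L * μ₁ / 2 := by
  have h1 : ‖P.gradFX s.x s.y - s.v‖ ≤ d₁ * L * μ₁ / 2 + ‖s.v - P.meanX μ₁ s.x s.y‖ := by
    have := hA.norm_meanX_sub_le hL.le hμ₁ hμ₂ hd₁ hs.1 hs.2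
    have h2 := norm_sub_le_norm_sub_add_norm_sub (P.gradFX s.x s.y) (P.meanX μ₁ s.x s.y) s.v
    rw [norm_sub_rev (P.gradFX s.x s.y) (P.meanX μ₁ s.x s.y),
      norm_sub_rev (P.meanX μ₁ s.x s.y) s.v] at h2
    linarith
  unfold stationarity progress trackY errX
  rw [P.ystarX_eq hs.1]
  change _ + ‖P.gradFX s.x s.y - s.v‖ + _ ≤ _
  set a := ‖P.xtilde q.γ s - s.x‖
  set e := ‖s.v - P.meanX μ₁ s.x s.y‖
  set y := ‖s.y - P.ystar s.x‖
  -- Cauchy–Schwarz with weights `1/10`, `1/2`, `8` costs `10 + 2 + 1/8 ≤ 13`; then `h ≤ h²/(2ε) +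
  -- ε/2`. The differences in the final `nlinarith` encode the equality cases of Cauchy–Schwarz.
  have key : 1 / q.γ * a + e + L * y ≤ 13 / (2 * q.γ * ε)
      * (1 / (10 * q.γ) * a ^ 2 + q.γ / 2 * e ^ 2 + 8 * q.γ * L ^ 2 * y ^ 2) + ε / 2 := by
    obtain ⟨p, hp⟩ : ∃ p, p = 1 / q.γ * a := ⟨_, rfl⟩
    have ha : a = q.γ * p := by rw [hp]; field_simp
    have e1 : 13 / (2 * q.γ * ε)
        * (1 / (10 * q.γ) * a ^ 2 + q.γ / 2 * e ^ 2 + 8 * q.γ * L ^ 2 * y ^ 2) + ε / 2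
        = (13 * (p ^ 2 / 10 + e ^ 2 / 2 + 8 * (L * y) ^ 2) + ε ^ 2) / (2 * ε) := by
      rw [ha]; field_simp
    rw [← hp, e1, le_div_iff₀ (by positivity)]
    nlinarith [sq_nonneg (p + e + L * y - ε), sq_nonneg (p - 5 * e), sq_nonneg (p - 80 * (L * y)),
      sq_nonneg (e - 16 * (L * y)), sq_nonneg p, sq_nonneg e, sq_nonneg (L * y)]
  linarith

include hd₂ hτ

variable {q : Params} {D : ℝ} (hq : q.Admissible L τ D b) (hτL : τ ≤ L) (hb : 0 < b)
  (hbD : (b : ℝ) ≤ D) (hD : D = d₁ + d₂) {Ω : Type*} [MeasurableSpace Ω] {Pr : Measure Ω}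
  [IsProbabilityMeasure Pr] {S : ℕ → Ω → Batch d₁ d₂ Ξ b} (hS : ∀ t, Measurable (S t))
  (hind : iIndepFun S Pr) (hlaw : ∀ t, Pr.map (S t) = batchLaw P b) {x₁ : E d₁} (hx₁ : x₁ ∈ P.X)
  {K : ℝ} (hK0 : 0 ≤ K) (hK : ∀ x ∈ P.X, P.g x₁ - P.g x ≤ K)
include hq hS hx₁

omit [IsProbabilityMeasure Pr] hd₂ hq in
lemma measurable_progress_run (n : ℕ) :
    Measurable fun ω => P.progress q L μ₁
      (P.run q μ₁ μ₂ x₁ (P.ystar x₁) (fun t => S t ω) n).val := by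
  have hne : P.X.Nonempty := ⟨x₁, hx₁⟩
  exact (hA.measurable_progress hd₁ hL hμ₁ hμ₂ hτ hne q).comp
    ((hA.measurable_run hne q x₁ (P.ystar x₁) n).comp (measurable_pi_lambda _ hS))

omit [IsProbabilityMeasure Pr] hd₁ hd₂ in
lemma measurable_stationarity_run (n : ℕ) :
    Measurable fun ω => P.stationarity L q.γ
      (P.run q μ₁ μ₂ x₁ (P.ystar x₁) (fun t => S t ω) n).val := by
  have hne : P.X.Nonempty := ⟨x₁, hx₁⟩
  have hy₁ := hA.ystar_mem hL.le hμ₁ hμ₂ hx₁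
  have hrun : Measurable fun ω => (P.run q μ₁ μ₂ x₁ (P.ystar x₁) (fun t => S t ω) n).val :=
    (hA.measurable_run hne q x₁ (P.ystar x₁) n).comp (measurable_pi_lambda _ hS)
  have hmem := fun ω => hA.run_mem q (fun t => ⟨(hq.η_pos t).le, hq.η_le_one t⟩) hx₁ hy₁
    (fun t => S t ω) n
  have hx := State.measurable_x.comp hrun
  have hy := State.measurable_y.comp hrun
  have h1 := ((hA.measurable_xtilde hne q.γ).comp hrun).sub hx
  have h2 := ((hA.measurable_indicator_gradFX hL.le hμ₁ hμ₂).comp (hx.prodMk hy)).sub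
    (State.measurable_v.comp hrun)
  have h3 := hy.sub ((hA.measurable_ystarX hL.le hμ₁ hμ₂ hτ).comp hx)
  have := ((h1.norm.const_mul (1 / q.γ)).add h2.norm).add (h3.norm.const_mul L)
  convert this using 2 with ω
  have hx := (hmem ω).1
  have hxy := Set.mk_mem_prod (hmem ω).1 (hmem ω).2
  simp only [Pi.add_apply, Pi.sub_apply, Function.comp_apply, Set.indicator_of_mem hxy,
    P.ystarX_eq hx]
  rfl

include hτL hb hbD hD hind hlaw hK0 hK

/-- Summed expected decrease of the potential, in terms of Bochner integrals. -/
lemma sum_integral_progress_le (T : ℕ) :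
    (∀ n < T, Integrable (fun ω => P.progress q L μ₁
      (P.run q μ₁ μ₂ x₁ (P.ystar x₁) (fun t => S t ω) n).val) Pr) ∧
    q.η T * ∑ n ∈ Finset.range T, ∫ ω, P.progress q L μ₁
      (P.run q μ₁ μ₂ x₁ (P.ystar x₁) (fun t => S t ω) n).val ∂Pr
    ≤ K + weightV q τ / q.η 0 * (2 * δ ^ 2 / b)
      + ∑ n ∈ Finset.range T,
        stepError q L τ D b δ (d₁ * L * μ₁) (d₂ * L * μ₂) (q.η (n + 1)) := by
  have hb' : (0 : ℝ) < b := by positivity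
  have hDpos := hb'.trans_le hbD
  have hγ := hq.γ_pos
  have hl := hq.lam_pos
  have hc₁ := hq.c₁_pos
  have hc₂ := hq.c₂_pos hDpos hb'
  have wY : 0 ≤ weightY q L τ D b := by rw [weightY]; positivity
  have wV : 0 ≤ weightV q τ := by rw [weightV]; positivity
  set G : ℕ → Ω → ℝ := fun n ω => P.progress q L μ₁
      (P.run q μ₁ μ₂ x₁ (P.ystar x₁) (fun t => S t ω) n).val with hG
  have hGm : ∀ n, Measurable (G n) := fun n =>
    hA.measurable_progress_run hd₁ hL hμ₁ hμ₂ hτ hS hx₁ n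
  have hG0 : ∀ n ω, 0 ≤ G n ω := fun n ω => progress_nonneg hγ _ _ _
  have herr : ∀ n, 0 ≤ stepError q L τ D b δ (d₁ * L * μ₁) (d₂ * L * μ₂) (q.η (n + 1)) := by
    intro n
    have := hq.η_pos (n + 1)
    unfold stepError; positivity
  have hη0 := hq.η_pos 0
  -- The terminal potential is discarded. The finite right-hand side then yields integrability of
  -- every summand, which permits the passage to Bochner integrals.
  have main := (le_add_self).trans (hA.sum_lintegral_progress_le hd₁ hd₂ hL hμ₁ hμ₂ hτ hq hτL hb
    hbD hD hS hind hlaw hx₁ hK0 hK T)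
  rw [← ENNReal.ofReal_sum_of_nonneg fun n _ => herr n,
    ← ENNReal.ofReal_add (by positivity) (Finset.sum_nonneg fun n _ => herr n)] at main
  have hint : ∀ n < T, Integrable (G n) Pr := by
    intro n hn
    have h1 := (Finset.single_le_sum (f := fun n => ∫⁻ ω, ENNReal.ofReal (q.η (n + 1) * G n ω) ∂Pr)
      (fun _ _ => zero_le) (Finset.mem_range.2 hn)).trans main
    have h2 : Integrable (fun ω => q.η (n + 1) * G n ω) Pr :=
      (lintegral_ofReal_ne_top_iff_integrable ((hGm n).const_mul _).aestronglyMeasurable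
        (Filter.Eventually.of_forall fun ω => mul_nonneg (hq.η_pos _).le (hG0 n ω))).1
        (h1.trans_lt ENNReal.ofReal_lt_top).ne
    refine (h2.const_mul (q.η (n + 1))⁻¹).congr (Filter.Eventually.of_forall fun ω => ?_)
    simp only
    rw [inv_mul_cancel_left₀ (hq.η_pos _).ne']
  refine ⟨hint, ?_⟩
  have e : ∀ n ∈ Finset.range T, ∫⁻ ω, ENNReal.ofReal (q.η (n + 1) * G n ω) ∂Pr
      = ENNReal.ofReal (q.η (n + 1) * ∫ ω, G n ω ∂Pr) := by
    intro n hn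
    rw [← integral_const_mul, ofReal_integral_eq_lintegral_ofReal
      ((hint n (Finset.mem_range.1 hn)).const_mul _)
      (Filter.Eventually.of_forall fun ω => mul_nonneg (hq.η_pos _).le (hG0 n ω))]
  have hI : ∀ n, 0 ≤ ∫ ω, G n ω ∂Pr := fun n => integral_nonneg (hG0 n)
  rw [Finset.sum_congr rfl e, ← ENNReal.ofReal_sum_of_nonneg
    fun n _ => mul_nonneg (hq.η_pos _).le (hI n),
    ENNReal.ofReal_le_ofReal_iff (add_nonneg (by positivity)
      (Finset.sum_nonneg fun n _ => herr n))] at main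
  refine le_trans ?_ main
  rw [Finset.mul_sum]
  exact Finset.sum_le_sum fun n hn => mul_le_mul_of_nonneg_right
    (hq.η_antitone (Finset.mem_range.1 hn)) (hI n)

/-- The output is stationary in expectation once the accumulated error is small. -/
lemma integral_stationarity_le {T : ℕ} (hT : 0 < T) {ε : ℝ} (hε : 0 < ε)
    (hbias : d₁ * L * μ₁ ≤ ε / 2)
    (herr : K + weightV q τ / q.η 0 * (2 * δ ^ 2 / b)
      + ∑ n ∈ Finset.range T,
        stepError q L τ D b δ (d₁ * L * μ₁) (d₂ * L * μ₂) (q.η (n + 1))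
      ≤ q.η T * T * (q.γ * ε ^ 2 / 26)) :
    Integrable (fun z : Ω × Fin T => P.stationarity L q.γ
        (P.run q μ₁ μ₂ x₁ (P.ystar x₁) (fun t => S t z.1) z.2).val)
      (Pr.prod (uniformOn Set.univ)) ∧
    ∫ z : Ω × Fin T, P.stationarity L q.γ
        (P.run q μ₁ μ₂ x₁ (P.ystar x₁) (fun t => S t z.1) z.2).val
      ∂(Pr.prod (uniformOn Set.univ)) ≤ ε := by
  obtain ⟨hint, hsum⟩ := hA.sum_integral_progress_le hd₁ hd₂ hL hμ₁ hμ₂ hτ hq hτL hb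
    hbD hD hS hind hlaw hx₁ hK0 hK T
  have hγ := hq.γ_pos
  have hηT := hq.η_pos T
  have hT' : (0 : ℝ) < T := by exact_mod_cast hT
  have hy₁ := hA.ystar_mem hL.le hμ₁ hμ₂ hx₁
  set G : ℕ → Ω → ℝ := fun n ω => P.progress q L μ₁
      (P.run q μ₁ μ₂ x₁ (P.ystar x₁) (fun t => S t ω) n).val with hG
  set H : ℕ → Ω → ℝ := fun n ω => P.stationarity L q.γ
      (P.run q μ₁ μ₂ x₁ (P.ystar x₁) (fun t => S t ω) n).val with hH
  have hHm : ∀ n, Measurable (H n) := fun n =>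
    hA.measurable_stationarity_run hL hμ₁ hμ₂ hτ hq hS hx₁ n
  have hH0 : ∀ n ω, 0 ≤ H n ω := fun n ω => by
    simp only [hH, stationarity]; positivity
  have hle : ∀ n ω, H n ω ≤ 13 / (2 * q.γ * ε) * G n ω + (ε / 2 + d₁ * L * μ₁ / 2) := fun n ω =>
    (hA.stationarity_le_progress hd₁ hL hμ₁ hμ₂ hγ hε
      (hA.run_mem q (fun t => ⟨(hq.η_pos t).le, hq.η_le_one t⟩) hx₁ hy₁ _ n)).trans_eq
      (add_assoc _ _ _)
  have hbd : ∀ n < T, Integrable (fun ω => 13 / (2 * q.γ * ε) * G n ω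
      + (ε / 2 + d₁ * L * μ₁ / 2)) Pr := fun n hn =>
    ((hint n hn).const_mul _).add (integrable_const _)
  have hHint : ∀ n < T, Integrable (H n) Pr := fun n hn =>
    (hbd n hn).mono' (hHm n).aestronglyMeasurable
      (Filter.Eventually.of_forall fun ω => by rw [Real.norm_of_nonneg (hH0 n ω)]; exact hle n ω)
  obtain ⟨h1, h2⟩ := integrable_uniform_index hT hHint hHm
  refine ⟨h1, h2.trans_le ?_⟩
  have h3 : ∀ n ∈ Finset.range T, ∫ ω, H n ω ∂Pr
      ≤ 13 / (2 * q.γ * ε) * ∫ ω, G n ω ∂Pr + (ε / 2 + d₁ * L * μ₁ / 2) := by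
    intro n hn
    have hn' := Finset.mem_range.1 hn
    refine (integral_mono (hHint n hn') (hbd n hn') (hle n)).trans_eq ?_
    rw [integral_add ((hint n hn').const_mul _) (integrable_const _), integral_const_mul, integral_const, probReal_univ, one_smul]
  have h4 := Finset.sum_le_sum h3
  rw [Finset.sum_add_distrib, ← Finset.mul_sum, Finset.sum_const, Finset.card_range,
    nsmul_eq_mul] at h4
  have h5 : ∑ n ∈ Finset.range T, ∫ ω, G n ω ∂Pr ≤ T * (q.γ * ε ^ 2 / 26) := by
    have := hsum.trans herr
    rw [mul_assoc] at this
    exact le_of_mul_le_mul_left this hηT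
  -- Budget for `ε`: `ε/2` from Young's inequality, `ε/4` from the averaged progress, `ε/4` from the
  -- bias. This fixes the constant `26 = 2 · 13`.
  have h6 : 13 / (2 * q.γ * ε) * ∑ n ∈ Finset.range T, ∫ ω, G n ω ∂Pr
      ≤ T * (ε / 4) := by
    calc _ ≤ 13 / (2 * q.γ * ε) * (T * (q.γ * ε ^ 2 / 26)) := by gcongr
      _ = _ := by field_simp; ring
  rw [inv_mul_le_iff₀ hT']
  nlinarith

end Assumptions

end Problem

end AccZOMDA

/-! ### The accumulated error -/

namespace AccZOMDA

lemma sum_inv_le_log {m : ℝ} (hm : 1 ≤ m) (T : ℕ) :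
    ∑ n ∈ Finset.range T, 1 / (m + ((n + 1 : ℕ) : ℝ)) ≤ Real.log (m + T) := by
  suffices h : ∑ n ∈ Finset.range T, 1 / (m + ((n + 1 : ℕ) : ℝ)) ≤ Real.log (m + T) - Real.log m by
    linarith [Real.log_nonneg hm]
  induction T with
  | zero => simp
  | succ T ih =>
    have h0 : 0 < m + T := by positivity
    have h1 : 0 < m + ((T + 1 : ℕ) : ℝ) := by positivity
    have h2 := Real.one_sub_inv_le_log_of_pos (div_pos h1 h0)
    rw [Real.log_div h1.ne' h0.ne', inv_div] at h2
    have h3 : 1 - (m + T) / (m + ((T + 1 : ℕ) : ℝ)) = 1 / (m + ((T + 1 : ℕ) : ℝ)) := by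
      rw [eq_div_iff h1.ne', sub_mul, div_mul_cancel₀ _ h1.ne']; push_cast; ring
    rw [Finset.sum_range_succ]
    linarith

section

variable {q : Params} {L τ D b : ℝ} (hq : q.Admissible L τ D b) (hL : 0 < L) (hτ : 0 < τ)
  (hb : 0 < b) (hD : 1 ≤ D) {δ β₁ β₂ r : ℝ} {T : ℕ} (hr : r = (q.m + T) ^ (1 / 3 : ℝ))
  (hβ₁ : β₁ ^ 2 ≤ L ^ 2 / r ^ 4) (hβ₂ : β₂ ^ 2 ≤ L ^ 2 / (D * r ^ 4))
include hq hL hτ hb hD hr hβ₁ hβ₂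

/-- With `r³ = m + T` the squared biases are of order `r⁻⁴`, so even after multiplication by `1/η ≤
r/k` they are of order `1/(m + T)` and sum to a constant. The extra `1/D` in `β₂²` cancels the `D`
in `weightY`. The variance carries `η³ = k³/(m + n + 1)`, the source of the logarithm. -/
lemma stepError_le {n : ℕ} (hn : n < T) :
    stepError q L τ D b δ β₁ β₂ (q.η (n + 1)) ≤ q.γ *
      ((L ^ 2 + 84 * (L / τ) ^ 2 * L ^ 2 / b + 16 * (L / τ) ^ 2 / (b * q.k)) / (q.m + T)
        + 4 * δ ^ 2 * (q.c₁ ^ 2 + q.c₂ ^ 2) * q.k ^ 3 / (τ ^ 2 * b)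
          * (1 / (q.m + ((n + 1 : ℕ) : ℝ)))) := by
  have hγ := hq.γ_pos
  have hl := hq.lam_pos
  have hk := hq.k_pos
  have hη := hq.η_pos (n + 1)
  have hη1 := hq.η_le_one (n + 1)
  have hr3 : r ^ 3 = q.m + T := hr ▸ hq.cbrt_cube T
  have hr1 : 1 ≤ r := by
    rw [hr]; exact hq.le_cbrt (by rw [one_pow]; linarith [hq.two_le_m]) T
  have hr0 : 0 < r := by linarith
  have hη3 : q.η (n + 1) ^ 3 = q.k ^ 3 / (q.m + ((n + 1 : ℕ) : ℝ)) := by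
    rw [Params.η, div_pow, hq.cbrt_cube]
  have hηi : 1 / q.η (n + 1) ≤ r / q.k := by
    have h1 := hq.η_antitone (Nat.succ_le_of_lt hn)
    rw [← one_div_div q.k r]
    refine one_div_le_one_div_of_le (by positivity) ?_
    rw [hr]; exact h1
  have hr43 : 1 / r ^ 4 ≤ 1 / r ^ 3 :=
    one_div_le_one_div_of_le (by positivity) (pow_le_pow_right₀ hr1 (by norm_num))
  have hβ₂' : β₂ ^ 2 ≤ L ^ 2 / r ^ 4 := by
    refine hβ₂.trans ?_
    gcongr
    nlinarith [pow_pos hr0 4]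
  have hL4 : L ^ 2 / r ^ 4 ≤ L ^ 2 / r ^ 3 := by
    have := mul_le_mul_of_nonneg_left hr43 (sq_nonneg L)
    simpa only [mul_one_div] using this
  have t1 : q.η (n + 1) * q.γ * β₁ ^ 2 ≤ q.γ * (L ^ 2 / r ^ 3) := by
    calc _ ≤ 1 * q.γ * (L ^ 2 / r ^ 3) := by gcongr; exact hβ₁.trans hL4
      _ = _ := by ring
  have t2 : weightY q L τ D b * (25 * q.η (n + 1) * q.lam / (6 * τ)) * (β₂ ^ 2 / 2)
      ≤ q.γ * (84 * (L / τ) ^ 2 * L ^ 2 / b / r ^ 3) := by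
    have wY : 0 ≤ weightY q L τ D b := by rw [weightY]; positivity
    calc _ ≤ weightY q L τ D b * (25 * 1 * q.lam / (6 * τ)) * (L ^ 2 / (D * r ^ 4) / 2) := by
          gcongr
      _ = q.γ * (250 / 3 * (L / τ) ^ 2 * L ^ 2 / b * (1 / r ^ 4)) := by
          rw [weightY]; field_simp; ring
      _ ≤ q.γ * (84 * (L / τ) ^ 2 * L ^ 2 / b * (1 / r ^ 3)) := by gcongr; norm_num
      _ = _ := by ring
  have t3 : weightV q τ / q.η (n + 1) * ((4 * β₁ ^ 2 + 4 * β₂ ^ 2) / b)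
      ≤ q.γ * (16 * (L / τ) ^ 2 / (b * q.k) / r ^ 3) := by
    have wV : 0 ≤ weightV q τ := by rw [weightV]; positivity
    calc _ = weightV q τ * (1 / q.η (n + 1)) * ((4 * β₁ ^ 2 + 4 * β₂ ^ 2) / b) := by ring
      _ ≤ weightV q τ * (r / q.k) * ((4 * (L ^ 2 / r ^ 4) + 4 * (L ^ 2 / r ^ 4)) / b) := by gcongr
      _ = _ := by rw [weightV]; field_simp; ring
  have t4 : weightV q τ / q.η (n + 1) * ((2 * (q.c₁ * q.η (n + 1) ^ 2) ^ 2 * δ ^ 2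
        + 2 * (q.c₂ * q.η (n + 1) ^ 2) ^ 2 * δ ^ 2) / b)
      = q.γ * (4 * δ ^ 2 * (q.c₁ ^ 2 + q.c₂ ^ 2) * q.k ^ 3 / (τ ^ 2 * b)
          * (1 / (q.m + ((n + 1 : ℕ) : ℝ)))) := by
    have : q.γ * (4 * δ ^ 2 * (q.c₁ ^ 2 + q.c₂ ^ 2) * q.k ^ 3 / (τ ^ 2 * b)
          * (1 / (q.m + ((n + 1 : ℕ) : ℝ))))
        = q.γ * (4 * δ ^ 2 * (q.c₁ ^ 2 + q.c₂ ^ 2) / (τ ^ 2 * b))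
          * (q.k ^ 3 / (q.m + ((n + 1 : ℕ) : ℝ))) := by ring
    rw [this, ← hη3, weightV]
    field_simp
    ring
  have split : stepError q L τ D b δ β₁ β₂ (q.η (n + 1))
      = q.η (n + 1) * q.γ * β₁ ^ 2
        + weightY q L τ D b * (25 * q.η (n + 1) * q.lam / (6 * τ)) * (β₂ ^ 2 / 2)
        + weightV q τ / q.η (n + 1) * ((4 * β₁ ^ 2 + 4 * β₂ ^ 2) / b)
        + weightV q τ / q.η (n + 1) * ((2 * (q.c₁ * q.η (n + 1) ^ 2) ^ 2 * δ ^ 2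
        + 2 * (q.c₂ * q.η (n + 1) ^ 2) ^ 2 * δ ^ 2) / b) := by
    rw [stepError]; ring
  rw [split, t4, ← hr3]
  have := add_le_add (add_le_add t1 t2) t3
  have e : q.γ * ((L ^ 2 + 84 * (L / τ) ^ 2 * L ^ 2 / b + 16 * (L / τ) ^ 2 / (b * q.k)) / r ^ 3)
    = q.γ * (L ^ 2 / r ^ 3) + q.γ * (84 * (L / τ) ^ 2 * L ^ 2 / b / r ^ 3)
      + q.γ * (16 * (L / τ) ^ 2 / (b * q.k) / r ^ 3) := by ring
  rw [mul_add q.γ (_ / _), e]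
  linarith

/-- The accumulated error. -/
lemma sum_stepError_le {K : ℝ} :
    K + weightV q τ / q.η 0 * (2 * δ ^ 2 / b)
      + ∑ n ∈ Finset.range T, stepError q L τ D b δ β₁ β₂ (q.η (n + 1))
    ≤ q.γ * (K / q.γ + 4 * δ ^ 2 * q.m ^ (1 / 3 : ℝ) / (q.k * τ ^ 2 * b)
      + (L ^ 2 + 84 * (L / τ) ^ 2 * L ^ 2 / b + 16 * (L / τ) ^ 2 / (b * q.k))
      + 4 * δ ^ 2 * (q.c₁ ^ 2 + q.c₂ ^ 2) * q.k ^ 3 / (τ ^ 2 * b) * Real.log (q.m + T)) := by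
  have hγ := hq.γ_pos
  have hk := hq.k_pos
  have hm := hq.two_le_m
  have hN := hq.add_pos T
  have hm3 : 0 < q.m ^ (1 / 3 : ℝ) := Real.rpow_pos_of_pos (by linarith) _
  have h1 := Finset.sum_le_sum fun n hn =>
    stepError_le hq hL hτ hb hD (δ := δ) hr hβ₁ hβ₂ (Finset.mem_range.1 hn)
  rw [← Finset.mul_sum, Finset.sum_add_distrib, Finset.sum_const, Finset.card_range, nsmul_eq_mul,
    ← Finset.mul_sum] at h1
  have h2 : (T : ℝ) * ((L ^ 2 + 84 * (L / τ) ^ 2 * L ^ 2 / b + 16 * (L / τ) ^ 2 / (b * q.k))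
      / (q.m + T)) ≤ L ^ 2 + 84 * (L / τ) ^ 2 * L ^ 2 / b + 16 * (L / τ) ^ 2 / (b * q.k) := by
    rw [← mul_div_assoc, div_le_iff₀ hN, mul_comm]
    gcongr
    linarith
  have h3 := sum_inv_le_log (by linarith : 1 ≤ q.m) T
  have h4 : weightV q τ / q.η 0 * (2 * δ ^ 2 / b)
      = q.γ * (4 * δ ^ 2 * q.m ^ (1 / 3 : ℝ) / (q.k * τ ^ 2 * b)) := by
    rw [weightV, Params.η]
    simp only [Nat.cast_zero, add_zero]
    field_simp
    ring
  rw [h4]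
  calc _ ≤ K + q.γ * (4 * δ ^ 2 * q.m ^ (1 / 3 : ℝ) / (q.k * τ ^ 2 * b))
      + q.γ * ((L ^ 2 + 84 * (L / τ) ^ 2 * L ^ 2 / b + 16 * (L / τ) ^ 2 / (b * q.k))
      + 4 * δ ^ 2 * (q.c₁ ^ 2 + q.c₂ ^ 2) * q.k ^ 3 / (τ ^ 2 * b) * Real.log (q.m + T)) := by
        gcongr
        exact h1.trans (by gcongr)
    _ = _ := by field_simp; ring

end

/-! ### Sizes of the parameters in powers of `s`, where `D = s ^ 10` -/

section

variable {q : Params} {K L τ b s : ℝ} (hK : 1 ≤ K) (hτ : 0 < τ) (hτL : τ ≤ L)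
  (hLK : L ≤ K) (hs : 1 ≤ s) (hb : s ^ 6 ≤ b)
  (hq : q.Admissible L τ (s ^ 10) b) (ho : q.OfOrder K L τ (s ^ 10) b)
include hK

lemma Params.OfOrder.inv_k_le {D : ℝ} (ho : q.OfOrder K L τ D b) : 1 / q.k ≤ K := by
  have := one_div_le_one_div_of_le (by positivity) ho.le_k
  rwa [one_div_one_div] at this

include hτ hτL hLK hs hb hq ho

omit hs hb in
lemma Params.Admissible.c₁_le_of_order : q.c₁ ≤ 3 * K ^ 4 := by
  have hk := hq.k_pos
  have h1 := pow_le_pow_left₀ (by positivity) (ho.inv_k_le hK) 3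
  have h2 : τ ^ 2 ≤ K ^ 2 := by gcongr; linarith
  have h3 : K ^ 2 ≤ K ^ 3 := pow_le_pow_right₀ hK (by norm_num)
  have h4 : c₁Min q.k τ ≤ 3 * K ^ 3 := by
    have : c₁Min q.k τ = 2 / 3 * (1 / q.k) ^ 3 + 9 / 4 * τ ^ 2 := by
      rw [c₁Min]; field_simp
    rw [this]; linarith [pow_pos (by linarith : 0 < K) 3]
  calc q.c₁ ≤ K * c₁Min q.k τ := ho.c₁_le
    _ ≤ K * (3 * K ^ 3) := by gcongr
    _ = _ := by ring

/-- The dominant part is `D/b ≤ s⁴`; it also determines the size of `m` below. -/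
lemma Params.Admissible.c₂_le_of_order : q.c₂ ≤ 210 * K ^ 4 * s ^ 4 := by
  have hk := hq.k_pos
  have hL : 0 < L := by linarith
  have hs0 : 0 < s := by linarith
  have hb0 : 0 < b := lt_of_lt_of_le (by positivity) hb
  have h1 := pow_le_pow_left₀ (by positivity) (ho.inv_k_le hK) 3
  have h3 : K ^ 2 ≤ K ^ 3 := pow_le_pow_right₀ hK (by norm_num)
  have hs4 : 1 ≤ s ^ 4 := one_le_pow₀ hs
  have h4 : c₂Min q.k L (s ^ 10) b ≤ 210 * K ^ 3 * s ^ 4 := by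
    have e : c₂Min q.k L (s ^ 10) b = 2 / 3 * (1 / q.k) ^ 3 + 625 / 3 * (s ^ 10 * L ^ 2 / b) := by
      rw [c₂Min]; field_simp
    have h5 : s ^ 10 * L ^ 2 / b ≤ K ^ 3 * s ^ 4 := by
      calc _ ≤ s ^ 10 * K ^ 2 / s ^ 6 := by gcongr
        _ = K ^ 2 * s ^ 4 := by field_simp
        _ ≤ _ := by gcongr
    rw [e]
    have h6 : K ^ 3 * 1 ≤ K ^ 3 * s ^ 4 := by gcongr
    have h7 : 0 < K ^ 3 * s ^ 4 := by positivity
    linarith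
  calc q.c₂ ≤ K * c₂Min q.k L (s ^ 10) b := ho.c₂_le
    _ ≤ K * (210 * K ^ 3 * s ^ 4) := by gcongr
    _ = _ := by ring

lemma Params.Admissible.m_le_of_order : q.m ≤ (210 * K ^ 6 * s ^ 4) ^ 3 := by
  have hk := hq.k_pos
  have hs0 : 0 < s := by linarith
  have hb0 : 0 < b := lt_of_lt_of_le (by positivity) hb
  have hc₁ := hq.c₁_pos
  have hc₂ := hq.c₂_pos (by positivity) hb0
  have h1 := hq.c₁_le_of_order hK hτ hτL hLK ho
  have h2 := hq.c₂_le_of_order hK hτ hτL hLK hs hb ho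
  have hs4 : 1 ≤ s ^ 4 := one_le_pow₀ hs
  have hK5 : 1 ≤ K ^ 5 := one_le_pow₀ hK
  have hK5' : K ≤ K ^ 5 := le_self_pow₀ hK (by norm_num)
  have hKs : K ^ 5 * 1 ≤ K ^ 5 * s ^ 4 := by gcongr
  have hmin : mMin q.k q.c₁ q.c₂ ≤ (210 * K ^ 5 * s ^ 4) ^ 3 := by
    refine max_le (max_le ?_ ?_) (max_le ?_ ?_)
    · have : (2 : ℝ) ≤ 210 * K ^ 5 * s ^ 4 := by linarith
      nlinarith [pow_le_pow_left₀ (by norm_num) this 3]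
    · exact pow_le_pow_left₀ hk.le (by linarith [ho.k_le]) 3
    · refine pow_le_pow_left₀ (by positivity) ?_ 3
      calc q.c₁ * q.k ≤ (3 * K ^ 4) * K := by gcongr; exact ho.k_le
        _ ≤ _ := by linarith
    · refine pow_le_pow_left₀ (by positivity) ?_ 3
      calc q.c₂ * q.k ≤ (210 * K ^ 4 * s ^ 4) * K := by gcongr; exact ho.k_le
        _ = _ := by ring
  have hK3 : K ≤ K ^ 3 := le_self_pow₀ hK (by norm_num)
  calc q.m ≤ K * mMin q.k q.c₁ q.c₂ := ho.m_le
    _ ≤ K * (210 * K ^ 5 * s ^ 4) ^ 3 := by gcongr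
    _ ≤ K ^ 3 * (210 * K ^ 5 * s ^ 4) ^ 3 := by gcongr
    _ = _ := by ring

omit hLK hs hb ho in
lemma Params.Admissible.lam_le_of_order (hKL : 1 / K ≤ L) : q.lam ≤ K / 6 := by
  have hK0 : 0 < K := by linarith
  have hL : 0 < L := by linarith
  have h := hq.lam_mul_L_le hL
  have h1 : q.lam * (1 / K) ≤ 1 / 6 :=
    (mul_le_mul_of_nonneg_left hKL hq.lam_pos.le).trans h
  rw [mul_one_div, div_le_iff₀ hK0] at h1
  linarith

/-- The first bound on `γ` is decisive: `√(b/D) ≥ s⁻²`, and the square root and the prefactor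
`λτ/(2L)` contribute one factor `1/κ` each. The second bound is larger because `k ≤ m^(1/3)`. -/
lemma Params.Admissible.inv_γ_le_of_order (hKL : 1 / K ≤ L) :
    1 / q.γ ≤ 22 * K ^ 3 * (L / τ) ^ 2 * s ^ 2 / q.lam := by
  have hK0 : 0 < K := by linarith
  have hL : 0 < L := by linarith
  have hk := hq.k_pos
  have hl := hq.lam_pos
  have hs0 : 0 < s := by linarith
  have hb0 : 0 < b := lt_of_lt_of_le (by positivity) hb
  have hlK := hq.lam_le_of_order hK hτ hτL hKL
  have hκ : 1 ≤ L / τ := (one_le_div hτ).2 hτL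
  set κ := L / τ with hκdef
  have hτκ : τ = L / κ := by rw [hκdef]; field_simp
  have hκ0 : 0 < κ := by linarith
  have hs2 : 1 ≤ s ^ 2 := one_le_pow₀ hs
  have hmain : q.lam / (22 * K ^ 2 * κ ^ 2 * s ^ 2) ≤ γMax q.k q.m q.lam L τ (s ^ 10) b := by
    refine le_min ?_ ?_
    · have hsq : 1 / (11 * K * κ * s ^ 2)
          ≤ √((6 * b / s ^ 10) / (36 * q.lam ^ 2 + 625 * (L / τ) ^ 2)) := by
        apply Real.le_sqrt_of_sq_le
        have h1 : 36 * q.lam ^ 2 + 625 * κ ^ 2 ≤ 626 * K ^ 2 * κ ^ 2 := by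
          have h2 : q.lam ^ 2 ≤ (K / 6) ^ 2 := by gcongr
          have h3 : K ^ 2 * 1 ≤ K ^ 2 * κ ^ 2 := by gcongr; exact one_le_pow₀ hκ
          have h4 : 1 * κ ^ 2 ≤ K ^ 2 * κ ^ 2 := by gcongr; exact one_le_pow₀ hK
          nlinarith
        calc (1 / (11 * K * κ * s ^ 2)) ^ 2 = 6 / (726 * K ^ 2 * κ ^ 2) / s ^ 4 := by
              field_simp; ring
          _ ≤ 6 / (626 * K ^ 2 * κ ^ 2) / s ^ 4 := by gcongr; norm_num
          _ ≤ 6 / (36 * q.lam ^ 2 + 625 * κ ^ 2) / s ^ 4 := by gcongr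
          _ = (6 * s ^ 6 / s ^ 10) / (36 * q.lam ^ 2 + 625 * κ ^ 2) := by field_simp
          _ ≤ _ := by gcongr
      calc q.lam / (22 * K ^ 2 * κ ^ 2 * s ^ 2)
          ≤ q.lam / (22 * K * κ ^ 2 * s ^ 2) := by
            gcongr; exact le_self_pow₀ hK (by norm_num)
        _ = q.lam * τ / (2 * L) * (1 / (11 * K * κ * s ^ 2)) := by
            rw [hτκ]; field_simp; norm_num
        _ ≤ _ := by gcongr
    · have hkm : q.k ≤ q.m ^ (1 / 3 : ℝ) := by
        have := hq.le_cbrt hq.k_cube_le_m 0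
        simpa using this
      have e : L + L ^ 2 / τ = L * (1 + κ) := by rw [hκdef]; field_simp
      have h1 : L * (1 + κ) ≤ K * (2 * κ) := by gcongr; linarith
      calc q.lam / (22 * K ^ 2 * κ ^ 2 * s ^ 2) ≤ (K / 6) / (22 * K ^ 2 * κ ^ 2 * s ^ 2) := by
            gcongr
        _ = 1 / (132 * K * κ ^ 2 * s ^ 2) := by field_simp; norm_num
        _ ≤ 1 / (2 * (K * (2 * κ))) := by
            refine one_div_le_one_div_of_le (by positivity) ?_
            have : κ * 1 * 1 ≤ κ * κ * s ^ 2 := by gcongr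
            nlinarith [mul_le_mul_of_nonneg_left this hK0.le]
        _ ≤ 1 / (2 * (L + L ^ 2 / τ)) := by rw [e]; gcongr
        _ = q.k / (2 * (L + L ^ 2 / τ) * q.k) := by field_simp
        _ ≤ _ := by gcongr
  have h2 : q.lam / (22 * K ^ 3 * κ ^ 2 * s ^ 2) ≤ q.γ := by
    refine le_trans ?_ ho.le_γ
    rw [le_div_iff₀ hK0]
    refine le_trans (le_of_eq ?_) hmain
    field_simp
  have h3 := one_div_le_one_div_of_le (by positivity) h2
  rwa [one_div_div] at h3

end

end AccZOMDA

/-! ### Comparison of the error with the number of iterations -/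

namespace AccZOMDA

/-- In powers of `s`, the term `1/γ` gives `s²` and the variance term `c₂²/b` gives `s⁸ / s⁶ = s²`:
the exponent `3/5` in the batch size balances the two. Terms lacking the factor `1/λ` are absorbed
by means of `λ ≤ K`. -/
lemma errorBound_le {q : Params} {K L τ b s : ℝ} (hK : 1 ≤ K) (hτ : 0 < τ) (hτL : τ ≤ L)
    (hLK : L ≤ K) (hKL : 1 / K ≤ L) (hs : 1 ≤ s) (hb : s ^ 6 ≤ b)
    (hq : q.Admissible L τ (s ^ 10) b) (ho : q.OfOrder K L τ (s ^ 10) b)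
    {δ lg : ℝ} (hδ : 0 < δ) (hδK : δ ≤ K) (hlg : 1 ≤ lg) :
    K / q.γ + 4 * δ ^ 2 * q.m ^ (1 / 3 : ℝ) / (q.k * τ ^ 2 * b)
      + (L ^ 2 + 84 * (L / τ) ^ 2 * L ^ 2 / b + 16 * (L / τ) ^ 2 / (b * q.k))
      + 4 * δ ^ 2 * (q.c₁ ^ 2 + q.c₂ ^ 2) * q.k ^ 3 / (τ ^ 2 * b) * lg
    ≤ 200000 * K ^ 16 * ((L / τ) ^ 2 * s ^ 2 / q.lam) * lg := by
  have hK0 : 0 < K := by linarith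
  have hL : 0 < L := by linarith
  have hk := hq.k_pos
  have hl := hq.lam_pos
  have hs0 : 0 < s := by linarith
  have hb0 : 0 < b := lt_of_lt_of_le (by positivity) hb
  have hκ : 1 ≤ L / τ := (one_le_div hτ).2 hτL
  have hlK := hq.lam_le_of_order hK hτ hτL hKL
  have hγ := hq.inv_γ_le_of_order hK hτ hτL hLK hs hb ho hKL
  have hc₁ := hq.c₁_le_of_order hK hτ hτL hLK ho
  have hc₂ := hq.c₂_le_of_order hK hτ hτL hLK hs hb ho
  have hm := hq.m_le_of_order hK hτ hτL hLK hs hb ho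
  have hc₁0 := hq.c₁_pos
  have hc₂0 := hq.c₂_pos (by positivity) hb0
  have hk1 := ho.inv_k_le hK
  have hm0 : 0 < q.m := by linarith [hq.two_le_m]
  have hm3 : q.m ^ (1 / 3 : ℝ) ≤ 210 * K ^ 6 * s ^ 4 := by
    have h := Real.rpow_le_rpow hm0.le hm (by norm_num : (0 : ℝ) ≤ 1 / 3)
    rwa [← Real.rpow_natCast (210 * K ^ 6 * s ^ 4), ← Real.rpow_mul (by positivity),
      show ((3 : ℕ) : ℝ) * (1 / 3) = 1 by norm_num, Real.rpow_one] at h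
  have hm30 : 0 < q.m ^ (1 / 3 : ℝ) := Real.rpow_pos_of_pos hm0 _
  have hτ2 : 1 / τ ^ 2 ≤ K ^ 2 * (L / τ) ^ 2 := by
    have h1 : 1 / L ≤ K := by
      have := one_div_le_one_div_of_le (by positivity) hKL
      rwa [one_div_one_div] at this
    calc 1 / τ ^ 2 = (1 / L) ^ 2 * (L / τ) ^ 2 := by field_simp
      _ ≤ _ := by gcongr
  have hbi : 1 / b ≤ 1 / s ^ 6 := one_div_le_one_div_of_le (by positivity) hb
  have hb1 : 1 / b ≤ 1 := hbi.trans (by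
    rw [div_le_one (by positivity)]; exact one_le_pow₀ hs)
  set κ := L / τ
  have hκ0 : 0 < κ := by linarith
  have hs2 : 1 ≤ s ^ 2 := one_le_pow₀ hs
  obtain ⟨V, hV⟩ : ∃ V, V = κ ^ 2 * s ^ 2 := ⟨_, rfl⟩
  obtain ⟨U, hU⟩ : ∃ U, U = κ ^ 2 * s ^ 2 / q.lam := ⟨_, rfl⟩
  have hV0 : 0 < V := by rw [hV]; positivity
  have hU0 : 0 < U := by rw [hU]; positivity
  have hκ2 : 1 ≤ κ ^ 2 := one_le_pow₀ hκ
  have hκV : κ ^ 2 ≤ V := by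
    calc κ ^ 2 = κ ^ 2 * 1 := (mul_one _).symm
      _ ≤ κ ^ 2 * s ^ 2 := by gcongr
      _ = V := hV.symm
  have hVU : V ≤ K * U := by
    have : V = q.lam * U := by rw [hV, hU]; field_simp
    rw [this]; gcongr; linarith
  have pw : ∀ {i : ℕ}, i ≤ 16 → K ^ i * U ≤ K ^ 16 * U := fun {i} hi =>
    mul_le_mul_of_nonneg_right (pow_le_pow_right₀ hK hi) hU0.le
  have t1 : K / q.γ ≤ 22 * (K ^ 16 * U) := by
    calc K / q.γ = K * (1 / q.γ) := by ring
      _ ≤ K * (22 * K ^ 3 * κ ^ 2 * s ^ 2 / q.lam) := by gcongr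
      _ = 22 * (K ^ 4 * U) := by rw [hU]; ring
      _ ≤ _ := by linarith [pw (show 4 ≤ 16 by norm_num)]
  have t2 : 4 * δ ^ 2 * q.m ^ (1 / 3 : ℝ) / (q.k * τ ^ 2 * b) ≤ 840 * (K ^ 16 * U) := by
    calc _ = 4 * δ ^ 2 * q.m ^ (1 / 3 : ℝ) * (1 / q.k) * (1 / τ ^ 2) * (1 / b) := by
          field_simp
      _ ≤ 4 * K ^ 2 * (210 * K ^ 6 * s ^ 4) * K * (K ^ 2 * κ ^ 2) * (1 / s ^ 6) := by gcongr
      _ = 840 * K ^ 11 * κ ^ 2 * (1 / s ^ 2) := by field_simp; norm_num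
      _ ≤ 840 * K ^ 11 * V * 1 := by
          gcongr
          rw [div_le_one (by positivity)]; exact hs2
      _ ≤ 840 * K ^ 11 * (K * U) * 1 := by gcongr
      _ = 840 * (K ^ 12 * U) := by ring
      _ ≤ _ := by linarith [pw (show 12 ≤ 16 by norm_num)]
  have t3 : L ^ 2 + 84 * κ ^ 2 * L ^ 2 / b + 16 * κ ^ 2 / (b * q.k) ≤ 101 * (K ^ 16 * U) := by
    calc _ = L ^ 2 * 1 + 84 * κ ^ 2 * L ^ 2 * (1 / b) + 16 * κ ^ 2 * (1 / b) * (1 / q.k) := by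
          field_simp
      _ ≤ K ^ 2 * V + 84 * V * K ^ 2 * 1 + 16 * V * 1 * K ^ 2 := by
          gcongr
          · linarith
          · exact hk1.trans (le_self_pow₀ hK (by norm_num))
      _ = 101 * K ^ 2 * V := by ring
      _ ≤ 101 * K ^ 2 * (K * U) := by gcongr
      _ = 101 * (K ^ 3 * U) := by ring
      _ ≤ _ := by linarith [pw (show 3 ≤ 16 by norm_num)]
  have t4 : 4 * δ ^ 2 * (q.c₁ ^ 2 + q.c₂ ^ 2) * q.k ^ 3 / (τ ^ 2 * b)
      ≤ 176436 * (K ^ 16 * U) := by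
    have hc : q.c₁ ^ 2 + q.c₂ ^ 2 ≤ 44109 * K ^ 8 * s ^ 8 := by
      have h1 := pow_le_pow_left₀ hc₁0.le hc₁ 2
      have h2 := pow_le_pow_left₀ hc₂0.le hc₂ 2
      have h3 : K ^ 8 * 1 ≤ K ^ 8 * s ^ 8 := by gcongr; exact one_le_pow₀ hs
      have e1 : (3 * K ^ 4) ^ 2 = 9 * K ^ 8 := by ring
      have e2 : (210 * K ^ 4 * s ^ 4) ^ 2 = 44100 * (K ^ 8 * s ^ 8) := by ring
      linarith
    have hkK := ho.k_le
    calc _ = 4 * δ ^ 2 * (q.c₁ ^ 2 + q.c₂ ^ 2) * q.k ^ 3 * (1 / τ ^ 2) * (1 / b) := by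
          field_simp
      _ ≤ 4 * K ^ 2 * (44109 * K ^ 8 * s ^ 8) * K ^ 3 * (K ^ 2 * κ ^ 2) * (1 / s ^ 6) := by gcongr
      _ = 176436 * K ^ 15 * V := by rw [hV]; field_simp; norm_num
      _ ≤ 176436 * K ^ 15 * (K * U) := by gcongr
      _ = _ := by ring
  obtain ⟨W, hW⟩ : ∃ W, W = K ^ 16 * U := ⟨_, rfl⟩
  have hW0 : 0 < W := by rw [hW]; positivity
  rw [← hW] at t1 t2 t3 t4
  have t5 := mul_le_mul_of_nonneg_right t4 (by linarith : 0 ≤ lg)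
  have t6 : W * 1 ≤ W * lg := by gcongr
  calc _ ≤ 22 * W + 840 * W + 101 * W + 176436 * W * lg := by gcongr
    _ ≤ 200000 * (W * lg) := by linarith [mul_pos hW0 (by linarith : 0 < lg)]
    _ = _ := by rw [hW, hU]; ring

/-- Logarithmic growth of the number of iterations. -/
lemma log_add_le {K A s u S m T : ℝ} (hK : 1 ≤ K) (hA : 211 * K ^ 9 ≤ A) (hs : 0 < s)
    (hS : 2 ≤ S) (hsu : s ^ 4 ≤ K ^ 2 * u) (huS : u ≤ K * S) (hm0 : 0 < m)
    (hm : m ≤ (210 * K ^ 6 * s ^ 4) ^ 3) (hT0 : 0 ≤ T)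
    (hT : T ≤ (A ^ 2 * (Real.log S * u)) ^ 3 + 1) :
    Real.log (m + T) ≤ 24 * A * Real.log S := by
  have hK0 : 0 < K := by linarith
  have hS0 : 0 < S := by linarith
  have hA1 : 1 ≤ A := by
    have : 1 ≤ K ^ 9 := one_le_pow₀ hK
    linarith
  have hA0 : 0 < A := by linarith
  have hu : 0 < u := by
    have : 0 < K ^ 2 * u := lt_of_lt_of_le (by positivity) hsu
    exact pos_of_mul_pos_right this (by positivity)
  have hℓ : 1 / 2 ≤ Real.log S := by
    have := Real.log_le_log (by norm_num) hS
    linarith [Real.log_two_gt_d9]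
  have hℓS : Real.log S ≤ S := by linarith [Real.log_le_sub_one_of_pos hS0]
  -- `210v` dominates the cube root of the bound for `m`, and `v` that of the bound for `T` before
  -- rounding. The final `24` is `18 + 6`: the constants cost `9A ≤ 18A log S`, and `log S²` costs
  -- `6 log S`.
  obtain ⟨v, hv⟩ : ∃ v, v = A ^ 2 * K ^ 9 * S ^ 2 := ⟨_, rfl⟩
  have hv1 : 1 ≤ v := by
    rw [hv]
    exact one_le_mul_of_one_le_of_one_le (one_le_mul_of_one_le_of_one_le (one_le_pow₀ hA1)
      (one_le_pow₀ hK)) (one_le_pow₀ (by linarith))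
  have h1 : m ≤ (210 * v) ^ 3 := by
    refine hm.trans (pow_le_pow_left₀ (by positivity) ?_ 3)
    calc 210 * K ^ 6 * s ^ 4 ≤ 210 * K ^ 6 * (K ^ 2 * (K * S)) := by
          gcongr
          exact hsu.trans (by gcongr)
      _ = 210 * (1 * K ^ 9 * S) := by ring
      _ ≤ 210 * (A ^ 2 * K ^ 9 * S ^ 2) := by
          gcongr
          · exact one_le_pow₀ hA1
          · exact le_self_pow₀ (by linarith) (by norm_num)
      _ = _ := by rw [hv]
  have h2 : (A ^ 2 * (Real.log S * u)) ^ 3 ≤ v ^ 3 := by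
    refine pow_le_pow_left₀ (by positivity) ?_ 3
    calc A ^ 2 * (Real.log S * u) ≤ A ^ 2 * (S * (K * S)) := by gcongr
      _ = A ^ 2 * K * S ^ 2 := by ring
      _ ≤ A ^ 2 * K ^ 9 * S ^ 2 := by gcongr; exact le_self_pow₀ hK (by norm_num)
      _ = v := hv.symm
  have h3 : m + T ≤ (211 * v) ^ 3 := by
    have : 1 ≤ v ^ 3 := one_le_pow₀ hv1
    nlinarith
  have h4 := Real.log_le_log (by linarith) h3
  have h5 : Real.log ((211 * v) ^ 3)
      = 3 * (Real.log (211 * K ^ 9) + 2 * Real.log A + 2 * Real.log S) := by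
    rw [hv, show 211 * (A ^ 2 * K ^ 9 * S ^ 2) = (211 * K ^ 9) * A ^ 2 * S ^ 2 by ring,
      Real.log_pow, Real.log_mul (by positivity) (by positivity),
      Real.log_mul (by positivity) (by positivity), Real.log_pow, Real.log_pow]
    push_cast; ring
  have h6 := Real.log_le_sub_one_of_pos (by positivity : 0 < 211 * K ^ 9)
  have h7 := Real.log_le_sub_one_of_pos hA0
  rw [h5] at h4
  nlinarith

/-- The number of iterations beats the accumulated error. -/
lemma mul_error_le_cube {A C₁ K r x t u ℓ lg : ℝ} (hA0 : 0 < A) (hC₁ : 0 < C₁) (hK : 0 < K)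
    (hu : 0 < u) (hℓ : 1 / 2 ≤ ℓ) (hx : x ≤ 210 * K ^ 8 * u) (hr : r ≤ x + t)
    (ht : A ^ 2 * (ℓ * u) ≤ t) (hlg0 : 0 ≤ lg) (hlg : lg ≤ 24 * A * ℓ)
    (hA3 : 96 * C₁ ≤ A ^ 3) (hA5 : 40320 * C₁ * K ^ 8 ≤ A ^ 5) :
    r * (C₁ * (u ^ 2 * lg)) ≤ t ^ 3 := by
  have hℓ0 : 0 < ℓ := by linarith
  obtain ⟨w, hw⟩ : ∃ w, w = ℓ * u := ⟨_, rfl⟩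
  rw [← hw] at ht
  have hw0 : 0 < w := by rw [hw]; positivity
  have ht0 : 0 < t := lt_of_lt_of_le (by positivity) ht
  have h2 : u ≤ 2 * w := by rw [hw]; nlinarith
  have h1 : u ^ 2 * ℓ ≤ 2 * w ^ 2 := by
    calc u ^ 2 * ℓ = u * w := by rw [hw]; ring
      _ ≤ 2 * w * w := by gcongr
      _ = _ := by ring
  -- The contributions of `x` and of `t` to `r` each use half of `t³`; `hA5` serves the former,
  -- `hA3` the latter.
  calc r * (C₁ * (u ^ 2 * lg)) ≤ (210 * K ^ 8 * u + t) * (C₁ * (u ^ 2 * (24 * A * ℓ))) := by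
        gcongr; linarith
    _ = (210 * K ^ 8 * u + t) * (24 * C₁ * A) * (u ^ 2 * ℓ) := by ring
    _ ≤ (210 * K ^ 8 * (2 * w) + t) * (24 * C₁ * A) * (2 * w ^ 2) := by gcongr
    _ = (40320 * C₁ * K ^ 8) * (A * w ^ 3 / 2) + t * ((96 * C₁) * (A * w ^ 2 / 2)) := by ring
    _ ≤ A ^ 5 * (A * w ^ 3 / 2) + t * (A ^ 3 * (A * w ^ 2 / 2)) := by gcongr
    _ = (A ^ 2 * w) ^ 3 / 2 + t * (A ^ 2 * w) ^ 2 / 2 := by ring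
    _ ≤ t ^ 3 / 2 + t * t ^ 2 / 2 := by gcongr
    _ = t ^ 3 := by ring

end AccZOMDA

/-! ### Choice of the number of iterations -/

namespace AccZOMDA

lemma natCeil_rpow_le {d : ℕ} (hd : 0 < d) : (⌈(d : ℝ) ^ (3 / 5 : ℝ)⌉₊ : ℝ) ≤ d := by
  have h1 : (1 : ℝ) ≤ d := by exact_mod_cast hd
  have : ⌈(d : ℝ) ^ (3 / 5 : ℝ)⌉₊ ≤ d := by
    rw [Nat.ceil_le]
    exact (Real.rpow_le_rpow_of_exponent_le h1 (by norm_num)).trans_eq (Real.rpow_one _)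
  exact_mod_cast this

set_option maxHeartbeats 1000000 in
/-- A number of iterations that is large enough for the accuracy `ε` and small enough for the claimed
query complexity. -/
lemma exists_iterations {K : ℝ} (hK : 1 ≤ K) : ∃ C : ℝ, 0 < C ∧
    ∀ (b : ℕ) (D L τ : ℝ) (q : Params) (ε : ℝ), 1 ≤ D → b = ⌈D ^ (3 / 5 : ℝ)⌉₊ →
      0 < τ → τ ≤ L → 1 / K ≤ L → L ≤ K → q.Admissible L τ D b → q.OfOrder K L τ D b →
      0 < ε → ε ≤ K * (L / τ) * D ^ (-(3 / 10) : ℝ) →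
      ∃ T : ℕ, 0 < T ∧
        (12 * b * T : ℝ) ≤ C * q.lam ^ (-(3 / 2) : ℝ) * (D ^ (9 / 10 : ℝ) * (L / τ) ^ 3 * ε⁻¹ ^ 3)
          * Real.log (2 + D * (L / τ) / (q.lam * ε)) ^ 3 ∧
        L / (q.m + T) ^ (2 / 3 : ℝ) ≤ ε / 2 ∧
        ∀ δ β₁ β₂ : ℝ, 0 < δ → δ ≤ K → 0 ≤ β₁ → β₁ ≤ L / (q.m + T) ^ (2 / 3 : ℝ) → 0 ≤ β₂ →
          β₂ ≤ L / (D ^ (1 / 2 : ℝ) * (q.m + T) ^ (2 / 3 : ℝ)) →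
          K + weightV q τ / q.η 0 * (2 * δ ^ 2 / b)
            + ∑ n ∈ Finset.range T, stepError q L τ D b δ β₁ β₂ (q.η (n + 1))
            ≤ q.η T * T * (q.γ * ε ^ 2 / 26) := by
  -- The strongest demand on `A` is `40320 · 5200000 · K¹⁷ · K⁸`, about `2.1 · 10¹¹ · K²⁵`.
  obtain ⟨A, hA⟩ : ∃ A, A = 10 ^ 12 * K ^ 25 := ⟨_, rfl⟩
  have hK0 : 0 < K := by linarith
  have hA0 : 0 < A := by rw [hA]; positivity
  have hpw : ∀ {i : ℕ}, i ≤ 25 → K ^ i ≤ K ^ 25 := fun hi => pow_le_pow_right₀ hK hi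
  have hA1 : 1 ≤ A := by linarith [one_le_pow₀ hK (n := 25)]
  -- `48 = 12 · 2 · 2`, with one factor `2` for each rounding up, of `b` and of `T`.
  refine ⟨48 * A ^ 6, by positivity, ?_⟩
  intro b D L τ q ε hD hbD hτ hτL hKL hLK hq ho hε hεK
  have hL : 0 < L := by linarith
  have hκ : 1 ≤ L / τ := (one_le_div hτ).2 hτL
  have hκ0 : 0 < L / τ := by linarith
  have hl := hq.lam_pos
  have hγ := hq.γ_pos
  have hk := hq.k_pos
  have hD0 : 0 < D := by linarith
  -- All powers of `D` that occur become integer powers of `s`.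
  obtain ⟨s, hs⟩ : ∃ s, s = D ^ (1 / 10 : ℝ) := ⟨_, rfl⟩
  have hs1 : 1 ≤ s := by rw [hs]; exact Real.one_le_rpow hD (by norm_num)
  have hs0 : 0 < s := by linarith
  have hspow : ∀ i : ℕ, s ^ i = D ^ ((i : ℝ) / 10) := fun i => by
    rw [hs, ← Real.rpow_natCast, ← Real.rpow_mul hD0.le]; congr 1; ring
  have hsD : s ^ 10 = D := by rw [hspow]; norm_num
  have hs6 : D ^ (3 / 5 : ℝ) = s ^ 6 := by rw [hspow]; norm_num
  have hs9 : D ^ (9 / 10 : ℝ) = s ^ 9 := by rw [hspow]; norm_num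
  have hs3 : D ^ (-(3 / 10) : ℝ) = (s ^ 3)⁻¹ := by rw [hspow, ← Real.rpow_neg hD0.le]; norm_num
  have hs5 : D ^ (1 / 2 : ℝ) = s ^ 5 := by rw [hspow]; norm_num
  rw [hs6] at hbD
  have hb : s ^ 6 ≤ b := by rw [hbD]; exact Nat.le_ceil _
  have hb2 : (b : ℝ) ≤ 2 * s ^ 6 := by
    have h1 := Nat.ceil_lt_add_one (by positivity : 0 ≤ s ^ 6)
    rw [← hbD] at h1
    linarith [one_le_pow₀ hs1 (n := 6)]
  have hb0 : (0 : ℝ) < b := lt_of_lt_of_le (by positivity) hb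
  obtain ⟨l, hldef⟩ : ∃ l, l = √q.lam := ⟨_, rfl⟩
  have hl0 : 0 < l := by rw [hldef]; exact Real.sqrt_pos.2 hl
  have hl2 : l ^ 2 = q.lam := by rw [hldef]; exact Real.sq_sqrt hl.le
  have hl3 : q.lam ^ (-(3 / 2) : ℝ) = (l ^ 3)⁻¹ := by
    rw [hldef, Real.sqrt_eq_rpow, ← Real.rpow_natCast, ← Real.rpow_mul hl.le, ← Real.rpow_neg hl.le]
    norm_num
  rw [hs3] at hεK
  rw [hs9, hs5, hl3]
  rw [← hsD] at hq ho ⊢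
  have hlK : l ≤ K := by
    have h1 := hq.lam_le_of_order hK hτ hτL hKL
    have : l ^ 2 ≤ K ^ 2 := by nlinarith
    exact le_of_sq_le_sq this hK0.le
  set κ := L / τ with hκdef
  -- Chosen so that `s⁶u³` is the claimed rate and `u²ε² = κ²s²/λ` is the size of the accumulated
  -- error.
  obtain ⟨u, hu⟩ : ∃ u, u = κ * s / (l * ε) := ⟨_, rfl⟩
  have hu0 : 0 < u := by rw [hu]; positivity
  obtain ⟨S, hS⟩ : ∃ S, S = 2 + s ^ 10 * κ / (q.lam * ε) := ⟨_, rfl⟩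
  have hS2 : 2 ≤ S := by
    have : 0 ≤ s ^ 10 * κ / (q.lam * ε) := by positivity
    linarith
  rw [← hS]
  have hℓ : 1 / 2 ≤ Real.log S := by
    have := Real.log_le_log (by norm_num) hS2
    linarith [Real.log_two_gt_d9]
  set ℓ := Real.log S with hℓdef
  -- The upper bound on `ε` enters here: it keeps `m^(1/3)`, of order at most `s⁴`, from dominating
  -- the scale `u` of `T^(1/3)`.
  have hsu : s ^ 4 ≤ K ^ 2 * u := by
    rw [hu, mul_div_assoc', le_div_iff₀ (by positivity)]
    calc s ^ 4 * (l * ε) ≤ s ^ 4 * (K * (K * κ * (s ^ 3)⁻¹)) := by gcongr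
      _ = _ := by field_simp
  have huS : u ≤ K * S := by
    have h1 : s * κ / (q.lam * ε) ≤ s ^ 10 * κ / (q.lam * ε) := by
      gcongr; exact le_self_pow₀ hs1 (by norm_num)
    have h2 : s * κ / (q.lam * ε) ≤ S := by linarith
    calc u = l * (s * κ / (q.lam * ε)) := by rw [hu, ← hl2]; field_simp
      _ ≤ K * S := by gcongr
  obtain ⟨T, hT⟩ : ∃ T : ℕ, T = ⌈(A ^ 2 * (ℓ * u)) ^ 3⌉₊ := ⟨_, rfl⟩
  have hT1 : (A ^ 2 * (ℓ * u)) ^ 3 ≤ T := by rw [hT]; exact Nat.le_ceil _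
  have hT2 : (T : ℝ) ≤ (A ^ 2 * (ℓ * u)) ^ 3 + 1 := by
    rw [hT]; exact (Nat.ceil_lt_add_one (by positivity)).le
  have hTpos : (0 : ℝ) < T := lt_of_lt_of_le (by positivity) hT1
  have hw1 : 1 ≤ A ^ 2 * (ℓ * u) := by
    have h1 : 1 ≤ K ^ 2 * u := (one_le_pow₀ hs1).trans hsu
    have h2 : 2 * K ^ 2 ≤ A ^ 2 := by
      calc 2 * K ^ 2 ≤ A * 1 := by
            linarith [hpw (show 2 ≤ 25 by norm_num), pow_pos hK0 25]
        _ ≤ A * A := by gcongr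
        _ = _ := by ring
    calc 1 ≤ K ^ 2 * u := h1
      _ = 2 * K ^ 2 * (1 / 2 * u) := by ring
      _ ≤ _ := by gcongr
  obtain ⟨t, ht⟩ : ∃ t, t = (T : ℝ) ^ (1 / 3 : ℝ) := ⟨_, rfl⟩
  have ht0 : 0 < t := by rw [ht]; exact Real.rpow_pos_of_pos hTpos _
  have ht3 : t ^ 3 = T := by
    rw [ht, ← Real.rpow_natCast, ← Real.rpow_mul hTpos.le]; norm_num
  have hwt : A ^ 2 * (ℓ * u) ≤ t :=
    le_of_pow_le_pow_left₀ three_ne_zero ht0.le (by rw [ht3]; exact hT1)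
  obtain ⟨r, hr⟩ : ∃ r, r = (q.m + T) ^ (1 / 3 : ℝ) := ⟨_, rfl⟩
  have hN := hq.add_pos T
  have hr3 : r ^ 3 = q.m + T := hr ▸ hq.cbrt_cube T
  have hr0 : 0 < r := by rw [hr]; exact Real.rpow_pos_of_pos hN _
  have hr2 : (q.m + T) ^ (2 / 3 : ℝ) = r ^ 2 := by
    rw [hr, ← Real.rpow_natCast, ← Real.rpow_mul hN.le]; norm_num
  have hm2 := hq.two_le_m
  have hm := hq.m_le_of_order hK hτ hτL hLK hs1 hb ho
  have htr : t ≤ r := le_of_pow_le_pow_left₀ three_ne_zero hr0.le (by rw [ht3, hr3]; linarith)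
  refine ⟨T, by exact_mod_cast hTpos, ?_⟩
  rw [hr2]
  refine ⟨?_, ?_, ?_⟩
  · have h1 : (T : ℝ) ≤ 2 * (A ^ 2 * (ℓ * u)) ^ 3 := by
      linarith [one_le_pow₀ hw1 (n := 3)]
    calc 12 * b * (T : ℝ) ≤ 12 * (2 * s ^ 6) * (2 * (A ^ 2 * (ℓ * u)) ^ 3) := by gcongr
      _ = _ := by rw [hu]; field_simp; norm_num
  · have h1 : A ^ 2 * (1 / 2 * u) ≤ r := le_trans (by gcongr) (hwt.trans htr)
    have h2 := pow_le_pow_left₀ (by positivity) h1 2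
    rw [div_le_iff₀ (by positivity)]
    have hA4 : 2 * K ≤ A ^ 4 := by
      refine le_trans ?_ (le_self_pow₀ hA1 (by norm_num))
      linarith [hpw (show 1 ≤ 25 by norm_num), pow_pos hK0 25]
    have h3 : ε ≤ K * κ := by
      refine hεK.trans (mul_le_of_le_one_right (by positivity) ?_)
      exact inv_le_one_of_one_le₀ (one_le_pow₀ hs1)
    have h4 : L * (q.lam * ε) ≤ A ^ 4 * (κ ^ 2 * s ^ 2) / 8 := by
      have h5 := hq.lam_mul_L_le hL
      have h6 : κ * 1 ≤ κ ^ 2 * s ^ 2 := by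
        gcongr
        · exact le_self_pow₀ hκ (by norm_num)
        · exact one_le_pow₀ hs1
      calc L * (q.lam * ε) = (q.lam * L) * ε := by ring
        _ ≤ 1 / 6 * (K * κ) := by gcongr
        _ ≤ 2 * K * (κ * 1) / 8 := by linarith [mul_pos hK0 hκ0]
        _ ≤ _ := by gcongr
    -- `εu²` carries `1/(λε)`, so the claim is `h4`, where `λL ≤ 1/6` and `ε ≤ Kκ` suffice.
    have h7 : L ≤ ε * (A ^ 4 * u ^ 2) / 8 := by
      rw [← mul_le_mul_iff_left₀ (by positivity : 0 < q.lam * ε)]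
      refine h4.trans_eq ?_
      rw [hu, ← hl2]; field_simp
    calc L ≤ ε * (A ^ 4 * u ^ 2) / 8 := h7
      _ = ε / 2 * (A ^ 2 * (1 / 2 * u)) ^ 2 := by ring
      _ ≤ _ := by gcongr
  · intro δ β₁ β₂ hδ hδK hβ₁0 hβ₁ hβ₂0 hβ₂
    have hβ₁' : β₁ ^ 2 ≤ L ^ 2 / r ^ 4 := by
      refine (pow_le_pow_left₀ hβ₁0 hβ₁ 2).trans_eq ?_
      rw [div_pow]; ring
    have hβ₂' : β₂ ^ 2 ≤ L ^ 2 / (s ^ 10 * r ^ 4) := by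
      refine (pow_le_pow_left₀ hβ₂0 hβ₂ 2).trans_eq ?_
      rw [div_pow]; ring
    have hlg1 : 1 ≤ Real.log (q.m + T) := by
      have hT1' : (1 : ℝ) ≤ T := by exact_mod_cast Nat.succ_le_of_lt (by exact_mod_cast hTpos)
      rw [Real.le_log_iff_exp_le hN]
      linarith [Real.exp_one_lt_d9]
    have hlg := log_add_le (A := A) hK (by linarith [hpw (show 9 ≤ 25 by norm_num), pow_pos hK0 25])
      hs0 hS2 hsu huS (by linarith) hm hTpos.le hT2
    have hx : 210 * K ^ 6 * s ^ 4 ≤ 210 * K ^ 8 * u := by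
      calc 210 * K ^ 6 * s ^ 4 ≤ 210 * K ^ 6 * (K ^ 2 * u) := by gcongr
        _ = _ := by ring
    have hrx : r ≤ 210 * K ^ 6 * s ^ 4 + t := by
      refine le_of_pow_le_pow_left₀ three_ne_zero (by positivity) ?_
      rw [hr3]
      have : 0 ≤ 3 * (210 * K ^ 6 * s ^ 4) * t * (210 * K ^ 6 * s ^ 4 + t) := by positivity
      nlinarith
    -- `5200000 = 26 · 200000`, from the target accuracy and `errorBound_le`; the seventeenth power
    -- of `K` comes from `1/k ≤ K`.
    have key := mul_error_le_cube (C₁ := 5200000 * K ^ 17) hA0 (by positivity) hK0 hu0 hℓ hx hrx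
      hwt (by linarith) hlg
      (by
        refine le_trans ?_ (le_self_pow₀ hA1 (by norm_num))
        linarith [hpw (show 17 ≤ 25 by norm_num), pow_pos hK0 25])
      (by
        refine le_trans ?_ (le_self_pow₀ hA1 (by norm_num))
        rw [show 40320 * (5200000 * K ^ 17) * K ^ 8 = 209664000000 * K ^ 25 by ring]
        linarith [pow_pos hK0 25])
    have herr := errorBound_le hK hτ hτL hLK hKL hs1 hb hq ho hδ hδK hlg1
    refine (sum_stepError_le hq hL hτ hb0 (one_le_pow₀ hs1) hr hβ₁' hβ₂').trans ?_
    rw [ht3] at key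
    have hη : q.η T = q.k / r := by rw [Params.η, hr]
    have hkK := ho.inv_k_le hK
    have hu2 : κ ^ 2 * s ^ 2 / q.lam = u ^ 2 * ε ^ 2 := by rw [hu, ← hl2]; field_simp
    rw [hu2] at herr
    calc _ ≤ q.γ * (200000 * K ^ 16 * (u ^ 2 * ε ^ 2) * Real.log (q.m + T)) := by gcongr
      _ = q.k / r * (q.γ * ε ^ 2 / 26)
          * (r * (5200000 * K ^ 16 * (1 / q.k) * (u ^ 2 * Real.log (q.m + T)))) := by
            field_simp; norm_num
      _ ≤ q.k / r * (q.γ * ε ^ 2 / 26)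
          * (r * (5200000 * K ^ 16 * K * (u ^ 2 * Real.log (q.m + T)))) := by
            have : 0 < Real.log (q.m + T) := by linarith
            gcongr
      _ = q.k / r * (q.γ * ε ^ 2 / 26)
          * (r * (5200000 * K ^ 17 * (u ^ 2 * Real.log (q.m + T)))) := by ring
      _ ≤ q.k / r * (q.γ * ε ^ 2 / 26) * T := by gcongr
      _ = _ := by rw [hη]; ring

end AccZOMDA

/-! ### The complexity theorem -/

theorem mainTheorem3 :
    ∃ p : ℕ, ∀ K : ℝ, 1 ≤ K → ∃ C : ℝ, 0 < C ∧
      ∀ (d₁ d₂ b : ℕ) (D κ L τ : ℝ) (q : AccZOMDA.Params) (ε : ℝ),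
        0 < d₁ → 0 < d₂ → D = (d₁ : ℝ) + (d₂ : ℝ) →
        b = ⌈D ^ (3 / 5 : ℝ)⌉₊ →
        0 < τ → τ ≤ L → κ = L / τ → 1 / K ≤ L → L ≤ K →
        q.Admissible L τ D b → q.OfOrder K L τ D b →
        0 < ε → ε ≤ K * κ * D ^ (-(3 / 10) : ℝ) →
        ∃ T : ℕ, 0 < T ∧
          ∀ (Ξ : Type*) [MeasurableSpace Ξ] (P : AccZOMDA.Problem d₁ d₂ Ξ) (μ₁ μ₂ δ : ℝ)
            (x₁ : AccZOMDA.E d₁),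
            0 < μ₁ → μ₁ ≤ 1 / (d₁ * (q.m + T) ^ (2 / 3 : ℝ)) →
            0 < μ₂ → μ₂ ≤ 1 / (D ^ (1 / 2 : ℝ) * d₂ * (q.m + T) ^ (2 / 3 : ℝ)) →
            0 < δ → δ ≤ K →
            P.Assumptions L τ δ μ₁ μ₂ →
            x₁ ∈ P.X → (∀ x ∈ P.X, P.g x₁ - P.g x ≤ K) →
            ∀ (Ω : Type*) [MeasurableSpace Ω] (Pr : MeasureTheory.Measure Ω)
              [MeasureTheory.IsProbabilityMeasure Pr]
              (S : ℕ → Ω → AccZOMDA.Batch d₁ d₂ Ξ b),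
              (∀ t, Measurable (S t)) → ProbabilityTheory.iIndepFun S Pr →
              (∀ t, Pr.map (S t) = AccZOMDA.batchLaw P b) →
              (∀ ω, ((P.run q μ₁ μ₂ x₁ (P.ystar x₁) (fun t => S t ω) T).queries : ℝ) ≤
                C * q.lam ^ (-(3 / 2) : ℝ) * (D ^ (9 / 10 : ℝ) * κ ^ 3 * ε⁻¹ ^ 3)
                  * Real.log (2 + D * κ / (q.lam * ε)) ^ p) ∧
              MeasureTheory.Integrable
                (fun z : Ω × Fin T => P.stationarity L q.γ
                  (P.run q μ₁ μ₂ x₁ (P.ystar x₁) (fun t => S t z.1) z.2).val)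
                (Pr.prod (ProbabilityTheory.uniformOn Set.univ)) ∧
              ∫ z : Ω × Fin T, P.stationarity L q.γ
                  (P.run q μ₁ μ₂ x₁ (P.ystar x₁) (fun t => S t z.1) z.2).val
                ∂(Pr.prod (ProbabilityTheory.uniformOn Set.univ)) ≤ ε := by
  -- `T` is the cube of a multiple of the logarithm, whence the exponent `3`.
  refine ⟨3, fun K hK => ?_⟩
  obtain ⟨C, hC, h⟩ := AccZOMDA.exists_iterations hK
  refine ⟨C, hC, ?_⟩
  intro d₁ d₂ b D κ L τ q ε hd₁ hd₂ hD hbD hτ hτL hκ hKL hLK hq ho hε hεK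
  have hL : 0 < L := by linarith
  have hd₁' : (1 : ℝ) ≤ d₁ := by exact_mod_cast hd₁
  have hd₂' : (1 : ℝ) ≤ d₂ := by exact_mod_cast hd₂
  have hD1 : 1 ≤ D := by linarith
  have hb0 : 0 < b := by rw [hbD, Nat.ceil_pos]; positivity
  have hbD' : (b : ℝ) ≤ D := by
    have := AccZOMDA.natCeil_rpow_le (add_pos hd₁ hd₂)
    rw [hbD]
    rwa [Nat.cast_add, ← hD] at this
  subst hκ
  obtain ⟨T, hT, hquery, hbias, herr⟩ := h b D L τ q ε hD1 hbD hτ hτL hKL hLK hq ho hε hεK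
  refine ⟨T, hT, ?_⟩
  intro Ξ _ P μ₁ μ₂ δ x₁ hμ₁ hμ₁T hμ₂ hμ₂T hδ hδK hA hx₁ hg Ω _ Pr _ S hS hind hlaw
  have hN : 0 < (q.m + T) ^ (2 / 3 : ℝ) := Real.rpow_pos_of_pos (hq.add_pos T) _
  have hDs : 0 < D ^ (1 / 2 : ℝ) := Real.rpow_pos_of_pos (by linarith) _
  have hβ₁ : d₁ * L * μ₁ ≤ L / (q.m + T) ^ (2 / 3 : ℝ) := by
    calc d₁ * L * μ₁ ≤ d₁ * L * (1 / (d₁ * (q.m + T) ^ (2 / 3 : ℝ))) := by gcongr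
      _ = _ := by field_simp
  have hβ₂ : d₂ * L * μ₂ ≤ L / (D ^ (1 / 2 : ℝ) * (q.m + T) ^ (2 / 3 : ℝ)) := by
    calc d₂ * L * μ₂ ≤ d₂ * L * (1 / (D ^ (1 / 2 : ℝ) * d₂ * (q.m + T) ^ (2 / 3 : ℝ))) := by gcongr
      _ = _ := by field_simp
  refine ⟨fun ω => ?_, ?_⟩
  · rw [AccZOMDA.Problem.queries_run]
    refine le_trans ?_ hquery
    -- The run makes `4b + 8bT` queries, at most `12bT` because `T ≥ 1`.
    have : (b : ℝ) * 1 ≤ b * T := by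
      gcongr
      exact_mod_cast hT
    push_cast
    linarith
  · exact hA.integral_stationarity_le hd₁ hd₂ hL hμ₁ hμ₂ hτ hq hτL hb0 hbD' hD hS hind hlaw hx₁
      (by linarith) hg hT hε (hβ₁.trans hbias)
      (herr δ _ _ hδ hδK (by positivity) hβ₁ (by positivity) hβ₂)
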